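/- All graphs are finite, directed and acyclic; parallel edges are allowed, and a path is regarded as a sequence of concatenated edges. For vertices $u,v$, the min-cut between $u$ and $v$ is the minimum number of edges meeting every directed path from $u$ to $v$, and a set of Menger's paths from $u$ to $v$ is a set consisting of the maximum number of pairwise edge-disjoint directed paths from $u$ to $v$. Paths $\beta_1,\dots,\beta_k$ merge at an edge $e$ if $e$ lies on all of them and there are two distinct edges $f\neq g$ that immediately precede $e$ on $\beta_i$ and on $\beta_j$, respectively, for some $i\ne j$. Let $G$ be such a graph with distinct sources $S_1,\dots,S_l$ and distinct sinks $R_1,\dots,R_l$. Given sets $\alpha_i$ of Menger's paths from $S_i$ to $R_i$ $(1\le i\le l)$, let $|G|_{\mathcal M}(\alpha_1,\dots,\alpha_l)$ be the number of edges $e$ at which some paths taken from pairwise different $\alpha_i$'s merge (all mergings at the same edge count once). Let $M(G)$ be the minimum of $|G|_{\mathcal M}(\alpha_1,\dots,\alpha_l)$ over all choices of sets of Menger's paths $\alpha_1,\dots,\alpha_l$, and let $\mathcal M(c_1,\dots,c_l)$ be the supremum of $M(G)$ over all such $G$ in which the min-cut between $S_i$ and $R_i$ is $c_i$ for every $i$.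 Theorem. For every integer $n\ge 1$, $$\mathcal M(1,2,n)=\begin{cases}4n & \text{if } n=2,3,\\ 4n+1 & \text{if } n=1 \text{ or } n\ge 4.\end{cases}$$ -/

import Mathlib

/-- A finite directed multigraph with vertex set `V` and edge set `E`; the edge `e` goes from
`src e` to `tgt e`. -/
structure DiMultigraph where
  V : Type
  E : Type
  finV : Finite V
  finE : Finite E
  src : E → V
  tgt : E → V

namespace DiMultigraph

variable (G : DiMultigraph)

/-- `G.IsPath u v p`: the list of edges `p` is a directed path from `u` to `v`, i.e. consecutive
edges of `p` are concatenated, the first one starts at `u` and the last one ends at `v`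
(the empty list is the degenerate path from a vertex to itself). -/
def IsPath : G.V → G.V → List G.E → Prop
  | u, v, [] => u = v
  | u, v, e :: p => G.src e = u ∧ IsPath (G.tgt e) v p

/-- There is no directed cycle. -/
def Acyclic : Prop := ∀ (u : G.V) (p : List G.E), G.IsPath u u p → p = []

/-- The set of edges `C` is a cut between `u` and `v`: every path from `u` to `v` uses an edge
of `C`. -/
def IsCut (u v : G.V) (C : Finset G.E) : Prop :=
  ∀ p : List G.E, G.IsPath u v p → ∃ e ∈ p, e ∈ C

/-- The min-cut between `u` and `v`: the least number of edges in a cut (`⊤` if there is no cut,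
which happens only for `u = v`). -/
noncomputable def minCut (u v : G.V) : ℕ∞ :=
  ⨅ (C : Finset G.E) (_ : G.IsCut u v C), (C.card : ℕ∞)

/-- A set of pairwise edge-disjoint directed paths from `u` to `v`. -/
def IsEdgeDisjointPaths (u v : G.V) (P : Finset (List G.E)) : Prop :=
  (∀ p ∈ P, G.IsPath u v p) ∧ ∀ p ∈ P, ∀ q ∈ P, p ≠ q → ∀ e ∈ p, e ∉ q

/-- A set of Menger's paths from `u` to `v`: a set consisting of the maximum number of pairwise
edge-disjoint directed paths from `u` to `v`. -/
def IsMengerSet (u v : G.V) (P : Finset (List G.E)) : Prop :=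
  G.IsEdgeDisjointPaths u v P ∧
    ∀ Q : Finset (List G.E), G.IsEdgeDisjointPaths u v Q → Q.card ≤ P.card

/-- The edge `f` is immediately ahead of (i.e. immediately precedes) the edge `e` on `p`. -/
def ImmediatelyAhead (f e : G.E) (p : List G.E) : Prop := [f, e] <:+: p

/-- The paths `β 0, …, β (k - 1)` merge at the edge `e`: all of them contain `e`, and there are
two distinct edges that are immediately ahead of `e` on two of the paths, respectively. -/
def MergeAt {k : ℕ} (β : Fin k → List G.E) (e : G.E) : Prop :=
  (∀ i, e ∈ β i) ∧
    ∃ i j, i ≠ j ∧ ∃ f g, f ≠ g ∧ G.ImmediatelyAhead f e (β i) ∧ G.ImmediatelyAhead g e (β j)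

/-- The edges at which some paths taken from different members of the family `α` of sets of paths
merge. -/
def mergingEdges {l : ℕ} (α : Fin l → Finset (List G.E)) : Set G.E :=
  {e | ∃ (k : ℕ) (σ : Fin k → Fin l) (β : Fin k → List G.E),
    Function.Injective σ ∧ (∀ t, β t ∈ α (σ t)) ∧ G.MergeAt β e}

/-- The number of mergings among paths from different `α i`'s, counted without multiplicity: all
the mergings at the same edge count once. -/
noncomputable def numMergings {l : ℕ} (α : Fin l → Finset (List G.E)) : ℕ∞ :=
  (G.mergingEdges α).encard

end DiMultigraph

/-- An acyclic directed network with `l` distinct sources `S i` and `l` distinct sinks `R i`. -/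
structure UnicastNetwork (l : ℕ) extends DiMultigraph where
  acyclic : toDiMultigraph.Acyclic
  S : Fin l → V
  R : Fin l → V
  S_injective : Function.Injective S
  R_injective : Function.Injective R

namespace UnicastNetwork

/-- `M(G)`: the minimum number of mergings over all choices of sets of Menger's paths `α i` from
`S i` to `R i`. -/
noncomputable def minMergings {l : ℕ} (G : UnicastNetwork l) : ℕ∞ :=
  ⨅ (α : Fin l → Finset (List G.E)) (_ : ∀ i, G.IsMengerSet (G.S i) (G.R i) (α i)),
    G.numMergings α

end UnicastNetwork

/-- `𝓜(c₁, …, c_l)`: the supremum of `M(G)` over all acyclic directed networks `G` with `l`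
distinct sources and `l` distinct sinks for which the min-cut between the `i`-th source and the
`i`-th sink is `c i`. -/
noncomputable def maxMinMergings {l : ℕ} (c : Fin l → ℕ) : ℕ∞ :=
  ⨆ (G : UnicastNetwork l) (_ : ∀ i, G.minCut (G.S i) (G.R i) = (c i : ℕ∞)), G.minMergings

/-!
The number of mergings of a choice of Menger's paths is studied through *routings*: predecessor
functions that encode families of disjoint paths (`IsRouting`). The three families have one, two
and `n` paths.

**Upper bound.** Among all triples of routings one is chosen that uses as few arcs as possible and,
subject to this, as few arcs as possible for the families of two and `n` paths (`Tight`,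
`exists_tight`). Minimality means that no family can be rerouted along the arcs of the others to
save an arc. As in the theory of flows, this amounts to the absence of cycles in a residual
relation, and hence to the existence of a rank function that decreases along residual steps
(`IsRouting.exists_residual_rank`).

Listed in a topological order, the mergings of the last two families form a word, each letter of
which lies on one of two chains and on one of `n` chains. The ranks restrict this word: link a
letter `u` to its predecessor `q u` on the second family and to the successor of `q u` on the first
one. These links form a forest (`card_links_lt`), and counting them shows that there are at most
`3n - 1` letters (`card_le_of_isRank`). The single path of the first family enters each path of the
others at most once, since a second entry could be avoided by following that path
(`Tight.ncard_entries_le`). This gives at most `n + 2` further mergings and `4n + 1` in all.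

If `n` is `2` or `3` and the bound is attained, then all paths are entered, no node is on paths of
all three families, and the ranks also decrease along the steps that the first path makes from one
entry to the next (`Extremal`). There are only a few words with `3n - 1` letters, and a finite
search finds a residual cycle for each of them, for each position of the entries and each order in
which they are visited (`refuted_two`, `refuted_three`, `Extremal.false`).

**Lower bound.** A `Layout` describes three families of chains on a set of points, with ranks as
above. In its network, the ranks give for each family a potential that increases along the edges of
this family only. Therefore every set of Menger's paths uses exactly these edges
(`Layout.exists_mem_of_own`), so that there is a merging at each point
(`Layout.card_le_maxMinMergings`). Suitable layouts are given by tables for `n ≤ 3` and by an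
explicit family for `n ≥ 4` (`Layout.large`).
-/


namespace Merging

open Relation Function

/-! ### Routings and their residual relation -/

/-- A routing from the set of starts `I` to the set of ends `Z` encodes a family of disjoint paths
by its predecessor function: `σ x` is the node before `x` on the path through `x`. A start and a
node which is on no path are fixed by `σ`. -/
structure IsRouting {X : Type*} (I Z : Finset X) (σ : X → X) : Prop where
  start : ∀ x ∈ I, σ x = x
  notEnd : ∀ x, x ∉ I → σ x ∉ Z
  inj : ∀ x, x ∉ I → ∀ y, y ∉ I → σ x = σ y → x = y

/-- `(a, b)` is an arc of the routing `σ`: some path of `σ` goes from `a` directly to `b`. -/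
def Arc {X : Type*} (σ : X → X) (a b : X) : Prop := σ b = a ∧ σ b ≠ b

variable {X : Type*}

/-- A finite relation is ranked, or it contains cycles, given by a permutation `g` of a set. -/
theorem exists_rank_or_cycle [Finite X] (L : X → X → Prop) :
    (∃ ρ : X → ℕ, ∀ u v, L u v → ρ v < ρ u) ∨
      ∃ (S : Set X) (g : X → X), S.Nonempty ∧ Set.BijOn g S S ∧ ∀ v ∈ S, L (g v) v := by
  classical
  by_cases h : ∀ v, ¬ TransGen L v v
  · left
    refine ⟨fun u => Set.ncard {v | TransGen L u v}, fun u v huv => ?_⟩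
    refine Set.ncard_lt_ncard ?_ (Set.toFinite _)
    refine ⟨fun w hw => TransGen.head huv hw, fun hsub => h v ?_⟩
    exact hsub (TransGen.single huv)
  · right
    push Not at h
    obtain ⟨v, hv⟩ := h
    set S0 : Set X := {w | TransGen L v w ∧ TransGen L w v} with hS0
    have hpred : ∀ w ∈ S0, ∃ u ∈ S0, L u w := by
      rintro w ⟨h1, h2⟩
      obtain ⟨u, hu, huw⟩ := TransGen.tail'_iff.1 h1
      refine ⟨u, ⟨?_, TransGen.head huw h2⟩, huw⟩
      rcases reflTransGen_iff_eq_or_transGen.1 hu with h | h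
      · rw [h]; exact hv
      · exact h
    choose! g hg hgL using hpred
    have hmaps : Set.MapsTo g S0 S0 := hg
    refine ⟨S0 ∩ periodicPts g, g, ?_, ⟨?_, ?_, ?_⟩, fun w hw => hgL w hw.1⟩
    · have hninj : ¬ Injective (fun k : ℕ => g^[k] v) := not_injective_infinite_finite _
      rw [Injective] at hninj
      push Not at hninj
      obtain ⟨a, b, hab, hne⟩ := hninj
      wlog hlt : a < b generalizing a b
      · exact this b a hab.symm hne.symm (by omega)
      refine ⟨g^[a] v, hmaps.iterate a ⟨hv, hv⟩, b - a, by omega, ?_⟩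
      change g^[b - a] (g^[a] v) = g^[a] v
      rw [← iterate_add_apply, Nat.sub_add_cancel hlt.le]
      exact hab.symm
    · exact fun w hw => ⟨hg w hw.1, (bijOn_periodicPts g).mapsTo hw.2⟩
    · exact fun a ha b hb hab => (bijOn_periodicPts g).injOn ha.2 hb.2 hab
    · rintro y ⟨hy0, n, hn, hyp⟩
      refine ⟨g^[n - 1] y, ⟨hmaps.iterate _ hy0, n, hn, hyp.apply_iterate _⟩, ?_⟩
      rw [← iterate_succ_apply' g, Nat.succ_eq_add_one, Nat.sub_add_cancel hn]
      exact hyp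

theorem IsRouting.prev_ne {I Z : Finset X} {σ : X → X} (hσ : IsRouting I Z σ) {w : X}
    (hw : σ w ≠ w) (h : σ w ∉ I) : σ (σ w) ≠ σ w := fun e =>
  hw (hσ.inj _ h w (fun hi => hw (hσ.start w hi)) e)

theorem IsRouting.notMem_start {I Z : Finset X} {σ : X → X} (hσ : IsRouting I Z σ) {w : X}
    (hw : σ w ≠ w) : w ∉ I := fun h => hw (hσ.start w h)

/-- If no routing inside `T` avoids an arc that `σ` does not share with `O`, then the residual
relation of `σ` in `T` is well founded: it has a rank function. The residual steps from `u` lead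
back to its predecessor, to the other successors of that predecessor, and, for a node `u` which
`σ` does not visit, to all successors of `u`. A cycle of residual steps would change `σ` into
another routing inside `T`. -/
theorem IsRouting.exists_residual_rank [Finite X] {I Z : Finset X} {σ : X → X}
    (hσ : IsRouting I Z σ) {T O : X → X → Prop} {τ : X → ℕ}
    (hτ : ∀ a b, T a b → τ a < τ b) (hI : ∀ a b, T a b → b ∉ I)
    (hσT : ∀ a b, Arc σ a b → T a b)
    (hrigid : ∀ σ', IsRouting I Z σ' → (∀ a b, Arc σ' a b → T a b) →
      ∀ a b, Arc σ a b → Arc σ' a b ∨ O a b)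
    (hO : ∀ a b c, Arc σ a b → O a b → T a c → c = b) :
    ∃ ρ : X → ℕ, (∀ u, σ u ≠ u → σ u ∉ I → ρ (σ u) < ρ u) ∧
      (∀ u v, σ u ≠ u → T (σ u) v → v ≠ u → ρ v < ρ u) ∧
      (∀ u v, u ∉ I → σ u = u → T u v → ρ v < ρ u) := by
  classical
  rcases exists_rank_or_cycle
    (fun u v : X => v ≠ u ∧ u ∉ I ∧ v ∉ I ∧ (v = σ u ∨ T (σ u) v)) with
    ⟨ρ, hρ⟩ | ⟨S, g, hS, hg, hL⟩
  · refine ⟨ρ, fun u hu hi => hρ u _ ⟨hu, hσ.notMem_start hu, hi, Or.inl rfl⟩,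
      fun u v hu huv hne => hρ u v ⟨hne, hσ.notMem_start hu, hI _ _ huv, Or.inr huv⟩,
      fun u v hi hu huv => hρ u v ⟨?_, hi, hI _ _ huv, Or.inr (hu.symm ▸ huv)⟩⟩
    rintro rfl
    exact lt_irrefl _ (hτ _ _ huv)
  · exfalso
    have hSI : ∀ v ∈ S, v ∉ I := fun v hv => (hL v hv).2.2.1
    -- otherwise the lowest node in `S` visited by `σ`, or, if none is visited, the highest node
    -- in `S`, has no residual step to another node in `S`
    have key : ∃ v ∈ S, σ v ≠ v ∧ ¬ O (σ v) v := by
      by_contra hcon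
      push Not at hcon
      by_cases hon : ∃ w ∈ S, σ w ≠ w
      · obtain ⟨w, ⟨hwS, hw⟩, hmin⟩ := Set.exists_min_image {w | w ∈ S ∧ σ w ≠ w} τ
          (Set.toFinite _) hon
        obtain ⟨v, hvS, hgv⟩ := hg.surjOn hwS
        have hLv := hL v hvS
        rw [hgv] at hLv
        obtain ⟨hne, -, hvI, hv | hv⟩ := hLv
        · have h1 := hmin v ⟨hvS, hv ▸ hσ.prev_ne hw (hv ▸ hvI)⟩
          have h2 := hτ _ _ (hσT (σ w) w ⟨rfl, hw⟩)
          rw [← hv] at h2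
          omega
        · exact hne (hO _ _ _ ⟨rfl, hw⟩ (hcon w hwS hw) hv)
      · push Not at hon
        obtain ⟨w, hwS, hmax⟩ := Set.exists_max_image S τ (Set.toFinite _) hS
        obtain ⟨v, hvS, hgv⟩ := hg.surjOn hwS
        have hLv := hL v hvS
        rw [hgv, hon w hwS] at hLv
        obtain ⟨hne, -, -, hv | hv⟩ := hLv
        · exact hne hv
        · exact absurd (hmax v hvS) (not_le.2 (hτ _ _ hv))
    obtain ⟨v, hvS, hv, hvO⟩ := key
    -- rerouting along the cycle: the node `w` takes over the predecessor of `g w`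
    set σ' : X → X := fun w => if w ∈ S then σ (g w) else σ w with hσ'
    have hin : ∀ w ∈ S, σ' w = σ (g w) := fun w hw => if_pos hw
    have hout : ∀ w, w ∉ S → σ' w = σ w := fun w hw => if_neg hw
    have hgI : ∀ w ∈ S, g w ∉ I := fun w hw => hSI _ (hg.mapsTo hw)
    have hr : IsRouting I Z σ' := by
      refine ⟨fun x hx => ?_, fun x hx => ?_, fun x hx y hy hxy => ?_⟩
      · rw [hout x (fun h => hSI x h hx)]; exact hσ.start x hx
      · by_cases hxS : x ∈ S
        · rw [hin x hxS]; exact hσ.notEnd _ (hgI x hxS)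
        · rw [hout x hxS]; exact hσ.notEnd _ hx
      · by_cases hxS : x ∈ S <;> by_cases hyS : y ∈ S
        · rw [hin x hxS, hin y hyS] at hxy
          exact hg.injOn hxS hyS (hσ.inj _ (hgI x hxS) _ (hgI y hyS) hxy)
        · rw [hin x hxS, hout y hyS] at hxy
          exact absurd (hg.mapsTo hxS) (hσ.inj _ (hgI x hxS) _ hy hxy ▸ hyS)
        · rw [hout x hxS, hin y hyS] at hxy
          exact absurd (hg.mapsTo hyS) (hσ.inj _ hx _ (hgI y hyS) hxy ▸ hxS)
        · rw [hout x hxS, hout y hyS] at hxy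
          exact hσ.inj _ hx _ hy hxy
    have hT : ∀ a b, Arc σ' a b → T a b := by
      rintro a b ⟨rfl, hb⟩
      by_cases hbS : b ∈ S
      · rw [hin b hbS] at hb ⊢
        obtain ⟨-, -, -, h | h⟩ := hL b hbS
        · exact absurd h.symm hb
        · exact h
      · rw [hout b hbS] at hb ⊢
        exact hσT _ _ ⟨rfl, hb⟩
    rcases hrigid σ' hr hT (σ v) v ⟨rfl, hv⟩ with h | h
    · have h1 := h.1
      rw [hin v hvS] at h1
      exact (hL v hvS).1 (hσ.inj _ (hgI v hvS) _ (hSI v hvS) h1).symm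
    · exact hvO h

end Merging

namespace Merging

open Finset

/-! ### Words with two labellings: at most `3n - 1` letters -/

section Words

variable {ι : Type*} [LinearOrder ι]

/-- `y` is the first element after `x` with the same label as `x`. -/
def IsNext {κ : Type*} (s : ι → κ) (x y : ι) : Prop :=
  s x = s y ∧ x < y ∧ ∀ z, s z = s x → x < z → y ≤ z

/-- A rank function certifying that the chains of the labelling `f` cannot be rerouted along the
chains of the labelling `s`. -/
structure IsRank {κ κ' : Type*} (f : ι → κ) (s : ι → κ') (α : ι → ℕ) : Prop where
  chain : ∀ x u, f x = f u → x < u → α x < α u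
  next : ∀ x v u, IsNext s x v → f x = f u → x < u → α v < α u

theorem IsNext.left_unique {κ : Type*} {s : ι → κ} {x x' y : ι} (h : IsNext s x y)
    (h' : IsNext s x' y) : x = x' := by
  obtain ⟨h1, h2, h3⟩ := h
  obtain ⟨h1', h2', h3'⟩ := h'
  by_contra hne
  rcases lt_or_gt_of_ne hne with hlt | hlt
  · exact absurd (h3 x' (h1'.trans h1.symm) hlt) (not_le.2 h2')
  · exact absurd (h3' x (h1.trans h1'.symm) hlt) (not_le.2 h2)

theorem IsNext.right_unique {κ : Type*} {s : ι → κ} {x y y' : ι} (h : IsNext s x y)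
    (h' : IsNext s x y') : y = y' :=
  le_antisymm (h.2.2 y' h'.1.symm h'.2.1) (h'.2.2 y h.1.symm h.2.1)

theorem exists_isNext_left [Fintype ι] {κ : Type*} (s : ι → κ) {y : ι}
    (h : ∃ x, s x = s y ∧ x < y) :
    ∃ x, IsNext s x y := by
  classical
  have hne : (univ.filter (fun x => s x = s y ∧ x < y)).Nonempty := by
    obtain ⟨x, hx⟩ := h
    exact ⟨x, by simp [hx]⟩
  have hm := Finset.max'_mem _ hne
  have hle := fun z hz => Finset.le_max' (univ.filter (fun x => s x = s y ∧ x < y)) z hz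
  set m := Finset.max' _ hne
  simp only [mem_filter, mem_univ, true_and] at hm hle
  refine ⟨m, hm.1, hm.2, fun z hz hmz => ?_⟩
  by_contra hcon
  exact absurd (hle z ⟨hz.trans hm.1, not_le.1 hcon⟩) (not_le.2 hmz)

variable [DecidableEq ι]

/-- A finite set of elements carries at most `|S| - 1` links, where `u` is linked to `q u` and to
the element that follows `q u` on its `f`-chain. The undirected graph of the links is a forest:
an element with two links into it separates them, and without such elements the rank `β` shows
that some element has no link into it. -/
theorem card_links_lt (f : ι → Bool) (q : ι → ι) (β : ι → ℕ) (W : Finset ι)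
    (hq : ∀ y ∈ W, q y < y) (hqf : ∀ y ∈ W, f (q y) ≠ f y)
    (hqi : ∀ y ∈ W, ∀ z ∈ W, q y = q z → y = z)
    (hC : ∀ v ∈ W, ∀ y ∈ W, f v ≠ f y → (q v < y ∧ v ≤ q y) ∨ (y ≤ q v ∧ q y < v))
    (hβ : ∀ u ∈ W, ∀ v ∈ W, (v = q u ∨ IsNext f (q u) v) → β v < β u) (S : Finset ι)
    (hSW : S ⊆ W) (hS : S.Nonempty) (r : ι → ι → Prop) [DecidableRel r]
    (hr : ∀ u v, r u v ↔ (v = q u ∨ IsNext f (q u) v)) :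
    ((S ×ˢ S).filter (fun p => r p.1 p.2)).card + 1 ≤ S.card := by
  induction hk : S.card using Nat.strong_induction_on generalizing S with
  | _ k ih =>
  subst hk
  by_cases hcase : ∃ w ∈ S, ∃ u₁ ∈ S, ∃ u₂ ∈ S, IsNext f (q u₁) w ∧ q u₂ = w
  · obtain ⟨w, hw, u₁, hu₁, u₂, hu₂, h₁, h₂⟩ := hcase
    set P : ι → Prop := fun y => (f y = f w ∧ y < w) ∨ (f y ≠ f w ∧ q y < w) with hP
    have hPw : ¬ P w := by simp [hP]
    have hfu₁ : f u₁ ≠ f w := by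
      have := hqf u₁ (hSW hu₁); rw [h₁.1] at this; exact this.symm
    have hfu₂ : f u₂ ≠ f w := by
      have := hqf u₂ (hSW hu₂); rw [h₂] at this; exact this.symm
    set L := S.filter P with hL
    set R := (S.erase w).filter (fun y => ¬ P y) with hR
    have hL₁ : u₁ ∈ L := by simp only [hL, mem_filter, hP]; exact ⟨hu₁, Or.inr ⟨hfu₁, h₁.2.1⟩⟩
    have hR₂ : u₂ ∈ R := by
      simp only [hR, mem_filter, mem_erase, hP]
      refine ⟨⟨fun h => hfu₂ (h ▸ rfl), hu₂⟩, ?_⟩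
      rintro (h | h)
      · exact hfu₂ h.1
      · rw [h₂] at h; exact lt_irrefl _ h.2
    have hwL : w ∉ L := by simp [hL, hPw]
    have hwR : w ∉ R := by simp [hR]
    have hcard : L.card + R.card + 1 = S.card := by
      have e1 : L = (S.erase w).filter P := by
        ext y
        simp only [hL, mem_filter, mem_erase]
        refine ⟨fun h => ⟨⟨?_, h.1⟩, h.2⟩, fun h => ⟨h.1.2, h.2⟩⟩
        rintro rfl; exact hPw h.2
      rw [e1, hR, card_filter_add_card_filter_not, card_erase_of_mem hw]
      have := card_pos.2 ⟨w, hw⟩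
      omega
    have hLS : insert w L ⊆ S := insert_subset hw (filter_subset _ _)
    have hRS : insert w R ⊆ S := insert_subset hw ((filter_subset _ _).trans (erase_subset _ _))
    have c1 := card_insert_of_notMem hwL
    have c2 := card_insert_of_notMem hwR
    have p1 := card_pos.2 ⟨_, hL₁⟩
    have p2 := card_pos.2 ⟨_, hR₂⟩
    have i1 := ih _ (by omega) (insert w L) (hLS.trans hSW) (insert_nonempty _ _) rfl
    have i2 := ih _ (by omega) (insert w R) (hRS.trans hSW) (insert_nonempty _ _) rfl
    -- no link joins an element before `w` to an element after `w`
    have hsep : ∀ y ∈ S, ∀ v ∈ S, f y = f w → f v ≠ f w →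
        ((y < w ∧ w ≤ q v) ∨ (w < y ∧ q v < w)) → ¬ r y v ∧ ¬ r v y := by
      intro y hy v hv hfy hfv hyv
      have hvy : f v ≠ f y := by rw [hfy]; exact hfv
      have Dvy := hC v (hSW hv) y (hSW hy) hvy
      have Dvw := hC v (hSW hv) w (hSW hw) hfv
      have D1y := hC u₁ (hSW hu₁) y (hSW hy) (by rw [hfy]; exact hfu₁)
      have D1w := hC u₁ (hSW hu₁) w (hSW hw) hfu₁
      have D2y := hC u₂ (hSW hu₂) y (hSW hy) (by rw [hfy]; exact hfu₂)
      have D2w := hC u₂ (hSW hu₂) w (hSW hw) hfu₂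
      rw [h₂] at D2y D2w
      have hw1 := h₁.2.1
      have hwy : q u₁ < y → w ≤ y := h₁.2.2 y (by rw [h₁.1, hfy])
      have hqy := hq y (hSW hy)
      have hqv := hq v (hSW hv)
      have hqw := hq w (hSW hw)
      constructor
      · rw [hr]
        rintro (h | h)
        · rcases hyv with ⟨a, b⟩ | ⟨a, b⟩
          · order
          · rcases Dvw with c | c
            · rcases D2y with d | d
              · rcases D2w with e | e <;> order
              · order
            · order
        · have hb : f u₁ = f (q y) := by
            have := hqf y (hSW hy); rw [hfy] at this
            revert hfu₁ this; cases f u₁ <;> cases f w <;> cases f (q y) <;> simp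
          have hb2 : f u₂ = f (q y) := by
            have := hqf y (hSW hy); rw [hfy] at this
            revert hfu₂ this; cases f u₂ <;> cases f w <;> cases f (q y) <;> simp
          have n1 := h.2.2 u₁ hb
          have n2 := h.2.2 u₂ hb2
          have n0 := h.2.1
          rcases hyv with ⟨a, b⟩ | ⟨a, b⟩
          · by_cases e : q u₁ < y
            · have := hwy e; order
            · rcases D1y with d | d
              · order
              · have := n1 d.2
                rcases D1w with c | c
                · rcases Dvw with g | g <;> order
                · order
          · rcases Dvw with c | c
            · rcases D2y with d | d
              · rcases D2w with e | e <;> order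
              · order
            · order
      · rw [hr]
        rintro (h | h)
        · rcases hyv with ⟨a, b⟩ | ⟨a, b⟩ <;> order
        · have n0 := h.2.1
          have n1 := h.2.2 w (by rw [h.1, hfy])
          rcases hyv with ⟨a, b⟩ | ⟨a, b⟩
          · order
          · have := n1 b; order
    have hopp : ∀ u ∈ S, ∀ v, r u v → f u ≠ f v := by
      intro u hu v h
      rw [hr] at h
      rcases h with h | h
      · rw [h]; exact (hqf u (hSW hu)).symm
      · rw [← h.1]; exact (hqf u (hSW hu)).symm
    -- so every link runs within `insert w L` or within `insert w R`
    have hsub : (S ×ˢ S).filter (fun p => r p.1 p.2) ⊆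
        ((insert w L ×ˢ insert w L).filter (fun p => r p.1 p.2)) ∪
        ((insert w R ×ˢ insert w R).filter (fun p => r p.1 p.2)) := by
      rintro ⟨u, v⟩ h
      simp only [mem_filter, mem_product] at h
      obtain ⟨⟨hu, hv⟩, huv⟩ := h
      have hne := hopp u hu v huv
      have hmem : ∀ z ∈ S, (z ∈ insert w L ↔ z = w ∨ P z) ∧ (z ∈ insert w R ↔ z = w ∨ ¬ P z) := by
        intro z hz
        simp only [mem_insert, hL, hR, mem_filter, mem_erase]
        by_cases hzw : z = w <;> simp [hz, hzw]
      simp only [mem_union, mem_filter, mem_product, (hmem u hu).1, (hmem u hu).2,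
        (hmem v hv).1, (hmem v hv).2, huv, and_true]
      by_cases huw : u = w
      · by_cases hPv : P v <;> simp [huw, hPv]
      by_cases hvw : v = w
      · by_cases hPu : P u <;> simp [hvw, hPu]
      by_cases hPu : P u <;> by_cases hPv : P v
      · simp [hPu, hPv]
      · exfalso
        by_cases hfu : f u = f w
        · have hfv : f v ≠ f w := fun h => hne (hfu.trans h.symm)
          simp only [hP, hfu, hfv, true_and, false_and, or_false, ne_eq, not_true,
            not_false_iff, false_or, not_lt] at hPu hPv
          exact (hsep u hu v hv hfu hfv (Or.inl ⟨hPu, hPv⟩)).1 huv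
        · have hfv : f v = f w := by
            revert hne hfu; cases f u <;> cases f v <;> cases f w <;> simp
          simp only [hP, hfu, hfv, true_and, false_and, or_false, ne_eq, not_true,
            not_false_iff, false_or, not_lt] at hPu hPv
          exact (hsep v hv u hu hfv hfu (Or.inr ⟨lt_of_le_of_ne hPv (Ne.symm hvw), hPu⟩)).2 huv
      · exfalso
        by_cases hfu : f u = f w
        · have hfv : f v ≠ f w := fun h => hne (hfu.trans h.symm)
          simp only [hP, hfu, hfv, true_and, false_and, or_false, ne_eq, not_true,
            not_false_iff, false_or, not_lt] at hPu hPv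
          exact (hsep u hu v hv hfu hfv (Or.inr ⟨lt_of_le_of_ne hPu (Ne.symm huw), hPv⟩)).1 huv
        · have hfv : f v = f w := by
            revert hne hfu; cases f u <;> cases f v <;> cases f w <;> simp
          simp only [hP, hfu, hfv, true_and, false_and, or_false, ne_eq, not_true,
            not_false_iff, false_or, not_lt] at hPu hPv
          exact (hsep v hv u hu hfv hfu (Or.inl ⟨hPv, hPu⟩)).2 huv
      · simp [hPu, hPv]
    have := (card_le_card hsub).trans (card_union_le _ _)
    omega
  · push Not at hcase
    -- the target of a link determines the link
    have hinj : Set.InjOn Prod.snd (((S ×ˢ S).filter (fun p => r p.1 p.2) : Finset _) :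
        Set (ι × ι)) := by
      rintro ⟨u, v⟩ h ⟨u', v'⟩ h' heq
      simp only [coe_filter, mem_product, Set.mem_ofPred_eq, hr] at h h' heq
      subst heq
      obtain ⟨⟨hu, hv⟩, h⟩ := h
      obtain ⟨⟨hu', -⟩, h'⟩ := h'
      have : u = u' := by
        rcases h with h | h <;> rcases h' with h' | h'
        · exact hqi u (hSW hu) u' (hSW hu') (h.symm.trans h')
        · exact absurd h.symm (hcase v hv u' hu' u hu h')
        · exact absurd h'.symm (hcase v hv u hu u' hu' h)
        · exact hqi u (hSW hu) u' (hSW hu') (h.left_unique h')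
      rw [this]
    -- the element of highest rank is not the target of a link
    obtain ⟨w, hw, hmax⟩ := exists_max_image S β hS
    have hsub : ((S ×ˢ S).filter (fun p => r p.1 p.2)).image Prod.snd ⊆ S.erase w := by
      intro v hv
      simp only [mem_image, mem_filter, mem_product, Prod.exists, exists_eq_right] at hv
      obtain ⟨u, ⟨hu, hv⟩, huv⟩ := hv
      refine mem_erase.2 ⟨?_, hv⟩
      rintro rfl
      exact absurd (hβ u (hSW hu) v (hSW hv) ((hr u v).1 huv)) (not_lt.2 (hmax u hu))
    have h1 := card_le_card hsub
    rw [card_image_of_injOn hinj, card_erase_of_mem hw] at h1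
    have := card_pos.2 hS
    omega

variable [Fintype ι]

/-- Two families of chains on the same points, the first consisting of two chains and the second
of `n`, neither of which can be rerouted along the other, have at most `3n - 1` points. -/
theorem card_le_of_isRank (f : ι → Bool) {κ : Type*} [DecidableEq κ] (s : ι → κ) (α β : ι → ℕ)
    (hα : IsRank f s α) (hβ : IsRank s f β) {n : ℕ} (hn : (univ.image s).card ≤ n) :
    Fintype.card ι ≤ 3 * n - 1 := by
  classical
  set W : Finset ι := univ.filter (fun y => ∃ x, s x = s y ∧ x < y) with hWdef
  have hq' : ∀ y, ∃ x, y ∈ W → IsNext s x y := by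
    intro y
    by_cases hy : y ∈ W
    · obtain ⟨x, hx⟩ := exists_isNext_left s (mem_filter.1 hy).2
      exact ⟨x, fun _ => hx⟩
    · exact ⟨y, fun h => absurd h hy⟩
  choose q hqn using hq'
  have hqlt : ∀ y ∈ W, q y < y := fun y hy => (hqn y hy).2.1
  have hqi : ∀ y ∈ W, ∀ z ∈ W, q y = q z → y = z := fun y hy z hz h =>
    (hqn y hy).right_unique (h ▸ hqn z hz)
  -- if `q y` and `y` had the same label under `f`, then `α y < α y`
  have hqf : ∀ y ∈ W, f (q y) ≠ f y := fun y hy h =>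
    lt_irrefl _ (hα.next (q y) y y (hqn y hy) h (hqlt y hy))
  -- if `q v < y` and `q y < v`, then `α v < α y` and `α y < α v`
  have hC : ∀ v ∈ W, ∀ y ∈ W, f v ≠ f y → (q v < y ∧ v ≤ q y) ∨ (y ≤ q v ∧ q y < v) := by
    intro v hv y hy hvy
    have e1 : f (q v) = f y := by
      have := hqf v hv
      revert this hvy; cases f v <;> cases f y <;> cases f (q v) <;> simp
    have e2 : f (q y) = f v := by
      have := hqf y hy
      revert this hvy; cases f v <;> cases f y <;> cases f (q y) <;> simp
    have h1 := hqlt v hv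
    have h2 := hqlt y hy
    by_cases a : q v < y
    · by_cases b : v ≤ q y
      · exact Or.inl ⟨a, b⟩
      · have := hα.next (q v) v y (hqn v hv) e1 a
        have := hα.next (q y) y v (hqn y hy) e2 (not_le.1 b)
        omega
    · right; constructor <;> order
  have hlink : ∀ u ∈ W, ∀ v ∈ W, (v = q u ∨ IsNext f (q u) v) → β v < β u := by
    rintro u hu v - (h | h)
    · rw [h]; exact hβ.chain _ _ (hqn u hu).1 (hqlt u hu)
    · exact hβ.next _ _ _ h (hqn u hu).1 (hqlt u hu)
  -- the complement of `W` has one element for each label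
  have hWc : (univ \ W).card ≤ n := by
    refine le_trans ?_ hn
    refine card_le_card_of_injOn s (fun x _ => mem_image_of_mem _ (mem_univ _)) ?_
    intro x hx y hy hxy
    simp only [hWdef, coe_sdiff, Set.mem_sdiff, coe_filter, mem_univ, true_and,
      Set.mem_ofPred_eq, coe_univ, Set.mem_univ, not_exists, not_and] at hx hy
    by_contra hne
    rcases lt_or_gt_of_ne hne with h | h
    · exact hy x hxy h
    · exact hx y hxy.symm h
  have hcard : W.card + (univ \ W).card = Fintype.card ι := by
    rw [card_sdiff_of_subset (subset_univ _), card_univ]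
    have := card_le_univ W
    omega
  rcases W.eq_empty_or_nonempty with hW | hW
  · rw [hW] at hcard hWc
    simp only [card_empty, zero_add] at hcard
    omega
  have hmain := card_links_lt f q β W hqlt hqf hqi hC hlink W subset_rfl hW
    (fun u v => v = q u ∨ IsNext f (q u) v) (fun _ _ => Iff.rfl)
  set W₁ := W.filter (fun u => q u ∈ W) with hW₁
  set W₂ := W.filter (fun u => ∃ v ∈ W, IsNext f (q u) v) with hW₂
  have hne : Nonempty ι := ⟨hW.choose⟩
  have c₁ : (W.filter (fun u => ¬ q u ∈ W)).card ≤ (univ \ W).card := by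
    refine card_le_card_of_injOn q (fun u hu => ?_) (fun u hu v hv h => ?_)
    · have := (mem_filter.1 hu).2; simp [this]
    · exact hqi u (mem_filter.1 hu).1 v (mem_filter.1 hv).1 h
  have c₂ : (W.filter (fun u => ¬ ∃ v ∈ W, IsNext f (q u) v)).card ≤ (univ \ W).card := by
    -- the very first element is `s`-initial and is not the successor of any element; it is the
    -- image of the only `u` for which `q u` is the last element of an `f`-chain
    obtain ⟨b, -, hb⟩ := exists_min_image (univ : Finset ι) id univ_nonempty
    obtain ⟨m, -, hm⟩ := exists_max_image (univ : Finset ι) id univ_nonempty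
    have hbW : b ∉ W := by
      simp only [hWdef, mem_filter, mem_univ, true_and, not_exists, not_and, not_lt]
      exact fun x _ => hb x (mem_univ _)
    have hnx : ∀ u, ∃ v, (∃ v', IsNext f (q u) v') → IsNext f (q u) v := by
      intro u
      by_cases h : ∃ v', IsNext f (q u) v'
      · exact ⟨h.choose, fun _ => h.choose_spec⟩
      · exact ⟨u, fun h' => absurd h' h⟩
    choose nx hnx using hnx
    have hlast : ∀ u ∈ W, (¬ ∃ v', IsNext f (q u) v') → f (q u) ≠ f m ∧
        ∀ z, f z = f (q u) → z ≤ q u := by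
      intro u hu h
      have hz : ∀ z, f z = f (q u) → z ≤ q u := by
        intro z hz
        by_contra hcon
        have hne : (univ.filter (fun z => f z = f (q u) ∧ q u < z)).Nonempty :=
          ⟨z, by simp [hz, not_le.1 hcon]⟩
        obtain ⟨y, hy, hymin⟩ := exists_min_image _ id hne
        simp only [mem_filter, mem_univ, true_and, id] at hy hymin
        exact h ⟨y, hy.1.symm, hy.2, fun z hz hlt => hymin z ⟨hz, hlt⟩⟩
      refine ⟨fun he => ?_, hz⟩
      have h1 := hz m he.symm
      have h2 := hqlt u hu
      have h3 := hm u (mem_univ _)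
      simp only [id] at h3
      order
    refine card_le_card_of_injOn (fun u => if ∃ v', IsNext f (q u) v' then nx u else b)
      (fun u hu => ?_) (fun u hu v hv h => ?_)
    · have hu2 := (mem_filter.1 hu).2
      simp only [coe_sdiff, coe_univ, Set.mem_sdiff, Set.mem_univ, true_and, mem_coe]
      by_cases hex : ∃ v', IsNext f (q u) v'
      · rw [if_pos hex]
        exact fun h => hu2 ⟨_, h, hnx u hex⟩
      · rw [if_neg hex]; exact hbW
    · have huW := (mem_filter.1 hu).1
      have hvW := (mem_filter.1 hv).1
      have hbn : ∀ x y, IsNext f x y → y ≠ b := by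
        rintro x y hxy rfl
        exact absurd (hb x (mem_univ _)) (not_le.2 hxy.2.1)
      simp only at h
      by_cases hexu : ∃ v', IsNext f (q u) v' <;> by_cases hexv : ∃ v', IsNext f (q v) v'
      · rw [if_pos hexu, if_pos hexv] at h
        exact hqi u huW v hvW ((hnx u hexu).left_unique (h ▸ hnx v hexv))
      · rw [if_pos hexu, if_neg hexv] at h
        exact absurd h (hbn _ _ (hnx u hexu))
      · rw [if_neg hexu, if_pos hexv] at h
        exact absurd h.symm (hbn _ _ (hnx v hexv))
      · obtain ⟨hu1, hu2⟩ := hlast u huW hexu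
        obtain ⟨hv1, hv2⟩ := hlast v hvW hexv
        have hfe : f (q u) = f (q v) := by
          revert hu1 hv1; cases f (q u) <;> cases f (q v) <;> cases f m <;> simp
        exact hqi u huW v hvW (le_antisymm (hv2 _ hfe) (hu2 _ hfe.symm))
  have e₁ : W₁.card + (W.filter (fun u => ¬ q u ∈ W)).card = W.card :=
    card_filter_add_card_filter_not _
  have e₂ : W₂.card + (W.filter (fun u => ¬ ∃ v ∈ W, IsNext f (q u) v)).card = W.card :=
    card_filter_add_card_filter_not _
  -- there are at least `|W₁| + |W₂|` links, and both terms are at least `2 |W| - |ι|`; since there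
  -- are at most `|W| - 1` links, `3 |W| ≤ 2 |ι| - 1`, where `|ι| ≤ |W| + n`
  have hlow : W₁.card + W₂.card ≤
      ((W ×ˢ W).filter (fun p => p.2 = q p.1 ∨ IsNext f (q p.1) p.2)).card := by
    have hnx : ∀ u, ∃ v, u ∈ W₂ → v ∈ W ∧ IsNext f (q u) v := by
      intro u
      by_cases h : u ∈ W₂
      · obtain ⟨v, hv⟩ := (mem_filter.1 h).2
        exact ⟨v, fun _ => hv⟩
      · exact ⟨u, fun h' => absurd h' h⟩
    choose nx hnx using hnx
    have hd : Disjoint (W₁.image (fun u => (u, q u))) (W₂.image (fun u => (u, nx u))) := by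
      rw [disjoint_left]
      rintro p hp hp'
      obtain ⟨u, hu, rfl⟩ := mem_image.1 hp
      obtain ⟨u', hu', h⟩ := mem_image.1 hp'
      simp only [Prod.mk.injEq] at h
      obtain ⟨rfl, h⟩ := h
      exact absurd (hnx u' hu').2.2.1 (by rw [h]; exact lt_irrefl _)
    have k₁ : (W₁.image (fun u => (u, q u))).card = W₁.card :=
      card_image_of_injective _ (fun a b h => (Prod.mk.inj h).1)
    have k₂ : (W₂.image (fun u => (u, nx u))).card = W₂.card :=
      card_image_of_injective _ (fun a b h => (Prod.mk.inj h).1)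
    rw [← k₁, ← k₂, ← card_union_of_disjoint hd]
    refine card_le_card (union_subset ?_ ?_)
    · intro p hp
      obtain ⟨u, hu, rfl⟩ := mem_image.1 hp
      have := mem_filter.1 hu
      simp [this.1, this.2]
    · intro p hp
      obtain ⟨u, hu, rfl⟩ := mem_image.1 hp
      have h1 := mem_filter.1 hu
      have h2 := hnx u hu
      simp [h1.1, h2.1, h2.2]
  omega

end Words

end Merging

namespace Merging

open Relation Finset

/-! ### Chains of a routing -/

section Chains

variable {X : Type*} {I Z : Finset X} {σ δ : X → X} {τ : X → ℕ}

/-- `Before σ x y`: some path of `σ` visits `x` and, later, `y`. -/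
abbrev Before (σ : X → X) : X → X → Prop := TransGen (Arc σ)

/-- The start of the path of `σ` that visits `x`. -/
noncomputable def root (I : Finset X) (σ : X → X) (x : X) : X := by
  classical
  exact if h : ∃ r ∈ I, ReflTransGen (Arc σ) r x then h.choose else x

theorem Before.lt {T : X → X → Prop} (hτ : ∀ a b, T a b → τ a < τ b) {x y : X}
    (h : TransGen T x y) : τ x < τ y := by
  induction h with
  | single h => exact hτ _ _ h
  | tail _ h ih => exact ih.trans (hτ _ _ h)

theorem IsRouting.exists_start (hσ : IsRouting I Z σ) (hτ : ∀ a b, Arc σ a b → τ a < τ b) (x : X)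
    (hx : σ x ≠ x) : ∃ r ∈ I, ReflTransGen (Arc σ) r x := by
  induction hk : τ x using Nat.strong_induction_on generalizing x with
  | _ k ih =>
  subst hk
  by_cases h : σ x ∈ I
  · exact ⟨_, h, ReflTransGen.single ⟨rfl, hx⟩⟩
  · obtain ⟨r, hr, hrx⟩ := ih _ (hτ _ _ ⟨rfl, hx⟩) (σ x) (hσ.prev_ne hx h) rfl
    exact ⟨r, hr, hrx.tail ⟨rfl, hx⟩⟩

theorem IsRouting.root_spec (hσ : IsRouting I Z σ) (hτ : ∀ a b, Arc σ a b → τ a < τ b) {x : X}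
    (hx : σ x ≠ x) : root I σ x ∈ I ∧ ReflTransGen (Arc σ) (root I σ x) x := by
  have h := hσ.exists_start hτ x hx
  rw [root, dif_pos h]
  exact h.choose_spec

theorem arc_leftUnique {a b c : X} (h : Arc σ a c) (h' : Arc σ b c) : a = b :=
  h.1.symm.trans h'.1

theorem IsRouting.arc_rightUnique (hσ : IsRouting I Z σ) {a b c : X} (h : Arc σ a b)
    (h' : Arc σ a c) : b = c :=
  hσ.inj _ (hσ.notMem_start h.2) _ (hσ.notMem_start h'.2) (h.1.trans h'.1.symm)

theorem IsRouting.root_eq (hσ : IsRouting I Z σ) {r x : X} (hr : r ∈ I)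
    (hrx : ReflTransGen (Arc σ) r x) : root I σ x = r := by
  have h : ∃ r ∈ I, ReflTransGen (Arc σ) r x := ⟨r, hr, hrx⟩
  rw [root, dif_pos h]
  obtain ⟨h1, h2⟩ := h.choose_spec
  have key : ∀ a b, a ∈ I → b ∈ I → ReflTransGen (Arc σ) a b → a = b := by
    intro a b _ hb hab
    rcases hab.cases_tail with h | ⟨c, -, h⟩
    · exact h.symm
    · exact absurd hb (hσ.notMem_start h.2)
  have htot := ReflTransGen.total_of_right_unique (r := Function.swap (Arc σ))
    (fun _ _ _ h h' => arc_leftUnique h h') (reflTransGen_swap.2 h2) (reflTransGen_swap.2 hrx)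
  rcases htot with h | h
  · exact (key _ _ hr h1 (reflTransGen_swap.1 h)).symm
  · exact key _ _ h1 hr (reflTransGen_swap.1 h)

theorem IsRouting.root_eq_of_chain (hσ : IsRouting I Z σ) (hτ : ∀ a b, Arc σ a b → τ a < τ b)
    {x y : X} (hx : σ x ≠ x) (hxy : ReflTransGen (Arc σ) x y) : root I σ x = root I σ y := by
  obtain ⟨h1, h2⟩ := hσ.root_spec hτ hx
  exact (hσ.root_eq h1 (h2.trans hxy)).symm

theorem IsRouting.before_of_root_eq (hσ : IsRouting I Z σ) (hτ : ∀ a b, Arc σ a b → τ a < τ b)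
    {x y : X} (hx : σ x ≠ x) (hy : σ y ≠ y) (h : root I σ x = root I σ y) (hlt : τ x < τ y) :
    Before σ x y := by
  obtain ⟨-, h1⟩ := hσ.root_spec hτ hx
  obtain ⟨-, h2⟩ := hσ.root_spec hτ hy
  rw [← h] at h2
  rcases ReflTransGen.total_of_right_unique (r := Arc σ)
    (fun _ _ _ h h' => hσ.arc_rightUnique h h') h1 h2 with h | h
  · rcases reflTransGen_iff_eq_or_transGen.1 h with h | h
    · rw [h] at hlt; exact absurd hlt (lt_irrefl _)
    · exact h
  · rcases reflTransGen_iff_eq_or_transGen.1 h with h | h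
    · rw [h] at hlt; exact absurd hlt (lt_irrefl _)
    · exact absurd (Before.lt hτ h) (by omega)

theorem Before.prev_ne {x y : X} (h : Before σ x y) : σ y ≠ y := by
  obtain ⟨c, -, h⟩ := TransGen.tail'_iff.1 h
  exact h.2

/-- `ρ` ranks the residual relation of the routing `σ` in `T`. -/
structure IsResidualRank (I : Finset X) (σ : X → X) (T : X → X → Prop) (ρ : X → ℕ) : Prop where
  back : ∀ u, σ u ≠ u → σ u ∉ I → ρ (σ u) < ρ u
  side : ∀ u v, σ u ≠ u → T (σ u) v → v ≠ u → ρ v < ρ u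
  off : ∀ u v, u ∉ I → σ u = u → T u v → ρ v < ρ u

variable {T : X → X → Prop} {ρ : X → ℕ}

theorem IsResidualRank.le_of_chain (hρ : IsResidualRank I σ T ρ) {x y : X} (hx : x ∉ I)
    (hσ : IsRouting I Z σ) (h : ReflTransGen (Arc σ) x y) : ρ x ≤ ρ y := by
  induction h with
  | refl => exact le_rfl
  | @tail b c hb hbc ih =>
    obtain ⟨rfl, hc⟩ := hbc
    have hbI : σ c ∉ I := by
      rcases hb.cases_tail with h | ⟨d, -, h⟩
      · rw [h]; exact hx
      · exact hσ.notMem_start h.2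
    exact ih.trans (hρ.back c hc hbI).le

theorem IsResidualRank.lt_of_before (hρ : IsResidualRank I σ T ρ) {x y : X} (hx : x ∉ I)
    (hσ : IsRouting I Z σ) (h : Before σ x y) : ρ x < ρ y := by
  obtain ⟨c, hc, rfl, hy⟩ := TransGen.tail'_iff.1 h
  have hcI : σ y ∉ I := by
    rcases hc.cases_tail with h | ⟨d, -, h⟩
    · rw [h]; exact hx
    · exact hσ.notMem_start h.2
  exact (hρ.le_of_chain hx hσ hc).trans_lt (hρ.back y hy hcI)

/-- The rank drops along a path of `δ` that starts off `σ` and meets no merging on the way. -/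
theorem IsResidualRank.lt_of_off (hρ : IsResidualRank I σ T ρ) (hσ : IsRouting I Z σ)
    (hI : ∀ a b, T a b → b ∉ I) (hδT : ∀ a b, Arc δ a b → T a b) {x v : X} (hxv : Before δ x v)
    (hmid : ∀ b, Before δ x b → Before δ b v → σ b ≠ b → σ b = δ b)
    (hxI : x ∉ I) (hx : σ x = x) : ρ v < ρ x := by
  induction hxv using TransGen.head_induction_on with
  | single h => exact hρ.off _ _ hxI hx (hδT _ _ h)
  | @head a c hac hcv ih =>
    have hcI := hI _ _ (hδT _ _ hac)
    have hc : σ c = c := by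
      by_contra hne
      have h1 := hmid c (TransGen.single hac) hcv hne
      have h2 : σ c = a := h1.trans hac.1
      exact hσ.prev_ne hne (by rw [h2]; exact hxI) (by rw [h2]; exact hx)
    exact (ih (fun b hb hbv => hmid b (TransGen.head hac hb) hbv) hcI hc).trans
      (hρ.off _ _ hxI hx (hδT _ _ hac))

/-- If a path of `δ` leads from `x` to a merging `v` without mergings in between, then `v` has
smaller rank than any merging `u` after `x` on the path of `σ` through `x`. -/
theorem IsResidualRank.lt_of_side (hρ : IsResidualRank I σ T ρ) (hσ : IsRouting I Z σ)
    (hI : ∀ a b, T a b → b ∉ I) (hδT : ∀ a b, Arc δ a b → T a b) {x v u : X}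
    (hxv : Before δ x v)
    (hmid : ∀ b, Before δ x b → Before δ b v → σ b ≠ b → σ b = δ b)
    (hv : σ v ≠ v → σ v ≠ δ v) (hxu : Before σ x u) (hu : δ u ≠ u → σ u ≠ δ u) : ρ v < ρ u := by
  have hside : ∀ a c, Arc δ a c → Before σ a u → ¬ Arc σ a c → ρ c < ρ u := by
    intro a c hac hau hn
    obtain ⟨u₁, h1, h2⟩ := TransGen.head'_iff.1 hau
    have hne : c ≠ u₁ := by rintro rfl; exact hn h1
    have h3 := hρ.side u₁ c h1.2 (by rw [h1.1]; exact hδT _ _ hac) hne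
    exact h3.trans_le (hρ.le_of_chain (hσ.notMem_start h1.2) hσ h2)
  induction hxv using TransGen.head_induction_on with
  | single h => exact hside _ _ h hxu (fun h' => hv h'.2 (h'.1.trans h.1.symm))
  | @head a c hac hcv ih =>
    by_cases hc : Arc σ a c
    · obtain ⟨u₁, h1, h2⟩ := TransGen.head'_iff.1 hxu
      obtain rfl := hσ.arc_rightUnique hc h1
      rcases reflTransGen_iff_eq_or_transGen.1 h2 with h | h
      · subst h
        exact absurd (hc.1.trans hac.1.symm) (hu hac.2)
      · exact ih (fun b hb hbv => hmid b (TransGen.head hac hb) hbv) h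
    · have hcσ : σ c = c := by
        by_contra hne
        exact hc ⟨(hmid c (TransGen.single hac) hcv hne).trans hac.1, hne⟩
      exact (hρ.lt_of_off hσ hI hδT hcv (fun b hb hbv => hmid b (TransGen.head hac hb) hbv)
        (hI _ _ (hδT _ _ hac)) hcσ).trans (hside _ _ hac hxu hc)

end Chains

/-! ### Mergings of two rigid routings -/

/-- The nodes at which the routings `σ` and `δ` merge. -/
def merges {X : Type*} (σ δ : X → X) : Set X := {x | σ x ≠ x ∧ δ x ≠ x ∧ σ x ≠ δ x}

/-- The residual rank of a routing, restricted to its mergings with another one, decreases along the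
residual steps of words: no merging lies between consecutive mergings on a path. -/
theorem isRank_of_residual {X : Type*} {I Z J Y : Finset X} {σ δ : X → X} {T : X → X → Prop}
    {τ ρ : X → ℕ} (hσ : IsRouting I Z σ) (hδ : IsRouting J Y δ)
    (hτ : ∀ a b, T a b → τ a < τ b) (hI : ∀ a b, T a b → b ∉ I)
    (hσT : ∀ a b, Arc σ a b → T a b) (hδT : ∀ a b, Arc δ a b → T a b)
    (hρ : IsResidualRank I σ T ρ) [LinearOrder (merges σ δ)]
    (hord : ∀ x y : merges σ δ, x < y ↔ τ x < τ y) {κ : Type*} (f : merges σ δ → κ)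
    (hf : ∀ x y, f x = f y ↔ root I σ x = root I σ y) {κ' : Type*} (s : merges σ δ → κ')
    (hs : ∀ x y, s x = s y ↔ root J δ x = root J δ y) :
    IsRank f s (fun x => ρ x) := by
  have hτσ : ∀ a b, Arc σ a b → τ a < τ b := fun a b h => hτ a b (hσT a b h)
  have hτδ : ∀ a b, Arc δ a b → τ a < τ b := fun a b h => hτ a b (hδT a b h)
  have hb : ∀ x y, f x = f y → x < y → Before σ (x : X) y := fun x y h hlt =>
    hσ.before_of_root_eq hτσ x.2.1 y.2.1 ((hf _ _).1 h) ((hord x y).1 hlt)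
  refine ⟨fun x u hxu hlt => hρ.lt_of_before (hσ.notMem_start x.2.1) hσ (hb x u hxu hlt),
    fun x v u hxv hxu hlt => ?_⟩
  refine hρ.lt_of_side hσ hI hδT
    (hδ.before_of_root_eq hτδ x.2.2.1 v.2.2.1 ((hs _ _).1 hxv.1) ((hord x v).1 hxv.2.1))
    (fun b hxb hbv hbσ => ?_) (fun _ => v.2.2.2) (hb x u hxu hlt) (fun _ => u.2.2.2)
  by_contra hne
  have hbM : b ∈ merges σ δ := ⟨hbσ, hxb.prev_ne, hne⟩
  have h1 := hxv.2.2 ⟨b, hbM⟩ ((hs _ _).2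
    (hδ.root_eq_of_chain hτδ x.2.2.1 hxb.to_reflTransGen).symm)
    ((hord _ _).2 (Before.lt hτδ hxb))
  exact absurd ((hord ⟨b, hbM⟩ v).2 (Before.lt hτδ hbv)) (not_lt.2 h1)

/-- Two routings with two paths and `n` paths, neither of which can be rerouted along the other,
merge at no more than `3n - 1` nodes. -/
theorem ncard_merges_le {X : Type*} [Finite X] {I Z J Y : Finset X} {σ δ : X → X}
    {τ α β : X → ℕ} (hσ : IsRouting I Z σ) (hδ : IsRouting J Y δ) (hinj : Function.Injective τ)
    (hτ : ∀ a b, Arc σ a b ∨ Arc δ a b → τ a < τ b)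
    (hI : ∀ a b, Arc σ a b ∨ Arc δ a b → b ∉ I) (hJ : ∀ a b, Arc σ a b ∨ Arc δ a b → b ∉ J)
    (hα : IsResidualRank I σ (fun a b => Arc σ a b ∨ Arc δ a b) α)
    (hβ : IsResidualRank J δ (fun a b => Arc σ a b ∨ Arc δ a b) β)
    (hI2 : I.card ≤ 2) :
    (merges σ δ).ncard ≤ 3 * J.card - 1 := by
  classical
  have : Fintype X := Fintype.ofFinite X
  let _ : LinearOrder (merges σ δ) := LinearOrder.lift' (fun x => τ x)
    (fun x y h => Subtype.ext (hinj h))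
  have hord : ∀ x y : merges σ δ, x < y ↔ τ x < τ y := fun _ _ => Iff.rfl
  have hτσ : ∀ a b, Arc σ a b → τ a < τ b := fun a b h => hτ a b (Or.inl h)
  have hτδ : ∀ a b, Arc δ a b → τ a < τ b := fun a b h => hτ a b (Or.inr h)
  -- a start which tells the at most two paths of `σ` apart
  obtain ⟨r₀, hr₀⟩ : ∃ r₀ : Option X, ∀ x ∈ I, ∀ y ∈ I,
      ((some x = r₀) ↔ (some y = r₀)) → x = y := by
    rcases I.eq_empty_or_nonempty with h | ⟨r, hr⟩
    · exact ⟨none, by simp [h]⟩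
    · refine ⟨some r, fun x hx y hy hxy => ?_⟩
      have hc : (I.erase r).card ≤ 1 := by rw [card_erase_of_mem hr]; omega
      by_cases h1 : x = r
      · have h2 : y = r := by simpa [h1] using hxy
        rw [h1, h2]
      · have h2 : y ≠ r := by intro h; apply h1; simpa [h] using hxy
        exact card_le_one.1 hc x (by simp [h1, hx]) y (by simp [h2, hy])
  set f : merges σ δ → Bool := fun x => decide (some (root I σ x) = r₀) with hfdef
  have hf : ∀ x y, f x = f y ↔ root I σ x = root I σ y := by
    intro x y
    refine ⟨fun h => hr₀ _ (hσ.root_spec hτσ x.2.1).1 _ (hσ.root_spec hτσ y.2.1).1 ?_, fun h => ?_⟩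
    · simpa [hfdef, decide_eq_decide] using h
    · simp only [hfdef, h]
  set s : merges σ δ → X := fun x => root J δ x
  have hA : IsRank f s (fun x => α x) := isRank_of_residual hσ hδ hτ hI (fun _ _ => Or.inl)
    (fun _ _ => Or.inr) hα hord f hf s (fun _ _ => Iff.rfl)
  have hB : IsRank s f (fun x => β x) := by
    let e : merges δ σ ≃ merges σ δ := Equiv.subtypeEquivRight (fun x =>
      ⟨fun h => ⟨h.2.1, h.1, h.2.2.symm⟩, fun h => ⟨h.2.1, h.1, h.2.2.symm⟩⟩)
    let _ : LinearOrder (merges δ σ) := LinearOrder.lift' e e.injective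
    have := isRank_of_residual hδ hσ hτ hJ (fun _ _ => Or.inr) (fun _ _ => Or.inl) hβ
      (fun _ _ => Iff.rfl) (fun x => s (e x)) (fun _ _ => Iff.rfl) (fun x => f (e x))
      (fun x y => hf (e x) (e y))
    refine ⟨fun x u h1 h2 => this.chain (e.symm x) (e.symm u) h1 h2, fun x v u h1 h2 h3 =>
      this.next (e.symm x) (e.symm v) (e.symm u) ⟨h1.1, h1.2.1, fun z hz hlt => ?_⟩ h2 h3⟩
    exact h1.2.2 (e z) hz hlt
  have hn : (univ.image s).card ≤ J.card := by
    refine card_le_card fun y hy => ?_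
    obtain ⟨x, -, rfl⟩ := mem_image.1 hy
    exact (hδ.root_spec hτδ x.2.2.1).1
  have := card_le_of_isRank f s _ _ hA hB hn
  rwa [← Nat.card_eq_fintype_card] at this

end Merging

namespace Merging

open Relation Finset

/-! ### Minimal triples of routings -/

section Triples

variable {X : Type*} {I Z : Fin 3 → Finset X} {σ : Fin 3 → X → X} {τ : X → ℕ}

/-- The arcs used by a triple of routings. -/
def Tot (σ : Fin 3 → X → X) (a b : X) : Prop := ∃ c, Arc (σ c) a b

/-- The arcs used by the last two routings of a triple. -/
def Hor (σ : Fin 3 → X → X) (a b : X) : Prop := Arc (σ 1) a b ∨ Arc (σ 2) a b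

/-- A triple of routings, the first of which has at most one path, that uses a minimal set of
arcs and, subject to this, a minimal set of arcs for the last two routings. -/
structure Tight (I Z : Fin 3 → Finset X) (σ : Fin 3 → X → X) (τ : X → ℕ) : Prop where
  routing : ∀ c, IsRouting (I c) (Z c) (σ c)
  disj : ∀ c d, ∀ x ∈ I c, x ∈ I d → c = d
  start : ∀ a b, Tot σ a b → ∀ c, b ∉ I c
  lt : ∀ a b, Tot σ a b → τ a < τ b
  tot_min : ∀ σ' : Fin 3 → X → X, (∀ c, IsRouting (I c) (Z c) (σ' c)) →
    (∀ a b, Tot σ' a b → Tot σ a b) → ∀ a b, Tot σ a b → Tot σ' a b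
  hor_min : ∀ σ' : Fin 3 → X → X, (∀ c, IsRouting (I c) (Z c) (σ' c)) →
    (∀ a b, Tot σ' a b → Tot σ a b) → (∀ a b, Hor σ' a b → Hor σ a b) →
    ∀ a b, Hor σ a b → Hor σ' a b
  card_zero : (I 0).card ≤ 1
  card_end : (I 0).card = (Z 0).card

theorem tot_iff {a b : X} : Tot σ a b ↔ Arc (σ 0) a b ∨ Hor σ a b := by
  simp [Tot, Hor, Fin.exists_fin_succ]

theorem Hor.tot {a b : X} (h : Hor σ a b) : Tot σ a b := tot_iff.2 (Or.inr h)

/-- A walk from `i` to `z` contains a path, that is, a routing from `{i}` to `{z}`. -/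
theorem exists_routing_of_walk {T : X → X → Prop} (hτ : ∀ a b, T a b → τ a < τ b) {i z : X}
    (hi : ∀ a, ¬ T a i) (h : ReflTransGen T i z) :
    ∃ σ : X → X, IsRouting {i} {z} σ ∧ ∀ a b, Arc σ a b → T a b := by
  classical
  suffices ∃ σ : X → X, IsRouting {i} {z} σ ∧ (∀ a b, Arc σ a b → T a b) ∧
      ∀ x, σ x ≠ x → τ x ≤ τ z by
    obtain ⟨σ, h1, h2, -⟩ := this
    exact ⟨σ, h1, h2⟩
  induction h with
  | refl =>
    exact ⟨id, ⟨fun _ _ => rfl, fun x hx => hx, fun _ _ _ _ h => h⟩,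
      fun a b h => absurd rfl h.2, fun x hx => absurd rfl hx⟩
  | @tail w v hw hwv ih =>
    obtain ⟨σ, h1, h2, h3⟩ := ih
    have hvi : v ≠ i := by rintro rfl; exact hi _ hwv
    have hwv' : w ≠ v := by rintro rfl; exact lt_irrefl _ (hτ _ _ hwv)
    have hne : ∀ x, x ≠ v → σ x ≠ v := by
      intro x hx hxv
      have h4 : σ x ≠ x := by rw [hxv]; exact hx.symm
      have h5 := hτ _ _ (h2 _ _ ⟨rfl, h4⟩)
      rw [hxv] at h5
      have := h3 x h4
      have := hτ _ _ hwv
      omega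
    have hne' : ∀ x, x ≠ i → σ x ≠ w := fun x hx => by
      simpa using h1.notEnd x (by simpa using hx)
    refine ⟨Function.update σ v w, ⟨?_, ?_, ?_⟩, ?_, ?_⟩
    · intro x hx
      rw [mem_singleton] at hx
      subst hx
      rw [Function.update_of_ne hvi.symm]
      exact h1.start _ (mem_singleton_self _)
    · intro x hx
      rw [mem_singleton]
      by_cases hxv : x = v
      · rw [hxv, Function.update_self]; exact hwv'
      · rw [Function.update_of_ne hxv]; exact hne x hxv
    · intro x hx y hy hxy
      rw [mem_singleton] at hx hy
      by_cases hxv : x = v <;> by_cases hyv : y = v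
      · rw [hxv, hyv]
      · rw [hxv, Function.update_self, Function.update_of_ne hyv] at hxy
        exact absurd hxy.symm (hne' y hy)
      · rw [hyv, Function.update_self, Function.update_of_ne hxv] at hxy
        exact absurd hxy (hne' x hx)
      · rw [Function.update_of_ne hxv, Function.update_of_ne hyv] at hxy
        exact h1.inj x (by simpa using hx) y (by simpa using hy) hxy
    · rintro a b ⟨rfl, hb⟩
      by_cases hbv : b = v
      · subst hbv; rwa [Function.update_self]
      · rw [Function.update_of_ne hbv] at hb ⊢
        exact h2 _ _ ⟨rfl, hb⟩
    · intro x hx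
      by_cases hxv : x = v
      · rw [hxv]
      · rw [Function.update_of_ne hxv] at hx
        exact (h3 x hx).trans (hτ _ _ hwv).le

namespace Tight

theorem arc_lt (h : Tight I Z σ τ) (c : Fin 3) : ∀ a b, Arc (σ c) a b → τ a < τ b :=
  fun a b hab => h.lt a b ⟨c, hab⟩

theorem hor_lt (h : Tight I Z σ τ) : ∀ a b, Hor σ a b → τ a < τ b :=
  fun a b hab => h.lt a b hab.tot

/-- The first routing has no arc outside `Hor σ` between two nodes that are joined by a walk in
`Hor σ`: the walk would allow to save the arc. -/
theorem hor_of_between (h : Tight I Z σ τ) {x a b y : X} (hxa : ReflTransGen (Arc (σ 0)) x a)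
    (hx : σ 0 x ≠ x) (hab : Arc (σ 0) a b) (hby : ReflTransGen (Arc (σ 0)) b y)
    (hxy : ReflTransGen (Hor σ) x y) : Hor σ a b := by
  classical
  by_contra hcon
  have hr := h.routing 0
  have hτ := h.arc_lt 0
  obtain ⟨hrI, hrx⟩ := hr.root_spec hτ hx
  set r := root (I 0) (σ 0) x
  have hI : I 0 = {r} := by
    rw [eq_singleton_iff_unique_mem]
    exact ⟨hrI, fun y hy => card_le_one.1 h.card_zero _ hy _ hrI⟩
  obtain ⟨z, hz⟩ : ∃ z, Z 0 = {z} := by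
    rw [← card_eq_one, ← h.card_end, hI, card_singleton]
  have hrz : ReflTransGen (Arc (σ 0)) r z := by
    by_cases hzI : z ∈ I 0
    · rw [hI, mem_singleton] at hzI; rw [hzI]
    · have hzz : σ 0 z ≠ z := fun e => hr.notEnd z hzI (by rw [e, hz]; exact mem_singleton_self z)
      obtain ⟨h1, h2⟩ := hr.root_spec hτ hzz
      rwa [card_le_one.1 h.card_zero _ h1 _ hrI] at h2
  have hyz : ReflTransGen (Arc (σ 0)) y z := by
    have hry : ReflTransGen (Arc (σ 0)) r y := ((hrx.trans hxa).tail hab).trans hby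
    rcases ReflTransGen.total_of_right_unique (r := Arc (σ 0))
      (fun _ _ _ h h' => hr.arc_rightUnique h h') hry hrz with h1 | h1
    · exact h1
    · rcases h1.cases_head with e | ⟨c, hc, -⟩
      · rw [e]
      · exact absurd (show σ 0 c ∈ Z 0 by rw [hc.1, hz]; exact mem_singleton_self z)
          (hr.notEnd c (hr.notMem_start hc.2))
  -- the arcs that remain when `(a, b)` is deleted still lead from `r` to `z`, via `x` and `y`
  set T' : X → X → Prop := fun p q => Tot σ p q ∧ ¬ (p = a ∧ q = b) with hT'
  have hle : ∀ {p q}, ReflTransGen (Arc (σ 0)) p q → τ p ≤ τ q := by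
    intro p q hpq
    rcases reflTransGen_iff_eq_or_transGen.1 hpq with e | e
    · rw [e]
    · exact (Before.lt hτ e).le
  have hw : ReflTransGen T' r z := by
    have w1 : ∀ {p}, ReflTransGen (Arc (σ 0)) r p → τ p < τ b → ReflTransGen T' r p := by
      intro p hp hlt
      induction hp with
      | refl => exact .refl
      | @tail c d _ hcd ih =>
        exact (ih ((hτ _ _ hcd).trans hlt)).tail
          ⟨⟨0, hcd⟩, fun e => absurd hlt (by rw [e.2]; exact lt_irrefl _)⟩
    have w2 : ReflTransGen T' x y := by
      refine ReflTransGen.mono (fun p q hpq => ⟨Hor.tot hpq, ?_⟩) _ _ hxy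
      rintro ⟨rfl, rfl⟩
      exact hcon hpq
    have w3 : ∀ {p}, ReflTransGen (Arc (σ 0)) p z → τ a < τ p → ReflTransGen T' p z := by
      intro p hp hlt
      induction hp using ReflTransGen.head_induction_on with
      | refl => exact .refl
      | @head c d hcd _ ih =>
        exact (ih (hlt.trans (hτ _ _ hcd))).head
          ⟨⟨0, hcd⟩, fun e => absurd hlt (by rw [e.1]; exact lt_irrefl _)⟩
    have hab' := hτ _ _ hab
    exact ((w1 hrx ((hle hxa).trans_lt hab')).trans w2).trans (w3 hyz (hab'.trans_le (hle hby)))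
  obtain ⟨θ, h1, h2⟩ := exists_routing_of_walk (τ := τ) (fun p q hpq => h.lt p q hpq.1)
    (fun p hp => h.start _ _ hp.1 0 hrI) hw
  have hnew : ∀ c, IsRouting (I c) (Z c) (Function.update σ 0 θ c) := by
    intro c
    by_cases hc : c = 0
    · subst hc; rw [Function.update_self, hI, hz]; exact h1
    · rw [Function.update_of_ne hc]; exact h.routing c
  have htot : ∀ p q, Tot (Function.update σ 0 θ) p q ↔ Arc θ p q ∨ Hor σ p q := by
    intro p q
    rw [tot_iff, Hor, Hor]
    simp
  have := h.tot_min _ hnew (fun p q hpq => by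
    rcases (htot p q).1 hpq with h3 | h3
    · exact (h2 _ _ h3).1
    · exact h3.tot) a b ⟨0, hab⟩
  rcases (htot a b).1 this with h3 | h3
  · exact (h2 _ _ h3).2 ⟨rfl, rfl⟩
  · exact hcon h3

/-- Two nodes of the first routing joined by a walk in `Hor σ`: the first routing enters the
second one along `Hor σ`. -/
theorem hor_prev (h : Tight I Z σ τ) {x y : X} (hx : σ 0 x ≠ x) (hy : σ 0 y ≠ y)
    (hxy : TransGen (Hor σ) x y) : Hor σ (σ 0 y) y := by
  have hr := h.routing 0
  have hxI := (hr.root_spec (h.arc_lt 0) hx).1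
  have hyI := (hr.root_spec (h.arc_lt 0) hy).1
  have hb := hr.before_of_root_eq (h.arc_lt 0) hx hy (card_le_one.1 h.card_zero _ hxI _ hyI)
    (Before.lt h.hor_lt hxy)
  obtain ⟨c, hc, hcy⟩ := TransGen.tail'_iff.1 hb
  rw [hcy.1]
  exact h.hor_of_between hc hx hcy .refl hxy.to_reflTransGen

end Tight

/-- The nodes at which the first routing enters the other two. -/
def entries (σ : Fin 3 → X → X) : Set X :=
  {e | σ 0 e ≠ e ∧ ¬ Hor σ (σ 0 e) e ∧ (σ 1 e ≠ e ∨ σ 2 e ≠ e)}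

open Classical in
/-- The start of the path of the second or third routing which is entered at `e`; it tells
entries apart. -/
noncomputable def entryStart (I : Fin 3 → Finset X) (σ : Fin 3 → X → X) (e : X) : X ⊕ X :=
  if σ 1 e ≠ e then Sum.inl (root (I 1) (σ 1) e) else Sum.inr (root (I 2) (σ 2) e)

theorem hor_of_before {c : Fin 3} (hc : c ≠ 0) {x y : X} (h : Before (σ c) x y) :
    TransGen (Hor σ) x y := by
  refine TransGen.mono (fun a b hab => ?_) _ _ h
  fin_cases c
  · exact absurd rfl hc
  · exact Or.inl hab
  · exact Or.inr hab

namespace Tight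

/-- No entry is reached from another one along the last two routings. -/
theorem entries_antichain (h : Tight I Z σ τ) {x y : X} (hx : x ∈ entries σ) (hy : y ∈ entries σ)
    (hxy : TransGen (Hor σ) x y) : False :=
  hy.2.1 (h.hor_prev hx.1 hy.1 hxy)

/-- A path of the second or third routing is entered at most once. -/
theorem entries_eq_of_root_eq (h : Tight I Z σ τ) (hinj : Function.Injective τ) {c : Fin 3}
    (hc : c ≠ 0) {x y : X} (hx : x ∈ entries σ) (hy : y ∈ entries σ) (hxc : σ c x ≠ x)
    (hyc : σ c y ≠ y) (hroot : root (I c) (σ c) x = root (I c) (σ c) y) : x = y := by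
  by_contra hne
  rcases lt_or_gt_of_ne (hinj.ne hne) with hlt | hlt
  · exact h.entries_antichain hx hy (hor_of_before hc
      ((h.routing c).before_of_root_eq (h.arc_lt c) hxc hyc hroot hlt))
  · exact h.entries_antichain hy hx (hor_of_before hc
      ((h.routing c).before_of_root_eq (h.arc_lt c) hyc hxc hroot.symm hlt))

theorem entryStart_injOn (h : Tight I Z σ τ) (hinj : Function.Injective τ) :
    Set.InjOn (entryStart I σ) (entries σ) := by
  intro x hx y hy hxy
  by_cases h1 : σ 1 x ≠ x <;> by_cases h2 : σ 1 y ≠ y <;>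
    simp only [entryStart, h1, h2, if_true, if_false, ne_eq,
      not_false_eq_true, reduceCtorEq, Sum.inl.injEq, Sum.inr.injEq] at hxy
  · exact h.entries_eq_of_root_eq hinj (c := 1) (by decide) hx hy h1 h2 hxy
  · exact h.entries_eq_of_root_eq hinj (c := 2) (by decide) hx hy (hx.2.2.resolve_left h1)
      (hy.2.2.resolve_left h2) hxy

theorem entryStart_mem (h : Tight I Z σ τ) {x : X} (hx : x ∈ entries σ) :
    entryStart I σ x ∈ (I 1).disjSum (I 2) := by
  by_cases h1 : σ 1 x ≠ x
  · rw [entryStart, if_pos h1]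
    exact Finset.inl_mem_disjSum.2 ((h.routing 1).root_spec (h.arc_lt 1) h1).1
  · rw [entryStart, if_neg h1]
    exact Finset.inr_mem_disjSum.2
      ((h.routing 2).root_spec (h.arc_lt 2) (hx.2.2.resolve_left h1)).1

theorem ncard_entries_le (h : Tight I Z σ τ) (hinj : Function.Injective τ) :
    (entries σ).ncard ≤ (I 1).card + (I 2).card := by
  rw [← Finset.card_disjSum, ← Set.ncard_coe_finset]
  exact Set.ncard_le_ncard_of_injOn (entryStart I σ) (fun x hx => h.entryStart_mem hx)
    (h.entryStart_injOn hinj)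

end Tight

/-- The nodes that are entered by two arcs. -/
def joins (σ : Fin 3 → X → X) : Set X := {x | ∃ a b, a ≠ b ∧ Tot σ a x ∧ Tot σ b x}

/-- Two arcs into a node belong to the last two routings, or one of them is an arc of the first
routing by which it enters a path. -/
theorem joins_subset : joins σ ⊆ merges (σ 1) (σ 2) ∪ entries σ := by
  have key : ∀ x a b, a ≠ b → Arc (σ 0) a x → Hor σ b x →
      x ∈ merges (σ 1) (σ 2) ∪ entries σ := by
    rintro x a b hab ⟨rfl, hx⟩ hb
    by_cases hH : Hor σ (σ 0 x) x
    · left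
      rcases hb with ⟨rfl, hb⟩ | ⟨rfl, hb⟩ <;> rcases hH with ⟨h1, h2⟩ | ⟨h1, h2⟩
      · exact absurd h1.symm hab
      · exact ⟨hb, h2, fun e => hab (h1.symm.trans e.symm)⟩
      · exact ⟨h2, hb, fun e => hab (h1.symm.trans e)⟩
      · exact absurd h1.symm hab
    · right
      exact ⟨hx, hH, hb.imp And.right And.right⟩
  rintro x ⟨a, b, hab, ha, hb⟩
  rw [tot_iff] at ha hb
  rcases ha with ha | ha <;> rcases hb with hb | hb
  · exact absurd (arc_leftUnique ha hb) hab
  · exact key x a b hab ha hb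
  · exact key x b a hab.symm hb ha
  · left
    rcases ha with ⟨rfl, ha⟩ | ⟨rfl, ha⟩ <;> rcases hb with ⟨rfl, hb⟩ | ⟨rfl, hb⟩
    · exact absurd rfl hab
    · exact ⟨ha, hb, hab⟩
    · exact ⟨hb, ha, hab.symm⟩
    · exact absurd rfl hab

namespace Tight

/-- The residual rank of one of the last two routings of a tight triple, in the union of the
two. -/
theorem exists_rank_hor [Finite X] (h : Tight I Z σ τ) {c d : Fin 3} (hcd : ∀ a b, Hor σ a b ↔
    (Arc (σ c) a b ∨ Arc (σ d) a b)) (hc0 : c ≠ 0) (hc : c ≠ d)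
    (hcd' : ∀ ω : Fin 3 → X → X, ∀ a b, Hor ω a b ↔ (Arc (ω c) a b ∨ Arc (ω d) a b)) :
    ∃ ρ, IsResidualRank (I c) (σ c) (Hor σ) ρ := by
  classical
  obtain ⟨ρ, h1, h2, h3⟩ := (h.routing c).exists_residual_rank (T := Hor σ) (O := Arc (σ d))
    h.hor_lt (fun a b hab => h.start a b hab.tot c) (fun a b hab => (hcd a b).2 (Or.inl hab))
    (fun σ' hσ' hsub a b hab => by
      have hH : ∀ p q, Hor (Function.update σ c σ') p q ↔ (Arc σ' p q ∨ Arc (σ d) p q) := by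
        intro p q
        rw [hcd', Function.update_self, Function.update_of_ne hc.symm]
      have hsub' : ∀ p q, Hor (Function.update σ c σ') p q → Hor σ p q := by
        intro p q hpq
        rcases (hH p q).1 hpq with h4 | h4
        · exact hsub _ _ h4
        · exact (hcd p q).2 (Or.inr h4)
      refine (hH a b).1 (h.hor_min (Function.update σ c σ') (fun k => ?_) (fun p q hpq => ?_)
        hsub' a b ((hcd a b).2 (Or.inl hab)))
      · by_cases hk : k = c
        · subst hk; rw [Function.update_self]; exact hσ'
        · rw [Function.update_of_ne hk]; exact h.routing k
      · rw [tot_iff] at hpq ⊢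
        rw [Function.update_of_ne hc0.symm] at hpq
        exact hpq.imp_right (hsub' p q))
    (fun a b e hab hab' hae => by
      rcases (hcd a e).1 hae with h4 | h4
      · exact (h.routing c).arc_rightUnique h4 hab
      · exact (h.routing d).arc_rightUnique h4 hab')
  exact ⟨ρ, h1, h2, h3⟩

theorem exists_ranks_hor [Finite X] (h : Tight I Z σ τ) :
    (∃ α, IsResidualRank (I 1) (σ 1) (Hor σ) α) ∧ ∃ β, IsResidualRank (I 2) (σ 2) (Hor σ) β :=
  ⟨h.exists_rank_hor (d := 2) (fun _ _ => Iff.rfl) (by decide) (by decide)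
      (fun _ _ _ => Iff.rfl),
    h.exists_rank_hor (d := 1) (fun _ _ => or_comm) (by decide) (by decide)
      (fun _ _ _ => or_comm)⟩

theorem ncard_merges_le [Finite X] (h : Tight I Z σ τ) (hinj : Function.Injective τ)
    (h1 : (I 1).card ≤ 2) : (merges (σ 1) (σ 2)).ncard ≤ 3 * (I 2).card - 1 := by
  obtain ⟨⟨α, hα⟩, β, hβ⟩ := h.exists_ranks_hor
  exact Merging.ncard_merges_le (h.routing 1) (h.routing 2) hinj h.hor_lt
    (fun a b hab => h.start a b (Hor.tot hab) 1) (fun a b hab => h.start a b (Hor.tot hab) 2)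
    hα hβ h1

theorem ncard_joins_le [Finite X] (h : Tight I Z σ τ) (hinj : Function.Injective τ)
    (h1 : (I 1).card ≤ 2) {n : ℕ} (hn : 1 ≤ n) (h2 : (I 2).card ≤ n) :
    (joins σ).ncard ≤ 4 * n + 1 := by
  have e1 := Set.ncard_le_ncard (joins_subset (σ := σ)) (Set.toFinite _)
  have e2 := Set.ncard_union_le (merges (σ 1) (σ 2)) (entries σ)
  have e3 := h.ncard_merges_le hinj h1
  have e4 := h.ncard_entries_le hinj
  omega

end Tight

end Triples

/-- Triples of routings along the arcs of an acyclic relation can be made tight. -/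
theorem exists_tight {X : Type*} [Finite X] {I Z : Fin 3 → Finset X} {σ : Fin 3 → X → X}
    {τ : X → ℕ} {A : X → X → Prop} (hA : ∀ a b, A a b → τ a < τ b)
    (hstart : ∀ a b, A a b → ∀ c, b ∉ I c) (hdisj : ∀ c d, ∀ x ∈ I c, x ∈ I d → c = d)
    (h0 : (I 0).card ≤ 1) (hZ : (I 0).card = (Z 0).card)
    (hσ : ∀ c, IsRouting (I c) (Z c) (σ c)) (hσA : ∀ c a b, Arc (σ c) a b → A a b) :
    ∃ ω : Fin 3 → X → X, Tight I Z ω τ ∧ ∀ c a b, Arc (ω c) a b → A a b := by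
  classical
  set S : Set (Fin 3 → X → X) :=
    {ω | (∀ c, IsRouting (I c) (Z c) (ω c)) ∧ ∀ c a b, Arc (ω c) a b → A a b}
  have hS : S.Nonempty := ⟨σ, hσ, hσA⟩
  set t : (Fin 3 → X → X) → ℕ := fun ω => {p : X × X | Tot ω p.1 p.2}.ncard
  set u : (Fin 3 → X → X) → ℕ := fun ω => {p : X × X | Hor ω p.1 p.2}.ncard
  obtain ⟨ω, ⟨hω, hωA⟩, hmin⟩ := Set.exists_min_image S (fun ω => toLex (t ω, u ω))
    (Set.toFinite _) hS
  have hsame : ∀ ω' : Fin 3 → X → X, (∀ c, IsRouting (I c) (Z c) (ω' c)) →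
      (∀ a b, Tot ω' a b → Tot ω a b) →
      {p : X × X | Tot ω' p.1 p.2} = {p : X × X | Tot ω p.1 p.2} ∧ u ω ≤ u ω' := by
    intro ω' h1 h2
    have hm := hmin ω' ⟨h1, fun c a b hab => by
      obtain ⟨d, hd⟩ := h2 a b ⟨c, hab⟩
      exact hωA d a b hd⟩
    rw [Prod.Lex.toLex_le_toLex] at hm
    have hsub : {p : X × X | Tot ω' p.1 p.2} ⊆ {p : X × X | Tot ω p.1 p.2} :=
      fun p hp => h2 _ _ hp
    have hle : t ω' ≤ t ω := Set.ncard_le_ncard hsub (Set.toFinite _)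
    rcases hm with hm | ⟨hm, hm'⟩
    · exact absurd hle (not_le.2 hm)
    · exact ⟨Set.eq_of_subset_of_ncard_le hsub hm.le (Set.toFinite _), hm'⟩
  refine ⟨ω, ⟨hω, hdisj, ?_, ?_, ?_, ?_, h0, hZ⟩, hωA⟩
  · rintro a b ⟨c, hab⟩; exact hstart a b (hωA c a b hab)
  · rintro a b ⟨c, hab⟩; exact hA a b (hωA c a b hab)
  · intro ω' h1 h2 a b hab
    have : (a, b) ∈ {p : X × X | Tot ω' p.1 p.2} := by rw [(hsame ω' h1 h2).1]; exact hab
    exact this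
  · intro ω' h1 h2 h3 a b hab
    have hsub : {p : X × X | Hor ω' p.1 p.2} ⊆ {p : X × X | Hor ω p.1 p.2} :=
      fun p hp => h3 _ _ hp
    have : (a, b) ∈ {p : X × X | Hor ω' p.1 p.2} := by
      rw [Set.eq_of_subset_of_ncard_le hsub (hsame ω' h1 h2).2 (Set.toFinite _)]; exact hab
    exact this

end Merging

namespace Merging

/-! ### Search for words: the extremal case for two and three paths

A word is a pair of lists of labels, one for the chains of each of two routings; the label `0`
says that the routing does not visit the point. -/

/-- The position of the first `a` in `l`, where the positions in `l` are counted from `p`. -/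
def nextAt (a : ℕ) : List ℕ → ℕ → Option ℕ
  | [], _ => none
  | b :: l, p => bif Nat.beq a b then some p else nextAt a l (p + 1)

/-- The rows of the reflexive and transitive relation that arises when a step from `u` to `v` is
added; each row is a bit mask. The result is `none` if this closes a cycle. -/
def addStep (u v : ℕ) (rows : List ℕ) : Option (List ℕ) :=
  bif (rows.getD v 0).testBit u then none
  else some (rows.map fun w => bif w.testBit u then w ||| rows.getD v 0 else w)

/-- Adds a list of steps to a relation, see `addStep`. -/
def addSteps : List (ℕ × ℕ) → List ℕ → Option (List ℕ)
  | [], rows => some rows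
  | e :: es, rows => (addStep e.1 e.2 rows).bind (addSteps es)

/-- The residual steps of the chains with labels `lc` along the chains with labels `ld`. -/
def steps : List ℕ → List ℕ → ℕ → List (ℕ × ℕ)
  | a :: lc, b :: ld, p =>
    let v := bif Nat.beq b 0 then none else nextAt b ld (p + 1)
    let u := bif Nat.beq a 0 then some p else nextAt a lc (p + 1)
    let r := steps lc ld (p + 1)
    match u with
    | none => r
    | some u =>
      let r' := match v with
        | none => r
        | some v => (u, v) :: r
      bif Nat.beq u p then r' else (u, p) :: r'
  | _, _, _ => []

/-- The closure of the residual steps of `lc` along `ld`, or `none` if they contain a cycle. -/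
def closed (lc ld : List ℕ) : Option (List ℕ) :=
  addSteps (steps lc ld 0) ((List.range lc.length).map fun u => 1 <<< u)

/-- Neither family of chains of the word has a residual cycle. -/
def good (w : List ℕ × List ℕ) : Bool := (closed w.1 w.2).isSome && (closed w.2 w.1).isSome

/-- The words of length `k + 1` with labels `1, 2` and `1, …, n` that start with the labels `1`
and `1` and have only good prefixes. -/
def words (n : ℕ) : ℕ → List (List ℕ × List ℕ)
  | 0 => [([1], [1])]
  | k + 1 => (words n k).flatMap fun w =>
      ((List.range 2).flatMap fun a => (List.range n).map fun b =>
        (w.1 ++ [a + 1], w.2 ++ [b + 1])).filter good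

/-- Adds the residual step that arises when the first routing goes from the entry `a` to the
entry `b`. -/
def linkStep (lc : List ℕ) (a b : ℕ) (rows : List ℕ) : Option (List ℕ) :=
  bif Nat.beq (lc.getD a 0) 0 then addStep a b rows
  else match nextAt (lc.getD a 0) (lc.drop (a + 1)) (a + 1) with
    | none => some rows
    | some u => addStep u b rows

/-- Every order in which the first routing may visit the remaining entries `E` after `a` leads to
a residual cycle. -/
def search (lc ld : List ℕ) : ℕ → ℕ → List ℕ → List ℕ → List ℕ → Bool
  | 0, _, _, _, _ => false
  | f + 1, a, E, R, R' => E.all fun b =>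
      match linkStep lc a b R, linkStep ld a b R' with
      | some Q, some Q' => search lc ld f b (E.erase b) Q Q'
      | _, _ => true

/-- Every order in which the first routing may visit the entries `E` leads to a residual cycle. -/
def refuted (lc ld E : List ℕ) : Bool :=
  match closed lc ld, closed ld lc with
  | some R, some R' => E.all fun a => search lc ld (E.length - 1) a (E.erase a) R R'
  | _, _ => true

/-- The labels for the two paths of the second routing, when the entries follow `k` mergings. -/
def fullFst (n : ℕ) (lc : List ℕ) (k : ℕ) : List ℕ :=
  lc.take k ++ ([1, 2] ++ List.replicate n 0) ++ lc.drop k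

/-- The labels for the paths of the third routing, when the entries follow `k` mergings. -/
def fullSnd (n : ℕ) (ld : List ℕ) (k : ℕ) : List ℕ :=
  ld.take k ++ ([0, 0] ++ (List.range n).map (· + 1)) ++ ld.drop k

set_option maxRecDepth 100000 in
theorem refuted_two : ((words 2 4).all fun w => (List.range 6).all fun k =>
    refuted (fullFst 2 w.1 k) (fullSnd 2 w.2 k) ((List.range 4).map (k + ·))) = true := by
  decide +kernel

set_option maxRecDepth 100000 in
theorem refuted_three : ((words 3 7).all fun w => (List.range 9).all fun k =>
    refuted (fullFst 3 w.1 k) (fullSnd 3 w.2 k) ((List.range 5).map (k + ·))) = true := by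
  decide +kernel

end Merging

namespace Merging

/-- The position `v` is the first one after `i` with the same nonzero label. -/
def Nxt (ld : List ℕ) (i v : ℕ) : Prop :=
  i < v ∧ ∃ b, b ≠ 0 ∧ ld[i]? = some b ∧ ld[v]? = some b ∧ ∀ k, i < k → k < v → ld[k]? ≠ some b

/-- The rank `ρ` decreases along the residual steps of the chains `lc` along the chains `ld`. -/
structure Obeys (lc ld : List ℕ) (ρ : ℕ → ℕ) : Prop where
  chain : ∀ i j, i < j → ∀ a, a ≠ 0 → lc[i]? = some a → lc[j]? = some a → ρ i < ρ j
  next : ∀ i j v, i < j → ∀ a, a ≠ 0 → lc[i]? = some a → lc[j]? = some a → Nxt ld i v → ρ v < ρ j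
  off : ∀ i v, lc[i]? = some 0 → Nxt ld i v → ρ v < ρ i

theorem nextAt_spec {a : ℕ} {l : List ℕ} {p j : ℕ} (h : nextAt a l p = some j) :
    ∃ i, j = p + i ∧ l[i]? = some a ∧ ∀ k < i, l[k]? ≠ some a := by
  induction l generalizing p with
  | nil => simp [nextAt] at h
  | cons b l ih =>
    by_cases hb : a = b
    · subst hb
      simp only [nextAt, Nat.beq_refl, cond_true, Option.some.injEq] at h
      exact ⟨0, by omega, by simp, by simp⟩
    · have hb' : Nat.beq a b = false := by
        rw [Bool.eq_false_iff]; exact fun e => hb (Nat.eq_of_beq_eq_true e)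
      simp only [nextAt, hb', cond_false] at h
      obtain ⟨i, h1, h2, h3⟩ := ih h
      refine ⟨i + 1, by omega, by simpa using h2, fun k hk => ?_⟩
      rcases k with _ | k
      · simpa using fun e => hb e.symm
      · simpa using h3 k (by omega)

theorem nxt_of_nextAt {d₀ ld : List ℕ} {b p v : ℕ} (hd : d₀.drop p = b :: ld) (hb : b ≠ 0)
    (h : nextAt b ld (p + 1) = some v) : Nxt d₀ p v := by
  obtain ⟨i, rfl, h2, h3⟩ := nextAt_spec h
  have hget : ∀ k, d₀[p + k]? = (b :: ld)[k]? := fun k => by rw [← hd, List.getElem?_drop]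
  refine ⟨by omega, b, hb, by simpa using hget 0, ?_, fun k h4 h5 => ?_⟩
  · rw [add_assoc, hget, add_comm 1]; simpa using h2
  · obtain ⟨k, rfl⟩ := Nat.exists_eq_add_of_lt h4
    rw [add_assoc, hget]
    simpa using h3 k (by omega)

theorem steps_sound {c₀ d₀ : List ℕ} {ρ : ℕ → ℕ} (h : Obeys c₀ d₀ ρ) {lc ld : List ℕ} {p : ℕ}
    (hc : c₀.drop p = lc) (hd : d₀.drop p = ld) : ∀ e ∈ steps lc ld p, ρ e.2 < ρ e.1 := by
  induction lc generalizing ld p with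
  | nil => simp [steps]
  | cons a lc ih =>
    rcases ld with _ | ⟨b, ld⟩
    · simp [steps]
    have hc' : c₀.drop (p + 1) = lc := by rw [← List.drop_drop, hc]; simp
    have hd' : d₀.drop (p + 1) = ld := by rw [← List.drop_drop, hd]; simp
    have ih' := ih hc' hd'
    have hcp : c₀[p]? = some a := by
      have := List.getElem?_drop (xs := c₀) (i := p) (j := 0)
      rw [hc] at this
      simpa using this.symm
    have hv : ∀ v, (bif Nat.beq b 0 then none else nextAt b ld (p + 1)) = some v →
        Nxt d₀ p v := by
      intro v hv
      by_cases hb : b = 0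
      · simp [hb] at hv
      · have hb' : Nat.beq b 0 = false := by
          rw [Bool.eq_false_iff]; exact fun e => hb (Nat.eq_of_beq_eq_true e)
        rw [hb', cond_false] at hv
        exact nxt_of_nextAt hd hb hv
    intro e he
    simp only [steps] at he
    revert hv he
    generalize (bif Nat.beq b 0 then none else nextAt b ld (p + 1)) = v
    intro hv he
    by_cases ha : a = 0
    · subst ha
      simp only [Nat.beq_refl, cond_true] at he
      rcases v with _ | v
      · exact ih' e he
      · rcases List.mem_cons.1 he with rfl | he
        · exact h.off p v hcp (hv v rfl)
        · exact ih' e he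
    · have ha' : Nat.beq a 0 = false := by
        rw [Bool.eq_false_iff]; exact fun e => ha (Nat.eq_of_beq_eq_true e)
      rw [ha', cond_false] at he
      rcases hu : nextAt a lc (p + 1) with _ | u
      · rw [hu] at he; exact ih' e he
      · rw [hu] at he
        obtain ⟨hpu, a', ha0, h1, h2, -⟩ := nxt_of_nextAt hc ha hu
        have hup : Nat.beq u p = false := by
          rw [Bool.eq_false_iff]; intro e; have := Nat.eq_of_beq_eq_true e; omega
        simp only [hup, cond_false] at he
        rcases List.mem_cons.1 he with rfl | he
        · exact h.chain p u hpu a' ha0 h1 h2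
        · rcases v with _ | v
          · exact ih' e he
          · rcases List.mem_cons.1 he with rfl | he
            · exact h.next p u v hpu a' ha0 h1 h2 (hv v rfl)
            · exact ih' e he

/-- The relation with the given rows is compatible with the rank `ρ`. -/
def Compatible (ρ : ℕ → ℕ) (rows : List ℕ) : Prop :=
  ∀ u v, (rows.getD u 0).testBit v = true → ρ v ≤ ρ u

theorem Compatible.addStep {ρ : ℕ → ℕ} {rows : List ℕ} (h : Compatible ρ rows) {u v : ℕ}
    (huv : ρ v < ρ u) : ∃ rows', addStep u v rows = some rows' ∧ Compatible ρ rows' := by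
  have h1 : (rows.getD v 0).testBit u = false := by
    rw [Bool.eq_false_iff]; intro e; exact absurd (h v u e) (not_le.2 huv)
  refine ⟨_, by rw [Merging.addStep, h1, cond_false], fun x y hxy => ?_⟩
  have h2 : (rows.map fun w => bif w.testBit u then w ||| rows.getD v 0 else w).getD x 0 =
      bif (rows.getD x 0).testBit u then rows.getD x 0 ||| rows.getD v 0 else rows.getD x 0 := by
    simp only [List.getD_eq_getElem?_getD, List.getElem?_map]
    rcases rows[x]? with _ | w <;> simp
  rw [h2] at hxy
  rcases hb : (rows.getD x 0).testBit u with _ | _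
  · rw [hb, cond_false] at hxy; exact h x y hxy
  · rw [hb, cond_true, Nat.testBit_or, Bool.or_eq_true] at hxy
    rcases hxy with hxy | hxy
    · exact h x y hxy
    · exact ((h v y hxy).trans huv.le).trans (h x u hb)

theorem Compatible.addSteps {ρ : ℕ → ℕ} {rows : List ℕ} (h : Compatible ρ rows)
    {es : List (ℕ × ℕ)} (hes : ∀ e ∈ es, ρ e.2 < ρ e.1) :
    ∃ rows', addSteps es rows = some rows' ∧ Compatible ρ rows' := by
  induction es generalizing rows with
  | nil => exact ⟨rows, rfl, h⟩
  | cons e es ih =>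
    obtain ⟨r, h1, h2⟩ := h.addStep (hes e (by simp))
    obtain ⟨r', h3, h4⟩ := ih h2 (fun e he => hes e (by simp [he]))
    exact ⟨r', by rw [Merging.addSteps, h1, Option.bind_some, h3], h4⟩

theorem Obeys.closed {lc ld : List ℕ} {ρ : ℕ → ℕ} (h : Obeys lc ld ρ) :
    ∃ rows, closed lc ld = some rows ∧ Compatible ρ rows := by
  refine Compatible.addSteps (fun u v huv => ?_) (steps_sound h (by simp) (by simp))
  by_cases hu : u < lc.length
  · simp only [List.getD_eq_getElem?_getD, List.getElem?_map, List.getElem?_range hu,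
      Option.map_some, Option.getD_some, Nat.one_shiftLeft, Nat.testBit_two_pow,
      decide_eq_true_eq] at huv
    rw [huv]
  · simp [List.getD_eq_getElem?_getD, hu] at huv

theorem Nxt.of_take {ld : List ℕ} {k i v : ℕ} (h : Nxt (ld.take k) i v) : Nxt ld i v := by
  obtain ⟨h1, b, hb, h2, h3, h4⟩ := h
  have hv : v < k := by
    by_contra hv
    rw [List.getElem?_eq_none (by simp; omega)] at h3
    simp at h3
  rw [List.getElem?_take_of_lt (by omega)] at h2
  rw [List.getElem?_take_of_lt hv] at h3
  refine ⟨h1, b, hb, h2, h3, fun j hj hjv => ?_⟩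
  have := h4 j hj hjv
  rwa [List.getElem?_take_of_lt (by omega)] at this

theorem Obeys.take {lc ld : List ℕ} {ρ : ℕ → ℕ} (h : Obeys lc ld ρ) (k : ℕ) :
    Obeys (lc.take k) (ld.take k) ρ := by
  have key : ∀ {i a : ℕ}, (lc.take k)[i]? = some a → lc[i]? = some a := by
    intro i a hi
    by_cases hk : i < k
    · rwa [List.getElem?_take_of_lt hk] at hi
    · rw [List.getElem?_eq_none (by simp; omega)] at hi; simp at hi
  exact ⟨fun i j hij a ha h1 h2 => h.chain i j hij a ha (key h1) (key h2),
    fun i j v hij a ha h1 h2 h3 => h.next i j v hij a ha (key h1) (key h2) h3.of_take,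
    fun i v h1 h2 => h.off i v (key h1) h2.of_take⟩

theorem mem_words {n : ℕ} {lc ld : List ℕ} {α β : ℕ → ℕ} (hα : Obeys lc ld α) (hβ : Obeys ld lc β)
    (hc0 : lc[0]? = some 1) (hd0 : ld[0]? = some 1) (hc : ∀ a ∈ lc, 1 ≤ a ∧ a ≤ 2)
    (hd : ∀ b ∈ ld, 1 ≤ b ∧ b ≤ n) (hlen : lc.length = ld.length) (k : ℕ) (hk : k < lc.length) :
    (lc.take (k + 1), ld.take (k + 1)) ∈ words n k := by
  induction k with
  | zero =>
    rcases lc with _ | ⟨a, lc⟩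
    · simp at hk
    rcases ld with _ | ⟨b, ld⟩
    · simp at hlen
    simp only [List.getElem?_cons_zero, Option.some.injEq] at hc0 hd0
    simp [words, hc0, hd0]
  | succ k ih =>
    have hk' : k + 1 < ld.length := by omega
    rw [words, List.mem_flatMap]
    refine ⟨_, ih (by omega), ?_⟩
    rw [List.mem_filter]
    constructor
    · have h1 := hc lc[k + 1] (List.getElem_mem hk)
      have h2 := hd ld[k + 1] (List.getElem_mem hk')
      rw [List.mem_flatMap]
      refine ⟨lc[k + 1] - 1, by simp; omega, ?_⟩
      rw [List.mem_map]
      refine ⟨ld[k + 1] - 1, by simp; omega, ?_⟩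
      rw [Nat.sub_add_cancel h1.1, Nat.sub_add_cancel h2.1, List.take_concat_get' _ _ hk,
        List.take_concat_get' _ _ hk']
    · obtain ⟨r, h1, -⟩ := (hα.take (k + 1 + 1)).closed
      obtain ⟨r', h2, -⟩ := (hβ.take (k + 1 + 1)).closed
      simp [good, h1, h2]

/-- The rank decreases along the residual steps that arise when the first routing goes from the
entry `a` to the entry `b`. -/
def Link (lc : List ℕ) (ρ : ℕ → ℕ) (a b : ℕ) : Prop :=
  (lc[a]? = some 0 → ρ b < ρ a) ∧ ∀ u, Nxt lc a u → ρ b < ρ u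

theorem Compatible.linkStep {ρ : ℕ → ℕ} {rows lc : List ℕ} (h : Compatible ρ rows) {a b : ℕ}
    (hl : Link lc ρ a b) (ha : a < lc.length) :
    ∃ rows', linkStep lc a b rows = some rows' ∧ Compatible ρ rows' := by
  have hg : lc.getD a 0 = lc[a] := by simp [List.getD_eq_getElem?_getD, ha]
  rw [Merging.linkStep, hg]
  by_cases h0 : lc[a] = 0
  · rw [h0, Nat.beq_refl, cond_true]
    exact h.addStep (hl.1 (by rw [List.getElem?_eq_getElem ha, h0]))
  · have h1 : Nat.beq lc[a] 0 = false := by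
      rw [Bool.eq_false_iff]; exact fun e => h0 (Nat.eq_of_beq_eq_true e)
    rw [h1, cond_false]
    rcases hu : nextAt lc[a] (lc.drop (a + 1)) (a + 1) with _ | u
    · exact ⟨rows, rfl, h⟩
    · exact h.addStep (hl.2 u (nxt_of_nextAt (List.drop_eq_getElem_cons ha) h0 hu))

theorem search_false {lc ld : List ℕ} {α β : ℕ → ℕ} {L : List ℕ} {a : ℕ} {E R R' : List ℕ}
    (hL : List.IsChain (fun a b => Link lc α a b ∧ Link ld β a b) (a :: L)) (hnd : L.Nodup)
    (hE : ∀ x ∈ L, x ∈ E) (hc : ∀ x ∈ a :: L, x < lc.length) (hd : ∀ x ∈ a :: L, x < ld.length)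
    (hR : Compatible α R) (hR' : Compatible β R') : search lc ld L.length a E R R' = false := by
  induction L generalizing a E R R' with
  | nil => rfl
  | cons b L ih =>
    rw [List.isChain_cons_cons] at hL
    obtain ⟨Q, h1, h2⟩ := hR.linkStep hL.1.1 (hc a (by simp))
    obtain ⟨Q', h3, h4⟩ := hR'.linkStep hL.1.2 (hd a (by simp))
    rw [List.nodup_cons] at hnd
    rw [List.length_cons, search, List.all_eq_false]
    refine ⟨b, hE b (by simp), ?_⟩
    rw [h1, h3]
    have := ih (E := E.erase b) hL.2 hnd.2 (fun x hx =>
      (List.mem_erase_of_ne (by rintro rfl; exact hnd.1 hx)).2 (hE x (by simp [hx])))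
      (fun x hx => hc x (List.mem_cons_of_mem _ hx)) (fun x hx => hd x (List.mem_cons_of_mem _ hx))
      h2 h4
    simp [this]

theorem refuted_false {lc ld : List ℕ} {α β : ℕ → ℕ} {L E : List ℕ} (hα : Obeys lc ld α)
    (hβ : Obeys ld lc β) (hL : List.IsChain (fun a b => Link lc α a b ∧ Link ld β a b) L)
    (hnd : L.Nodup) (hE : ∀ x ∈ L, x ∈ E) (hlen : L.length = E.length) (hne : E ≠ [])
    (hc : ∀ x ∈ L, x < lc.length) (hd : ∀ x ∈ L, x < ld.length) : refuted lc ld E = false := by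
  obtain ⟨R, h1, h2⟩ := hα.closed
  obtain ⟨R', h3, h4⟩ := hβ.closed
  rcases L with _ | ⟨a, L⟩
  · exact absurd (List.length_eq_zero_iff.1 hlen.symm) hne
  rw [List.nodup_cons] at hnd
  rw [refuted, h1, h3, List.all_eq_false]
  refine ⟨a, hE a (by simp), ?_⟩
  rw [← hlen, List.length_cons, Nat.add_sub_cancel]
  simp [search_false (E := E.erase a) hL hnd.2 (fun x hx =>
    (List.mem_erase_of_ne (by rintro rfl; exact hnd.1 hx)).2 (hE x (by simp [hx]))) hc hd h2 h4]

/-- There is no word with `3n - 1` mergings and one entry for each chain when `n` is `2` or `3`. -/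
theorem not_exists_word {n : ℕ} (hn : n = 2 ∨ n = 3) {lc ld : List ℕ} {α β α' β' : ℕ → ℕ}
    (hα : Obeys lc ld α) (hβ : Obeys ld lc β) (hc0 : lc[0]? = some 1) (hd0 : ld[0]? = some 1)
    (hc : ∀ a ∈ lc, 1 ≤ a ∧ a ≤ 2) (hd : ∀ b ∈ ld, 1 ≤ b ∧ b ≤ n) (hlc : lc.length = 3 * n - 1)
    (hld : ld.length = 3 * n - 1) {k : ℕ} (hk : k ≤ 3 * n - 1)
    (hα' : Obeys (fullFst n lc k) (fullSnd n ld k) α')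
    (hβ' : Obeys (fullSnd n ld k) (fullFst n lc k) β') {L : List ℕ}
    (hL : List.IsChain (fun a b => Link (fullFst n lc k) α' a b ∧ Link (fullSnd n ld k) β' a b) L)
    (hnd : L.Nodup) (hE : ∀ x ∈ L, k ≤ x ∧ x < k + (n + 2)) (hlen : L.length = n + 2) : False := by
  have hw := mem_words hα hβ hc0 hd0 hc hd (hlc.trans hld.symm) (3 * n - 2) (by omega)
  rw [List.take_of_length_le (by omega), List.take_of_length_le (by omega)] at hw
  have hl1 : (fullFst n lc k).length = 4 * n + 1 := by
    simp [fullFst]; omega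
  have hl2 : (fullSnd n ld k).length = 4 * n + 1 := by
    simp [fullSnd]; omega
  have hfalse := refuted_false (E := (List.range (n + 2)).map (k + ·)) hα' hβ' hL hnd
    (fun x hx => by
      have := hE x hx
      rw [List.mem_map]
      exact ⟨x - k, by simp; omega, by omega⟩)
    (by simpa using hlen) (by simp)
    (fun x hx => by have := hE x hx; omega) (fun x hx => by have := hE x hx; omega)
  have htrue : refuted (fullFst n lc k) (fullSnd n ld k) ((List.range (n + 2)).map (k + ·)) =
      true := by
    rcases hn with rfl | rfl
    · exact List.all_eq_true.1 (List.all_eq_true.1 refuted_two _ hw) k (by simp; omega)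
    · exact List.all_eq_true.1 (List.all_eq_true.1 refuted_three _ hw) k (by simp; omega)
  rw [htrue] at hfalse
  exact Bool.noConfusion hfalse

end Merging

namespace Merging

open Relation Finset

/-! ### From points on chains to words -/

section Words

variable {X : Type*} {I Z J Y : Finset X} {σ δ : X → X} {T : X → X → Prop} {τ ρ : X → ℕ}

/-- Two points on a common chain of `σ` are listed in their order on the chain. -/
def Listed (I : Finset X) (σ : X → X) (x y : X) : Prop :=
  σ x ≠ x → σ y ≠ y → root I σ x = root I σ y → Before σ x y

/-- The label of `x` is the position in `l` of the start of the path of `σ` that visits `x`,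
counted from `1`, and is `0` if there is no such path. -/
noncomputable def label [DecidableEq X] (I : Finset X) (σ : X → X) (l : List X) (x : X) : ℕ :=
  if σ x = x then 0 else l.idxOf (root I σ x) + 1

/-- The rank of the point at a position of the list `l`. -/
def rankAt (ρ : X → ℕ) (l : List X) (i : ℕ) : ℕ := (l[i]?).elim 0 ρ

section

variable [DecidableEq X] {l : List X}

theorem label_eq_zero {x : X} : label I σ l x = 0 ↔ σ x = x := by
  by_cases h : σ x = x <;> simp [label, h]

theorem IsRouting.root_eq_of_label (hσ : IsRouting I Z σ) (hτ : ∀ a b, Arc σ a b → τ a < τ b)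
    (hl : ∀ r ∈ I, r ∈ l) {x y : X} {a : ℕ} (ha : a ≠ 0) (hx : label I σ l x = a)
    (hy : label I σ l y = a) : σ x ≠ x ∧ σ y ≠ y ∧ root I σ x = root I σ y := by
  have hx' : σ x ≠ x := fun e => ha (hx.symm.trans (label_eq_zero.2 e))
  have hy' : σ y ≠ y := fun e => ha (hy.symm.trans (label_eq_zero.2 e))
  refine ⟨hx', hy', ?_⟩
  have h : l.idxOf (root I σ x) + 1 = l.idxOf (root I σ y) + 1 := by
    rw [label, if_neg hx'] at hx
    rw [label, if_neg hy'] at hy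
    exact hx.trans hy.symm
  exact (List.idxOf_inj (hl _ (hσ.root_spec hτ hx').1)).1 (Nat.succ_injective h)

theorem label_congr {x y : X} (hx : σ x ≠ x) (hy : σ y ≠ y) (h : root I σ x = root I σ y) :
    label I σ l x = label I σ l y := by
  rw [label, label, if_neg hx, if_neg hy, h]

theorem IsRouting.label_pos (hσ : IsRouting I Z σ) (hτ : ∀ a b, Arc σ a b → τ a < τ b)
    (hl : ∀ r ∈ I, r ∈ l) {x : X} (hx : σ x ≠ x) :
    1 ≤ label I σ l x ∧ label I σ l x ≤ l.length := by
  rw [label, if_neg hx]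
  exact ⟨by omega, List.idxOf_lt_length_of_mem (hl _ (hσ.root_spec hτ hx).1)⟩

end

theorem pairwise_pos {R : X → X → Prop} {p : List X} (hp : p.Pairwise R) {i j : ℕ} (hij : i < j)
    {x y : X} (hx : p[i]? = some x) (hy : p[j]? = some y) : R x y := by
  obtain ⟨hi, rfl⟩ := List.getElem?_eq_some_iff.1 hx
  obtain ⟨hj, rfl⟩ := List.getElem?_eq_some_iff.1 hy
  exact List.pairwise_iff_getElem.1 hp i j hi hj hij

theorem getElem?_map_eq_some {κ : Type*} {f : X → κ} {p : List X} {i : ℕ} {a : κ}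
    (h : (p.map f)[i]? = some a) : ∃ x, p[i]? = some x ∧ f x = a := by
  rw [List.getElem?_map, Option.map_eq_some_iff] at h
  exact h

/-- What it means for a point to follow another one on a chain of `δ`. -/
theorem IsRouting.of_nxt [DecidableEq X] (hδ : IsRouting J Y δ)
    (hτ : ∀ a b, Arc δ a b → τ a < τ b) {l p : List X} (hl : ∀ r ∈ J, r ∈ l)
    (hp : p.Pairwise (Listed J δ)) {i v : ℕ} (h : Nxt (p.map (label J δ l)) i v) :
    ∃ x y, p[i]? = some x ∧ p[v]? = some y ∧ δ x ≠ x ∧ Before δ x y ∧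
      ∀ b ∈ p, Before δ x b → ¬ Before δ b y := by
  obtain ⟨h1, a, ha, h2, h3, h4⟩ := h
  obtain ⟨x, hx, hxa⟩ := getElem?_map_eq_some h2
  obtain ⟨y, hy, hya⟩ := getElem?_map_eq_some h3
  obtain ⟨hx', hy', hr⟩ := hδ.root_eq_of_label hτ hl ha hxa hya
  refine ⟨x, y, hx, hy, hx', pairwise_pos hp h1 hx hy hx' hy' hr, fun b hb hxb hby => ?_⟩
  obtain ⟨k, hk⟩ := List.mem_iff_getElem?.1 hb
  have hbr : root J δ x = root J δ b := hδ.root_eq_of_chain hτ hx' hxb.to_reflTransGen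
  have h5 : i < k := by
    rcases lt_trichotomy k i with h5 | h5 | h5
    · have h6 := Before.lt hτ (pairwise_pos hp h5 hk hx hxb.prev_ne hx' hbr.symm)
      have h7 := Before.lt hτ hxb
      omega
    · rw [h5, hx] at hk
      obtain rfl : x = b := by simpa using hk
      exact absurd (Before.lt hτ hxb) (lt_irrefl _)
    · exact h5
  have h6 : k < v := by
    rcases lt_trichotomy k v with h6 | h6 | h6
    · exact h6
    · rw [h6, hy] at hk
      obtain rfl : y = b := by simpa using hk
      exact absurd (Before.lt hτ hby) (lt_irrefl _)
    · have h8 := Before.lt hτ (pairwise_pos hp h6 hy hk hy' hxb.prev_ne (hr.symm.trans hbr))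
      have h7 := Before.lt hτ hby
      omega
  refine h4 k h5 h6 ?_
  rw [List.getElem?_map, hk, Option.map_some, ← hxa, label_congr hx' hxb.prev_ne hbr]

/-- A list of points which contains all mergings of `σ` and `δ` gives rise to a word which obeys
a residual rank of `σ`. -/
theorem IsResidualRank.obeys [DecidableEq X] (hρ : IsResidualRank I σ T ρ)
    (hσ : IsRouting I Z σ) (hδ : IsRouting J Y δ) (hτ : ∀ a b, T a b → τ a < τ b)
    (hI : ∀ a b, T a b → b ∉ I) (hσT : ∀ a b, Arc σ a b → T a b)
    (hδT : ∀ a b, Arc δ a b → T a b) {l l' p : List X} (hl : ∀ r ∈ I, r ∈ l)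
    (hl' : ∀ r ∈ J, r ∈ l') (hpσ : p.Pairwise (Listed I σ)) (hpδ : p.Pairwise (Listed J δ))
    (hP : ∀ x ∈ merges σ δ, x ∈ p) (hp : ∀ x ∈ p, σ x ≠ x → δ x ≠ x → σ x ≠ δ x) :
    Obeys (p.map (label I σ l)) (p.map (label J δ l')) (rankAt ρ p) := by
  have hτσ : ∀ a b, Arc σ a b → τ a < τ b := fun a b h => hτ a b (hσT a b h)
  have hτδ : ∀ a b, Arc δ a b → τ a < τ b := fun a b h => hτ a b (hδT a b h)
  have hmid : ∀ {x y}, (∀ b ∈ p, Before δ x b → ¬ Before δ b y) →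
      ∀ b, Before δ x b → Before δ b y → σ b ≠ b → σ b = δ b := by
    intro x y h b hxb hby hb
    by_contra hne
    exact h b (hP b ⟨hb, hxb.prev_ne, hne⟩) hxb hby
  refine ⟨fun i j hij a ha h1 h2 => ?_, fun i j v hij a ha h1 h2 h3 => ?_, fun i v h1 h2 => ?_⟩
  · obtain ⟨x, hx, hxa⟩ := getElem?_map_eq_some h1
    obtain ⟨y, hy, hya⟩ := getElem?_map_eq_some h2
    obtain ⟨hx', hy', hr⟩ := hσ.root_eq_of_label hτσ hl ha hxa hya
    simp only [rankAt, hx, hy, Option.elim_some]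
    exact hρ.lt_of_before (hσ.notMem_start hx') hσ (pairwise_pos hpσ hij hx hy hx' hy' hr)
  · obtain ⟨x, hx, hxa⟩ := getElem?_map_eq_some h1
    obtain ⟨u, hu, hua⟩ := getElem?_map_eq_some h2
    obtain ⟨hx', hu', hr⟩ := hσ.root_eq_of_label hτσ hl ha hxa hua
    obtain ⟨x₁, y, hx₁, hy, -, hxy, hno⟩ := hδ.of_nxt hτδ hl' hpδ h3
    obtain rfl : x = x₁ := by simpa [hx] using hx₁
    simp only [rankAt, hu, hy, Option.elim_some]
    exact hρ.lt_of_side hσ hI hδT hxy (hmid hno)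
      (fun h => hp y (List.mem_of_getElem? hy) h hxy.prev_ne)
      (pairwise_pos hpσ hij hx hu hx' hu' hr)
      (fun h => hp u (List.mem_of_getElem? hu) hu' h)
  · obtain ⟨x, hx, hxa⟩ := getElem?_map_eq_some h1
    obtain ⟨x₁, y, hx₁, hy, hx', hxy, hno⟩ := hδ.of_nxt hτδ hl' hpδ h2
    obtain rfl : x = x₁ := by simpa [hx] using hx₁
    simp only [rankAt, hx, hy, Option.elim_some]
    exact hρ.lt_of_off hσ hI hδT hxy (hmid hno) (hI _ _ (hδT _ _ ⟨rfl, hx'⟩))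
      (label_eq_zero.1 hxa)

end Words

end Merging

namespace Merging

open Relation Finset

/-! ### Tight triples with as many joins as possible -/

theorem eq_one_or_two : ∀ c : Fin 3, c ≠ 0 → c = 1 ∨ c = 2 := by decide

section Extremal

variable {X : Type*} {I Z : Fin 3 → Finset X} {σ : Fin 3 → X → X} {τ : X → ℕ}

/-- A tight triple with the maximal number of entries, none of which is a merging of the last two
routings. -/
structure Extremal (I Z : Fin 3 → Finset X) (σ : Fin 3 → X → X) (τ : X → ℕ) : Prop
    extends Tight I Z σ τ where
  inj : Function.Injective τ
  card_entries : (entries σ).ncard = (I 1).card + (I 2).card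
  disjoint : Disjoint (merges (σ 1) (σ 2)) (entries σ)

namespace Extremal

theorem exists_entryStart (h : Extremal I Z σ τ) {y : X ⊕ X} (hy : y ∈ (I 1).disjSum (I 2)) :
    ∃ e ∈ entries σ, entryStart I σ e = y := by
  have := Set.eq_of_subset_of_ncard_le (s := entryStart I σ '' entries σ)
    (t := ((I 1).disjSum (I 2) : Finset (X ⊕ X)))
    (by rintro _ ⟨x, hx, rfl⟩; exact h.entryStart_mem hx)
    (by rw [(h.entryStart_injOn h.inj).ncard_image, h.card_entries, Set.ncard_coe_finset,
      Finset.card_disjSum]) (Finset.finite_toSet _)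
  have hy' : y ∈ entryStart I σ '' entries σ := by rw [this]; exact hy
  exact hy'

open Classical in
/-- An entry belongs to only one of the last two routings: all paths of these are entered, and
none of them is entered twice. -/
theorem entry_excl (h : Extremal I Z σ τ) {e : X} (he : e ∈ entries σ) (h1 : σ 1 e ≠ e) :
    σ 2 e = e := by
  by_contra h2
  obtain ⟨e', he', hee⟩ := h.exists_entryStart (y := Sum.inr (root (I 2) (σ 2) e))
    (Finset.inr_mem_disjSum.2 ((h.routing 2).root_spec (h.arc_lt 2) h2).1)
  rw [entryStart] at hee
  split_ifs at hee with h3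
  rw [Sum.inr.injEq] at hee
  have := h.entries_eq_of_root_eq h.inj (c := 2) (by decide) he' he
    (he'.2.2.resolve_left h3) h2 hee
  rw [this] at h3
  exact h3 h1

open Classical in
/-- Every path of the last two routings is entered. -/
theorem exists_entry (h : Extremal I Z σ τ) {c : Fin 3} (hc : c ≠ 0) {r : X} (hr : r ∈ I c) :
    ∃ e ∈ entries σ, σ c e ≠ e ∧ root (I c) (σ c) e = r := by
  have hc' := eq_one_or_two c hc
  rcases hc' with rfl | rfl
  · obtain ⟨e, he, hee⟩ := h.exists_entryStart (Finset.inl_mem_disjSum.2 hr)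
    rw [entryStart] at hee
    split_ifs at hee with h3
    exact ⟨e, he, h3, by simpa using hee⟩
  · obtain ⟨e, he, hee⟩ := h.exists_entryStart (Finset.inr_mem_disjSum.2 hr)
    rw [entryStart] at hee
    split_ifs at hee with h3
    exact ⟨e, he, he.2.2.resolve_left h3, by simpa using hee⟩

theorem entry_before (h : Extremal I Z σ τ) {c : Fin 3} (hc : c ≠ 0) {e x : X}
    (he : e ∈ entries σ) (hec : σ c e ≠ e) (hx0 : σ 0 x ≠ x) (hxc : σ c x ≠ x)
    (hr : root (I c) (σ c) e = root (I c) (σ c) x) (hne : e ≠ x) : TransGen (Hor σ) e x := by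
  rcases lt_or_gt_of_ne (h.inj.ne hne) with hlt | hlt
  · exact hor_of_before hc ((h.routing c).before_of_root_eq (h.arc_lt c) hec hxc hr hlt)
  · exact absurd (h.hor_prev hx0 he.1 (hor_of_before hc
      ((h.routing c).before_of_root_eq (h.arc_lt c) hxc hec hr.symm hlt))) he.2.1

/-- No node lies on paths of all three routings. -/
theorem exists_off (h : Extremal I Z σ τ) (x : X) : ∃ c, σ c x = x := by
  by_contra hcon
  push Not at hcon
  obtain ⟨e₁, he₁, h11, hr₁⟩ := h.exists_entry (c := 1) (by decide)
    ((h.routing 1).root_spec (h.arc_lt 1) (hcon 1)).1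
  obtain ⟨e₂, he₂, h22, hr₂⟩ := h.exists_entry (c := 2) (by decide)
    ((h.routing 2).root_spec (h.arc_lt 2) (hcon 2)).1
  have h12 := h.entry_excl he₁ h11
  have hx₁ : e₁ ≠ x := by rintro rfl; exact hcon 2 h12
  have hx₂ : e₂ ≠ x := by rintro rfl; exact hcon 2 (h.entry_excl he₂ (hcon 1))
  have hne : e₁ ≠ e₂ := by rintro rfl; exact h22 h12
  have hb₁ := h.entry_before (by decide) he₁ h11 (hcon 0) (hcon 1) hr₁ hx₁
  have hb₂ := h.entry_before (by decide) he₂ h22 (hcon 0) (hcon 2) hr₂ hx₂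
  -- the walk from the earlier entry to `x` bypasses the later one
  have key : ∀ e e', e ∈ entries σ → e' ∈ entries σ → TransGen (Hor σ) e x →
      TransGen (Hor σ) e' x → τ e < τ e' → False := by
    intro e e' he he' hex hex' hlt
    have hroot : ∀ {y z}, σ 0 y ≠ y → σ 0 z ≠ z → root (I 0) (σ 0) y = root (I 0) (σ 0) z :=
      fun hy hz => card_le_one.1 h.card_zero _ ((h.routing 0).root_spec (h.arc_lt 0) hy).1 _
        ((h.routing 0).root_spec (h.arc_lt 0) hz).1
    have h1 := (h.routing 0).before_of_root_eq (h.arc_lt 0) he.1 he'.1 (hroot he.1 he'.1) hlt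
    have h2 := (h.routing 0).before_of_root_eq (h.arc_lt 0) he'.1 (hcon 0)
      (hroot he'.1 (hcon 0)) (Before.lt h.hor_lt hex')
    obtain ⟨a, ha, hae⟩ := TransGen.tail'_iff.1 h1
    apply he'.2.1
    rw [hae.1]
    exact h.hor_of_between ha he.1 hae h2.to_reflTransGen hex.to_reflTransGen
  rcases lt_or_gt_of_ne (h.inj.ne hne) with hlt | hlt
  · exact key _ _ he₁ he₂ hb₁ hb₂ hlt
  · exact key _ _ he₂ he₁ hb₂ hb₁ hlt

/-- The residual rank of one of the last two routings in the union of all three. -/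
theorem exists_rank_tot [Finite X] (h : Extremal I Z σ τ) (c : Fin 3) :
    ∃ ρ, IsResidualRank (I c) (σ c) (Tot σ) ρ := by
  classical
  obtain ⟨ρ, h1, h2, h3⟩ := (h.routing c).exists_residual_rank (T := Tot σ)
    (O := fun a b => ∃ d, d ≠ c ∧ Arc (σ d) a b) h.lt (fun a b hab => h.start a b hab c)
    (fun a b hab => ⟨c, hab⟩) (fun σ' hσ' hsub a b hab => by
      have hne : ∀ k, k ≠ c → Function.update σ c σ' k = σ k :=
        fun k hk => Function.update_of_ne hk _ _
      obtain ⟨d, hd⟩ := h.tot_min (Function.update σ c σ') (fun k => by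
        by_cases hk : k = c
        · subst hk; rw [Function.update_self]; exact hσ'
        · rw [hne k hk]; exact h.routing k) (fun p q hpq => by
        obtain ⟨k, hk⟩ := hpq
        by_cases hkc : k = c
        · subst hkc; rw [Function.update_self] at hk; exact hsub _ _ hk
        · rw [hne k hkc] at hk; exact ⟨k, hk⟩) a b ⟨c, hab⟩
      by_cases hdc : d = c
      · subst hdc; rw [Function.update_self] at hd; exact Or.inl hd
      · rw [hne d hdc] at hd; exact Or.inr ⟨d, hdc, hd⟩)
    (fun a b e hab ⟨d, hdc, hab'⟩ ⟨k, hae⟩ => by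
      by_cases hkc : k = c
      · subst hkc; exact (h.routing k).arc_rightUnique hae hab
      by_cases hkd : k = d
      · subst hkd; exact (h.routing k).arc_rightUnique hae hab'
      exfalso
      have hall : ∀ j : Fin 3, ∃ v, Arc (σ j) a v := by
        intro j
        have : ∀ c d k j : Fin 3, d ≠ c → k ≠ c → k ≠ d → j = c ∨ j = d ∨ j = k := by decide
        rcases this c d k j hdc hkc hkd with rfl | rfl | rfl
        exacts [⟨b, hab⟩, ⟨b, hab'⟩, ⟨e, hae⟩]
      have hon : ∀ j, a ∉ I j → σ j a ≠ a := by
        intro j hj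
        obtain ⟨v, rfl, hv⟩ := hall j
        exact (h.routing j).prev_ne hv hj
      by_cases hI : ∃ j, a ∈ I j
      · obtain ⟨j, hj⟩ := hI
        obtain ⟨i, hij⟩ : ∃ i : Fin 3, i ≠ j := exists_ne j
        have hi : a ∉ I i := fun hi => hij (h.disj i j a hi hj)
        exact h.start (σ i a) a ⟨i, rfl, hon i hi⟩ j hj
      · push Not at hI
        obtain ⟨j, hj⟩ := h.exists_off a
        exact hon j (hI j) hj)
  exact ⟨ρ, h1, h2, h3⟩

/-- The residual rank of a later routing decreases along the first routing from one entry to the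
next. -/
theorem link [DecidableEq X] (h : Extremal I Z σ τ) {c : Fin 3} (hc : c ≠ 0) {ρ : X → ℕ}
    (hρ : IsResidualRank (I c) (σ c) (Tot σ) ρ) {l p : List X} (hl : ∀ r ∈ I c, r ∈ l)
    (hp : p.Pairwise (Listed (I c) (σ c)))
    (hpm : ∀ x ∈ p, x ∈ merges (σ 1) (σ 2) ∪ entries σ) {x y : X} (hx : x ∈ entries σ)
    (hy : y ∈ entries σ) (hxp : x ∈ p) (hyp : y ∈ p) (hlt : τ x < τ y)
    (hno : ∀ e ∈ entries σ, τ x < τ e → ¬ τ e < τ y) :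
    Link (p.map (label (I c) (σ c) l)) (rankAt ρ p) (p.idxOf x) (p.idxOf y) := by
  have hgx : p[p.idxOf x]? = some x := List.getElem?_idxOf hxp
  have hgy : p[p.idxOf y]? = some y := List.getElem?_idxOf hyp
  have hxy : Before (σ 0) x y := (h.routing 0).before_of_root_eq (h.arc_lt 0) hx.1 hy.1
    (card_le_one.1 h.card_zero _ ((h.routing 0).root_spec (h.arc_lt 0) hx.1).1 _
      ((h.routing 0).root_spec (h.arc_lt 0) hy.1).1) hlt
  have hc' := eq_one_or_two c hc
  have hmid : ∀ b, Before (σ 0) x b → Before (σ 0) b y → σ c b ≠ b → σ c b = σ 0 b := by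
    intro b hxb hby hb
    by_contra hne
    have hb12 : σ 1 b ≠ b ∨ σ 2 b ≠ b := by
      rcases hc' with rfl | rfl
      · exact Or.inl hb
      · exact Or.inr hb
    by_cases hH : Hor σ (σ 0 b) b
    · have hall : σ 1 b ≠ b ∧ σ 2 b ≠ b := by
        rcases hc' with rfl | rfl <;> rcases hH with hH | hH
        · exact absurd hH.1 hne
        · exact ⟨hb, hH.2⟩
        · exact ⟨hH.2, hb⟩
        · exact absurd hH.1 hne
      obtain ⟨j, hj⟩ := h.exists_off b
      fin_cases j
      · exact hxb.prev_ne hj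
      · exact hall.1 hj
      · exact hall.2 hj
    · exact hno b ⟨hxb.prev_ne, hH, hb12⟩ (Before.lt (h.arc_lt 0) hxb)
        (Before.lt (h.arc_lt 0) hby)
  have hσT : ∀ a b, Arc (σ c) a b → Tot σ a b := fun a b hab => ⟨c, hab⟩
  have hδT : ∀ a b, Arc (σ 0) a b → Tot σ a b := fun a b hab => ⟨0, hab⟩
  have hI : ∀ a b, Tot σ a b → b ∉ I c := fun a b hab => h.start a b hab c
  refine ⟨fun h0 => ?_, fun u hu => ?_⟩
  · obtain ⟨x', hx', h0'⟩ := getElem?_map_eq_some h0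
    obtain rfl : x = x' := by simpa [hgx] using hx'
    simp only [rankAt, hgx, hgy, Option.elim_some]
    exact hρ.lt_of_off (h.routing c) hI hδT hxy hmid (hI _ _ ⟨0, rfl, hx.1⟩)
      (label_eq_zero.1 h0')
  · obtain ⟨x', v, hx', hv, -, hxv, -⟩ := (h.routing c).of_nxt (h.arc_lt c) hl hp hu
    obtain rfl : x = x' := by simpa [hgx] using hx'
    simp only [rankAt, hgy, hv, Option.elim_some]
    refine hρ.lt_of_side (h.routing c) hI hδT hxy hmid (fun hyc e => hy.2.1 ?_) hxv
      (fun h0 => ?_)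
    · have hyc' : Arc (σ c) (σ 0 y) y := ⟨e, hyc⟩
      rcases hc' with rfl | rfl
      · exact Or.inl hyc'
      · exact Or.inr hyc'
    · exfalso
      rcases hpm v (List.mem_of_getElem? hv) with hvM | hvE
      · obtain ⟨j, hj⟩ := h.exists_off v
        fin_cases j
        · exact h0 hj
        · exact hvM.1 hj
        · exact hvM.2.1 hj
      · exact h.entries_antichain hx hvE (hor_of_before hc hxv)

end Extremal

end Extremal

theorem isChain_consecutive {X : Type*} {τ : X → ℕ} {l : List X}
    (h : l.Pairwise (fun a b => τ a < τ b)) :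
    l.IsChain (fun a b => a ∈ l ∧ b ∈ l ∧ τ a < τ b ∧ ∀ e ∈ l, τ a < τ e → ¬ τ e < τ b) := by
  rw [List.isChain_iff_getElem]
  intro i hi
  have hlt : ∀ {j k} (hj : j < l.length) (hk : k < l.length), j < k → τ l[j] < τ l[k] :=
    fun hj hk hjk => List.pairwise_iff_getElem.1 h _ _ hj hk hjk
  refine ⟨List.getElem_mem _, List.getElem_mem _, hlt _ _ (Nat.lt_succ_self i),
    fun e he h1 h2 => ?_⟩
  obtain ⟨j, hj, rfl⟩ := List.getElem_of_mem he
  rcases lt_trichotomy i j with hij | hij | hij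
  · rcases Nat.lt_or_eq_of_le (Nat.succ_le_of_lt hij) with h3 | h3
    · exact absurd (hlt hi hj h3) (by omega)
    · subst h3; exact lt_irrefl _ h2
  · subst hij; exact lt_irrefl _ h1
  · exact absurd (hlt hj (by omega) hij) (by omega)

theorem exists_sorted {X : Type*} {τ : X → ℕ} (hτ : Function.Injective τ) (s : Finset X) :
    ∃ l : List X, l.Pairwise (fun a b => τ a < τ b) ∧ (∀ x, x ∈ l ↔ x ∈ s) ∧
      l.length = s.card := by
  classical
  let _ : LinearOrder X := LinearOrder.lift' τ hτ
  exact ⟨s.sort (· ≤ ·), s.sortedLT_sort.pairwise, fun x => s.mem_sort (· ≤ ·),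
    s.length_sort (· ≤ ·)⟩

theorem map_idxOf_self {X : Type*} [DecidableEq X] {l : List X} (h : l.Nodup) :
    l.map (fun r => l.idxOf r) = List.range l.length := by
  refine List.ext_getElem (by simp) fun i h1 h2 => ?_
  simp only [List.length_map] at h1
  simp [h.idxOf_getElem i h1]

end Merging

namespace Merging

open Relation Finset

section Bound

variable {X : Type*} {I Z : Fin 3 → Finset X} {σ : Fin 3 → X → X} {τ : X → ℕ}

/-- A list that names the starts in `I`, beginning with the given one. -/
theorem exists_list_cons {X : Type*} {I : Finset X} {r : X} (hr : r ∈ I) :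
    ∃ l : List X, l.Nodup ∧ (∀ x, x ∈ l ↔ x ∈ I) ∧ l.length = I.card ∧ l[0]? = some r := by
  classical
  refine ⟨r :: (I.erase r).toList, ?_, fun x => ?_, ?_, by simp⟩
  · rw [List.nodup_cons]; exact ⟨by simp, Finset.nodup_toList _⟩
  · by_cases hx : x = r <;> simp [hx, hr]
  · rw [List.length_cons, Finset.length_toList, card_erase_of_mem hr]
    have := card_pos.2 ⟨r, hr⟩
    omega

theorem label_of_root_eq_head [DecidableEq X] {J : Finset X} {δ : X → X} {l : List X} {x : X}
    (hx : δ x ≠ x) (hl : l[0]? = some (root J δ x)) : label J δ l x = 1 := by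
  rcases l with _ | ⟨a, l⟩
  · simp at hl
  · obtain rfl : a = root J δ x := by simpa using hl
    simp [label, hx]

/-- When the third routing has two or three paths, the second one has two paths, and these merge
as often as possible, then not every path can be entered by the first routing. -/
theorem Extremal.false [Finite X] (h : Extremal I Z σ τ) {n : ℕ} (hn : n = 2 ∨ n = 3)
    (h1 : (I 1).card = 2) (h2 : (I 2).card = n)
    (hM : (merges (σ 1) (σ 2)).ncard = 3 * n - 1) : False := by
  classical
  have hMf := Set.toFinite (merges (σ 1) (σ 2))
  have hEf := Set.toFinite (entries σ)
  -- the mergings that precede the entries, those that follow them, and the entries themselves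
  set late : Set X := {x | ∃ e ∈ entries σ, TransGen (Hor σ) e x} with hlate
  obtain ⟨p₁, hp₁, hm₁, hl₁⟩ := exists_sorted h.inj (hMf.toFinset.filter (fun x => x ∉ late))
  obtain ⟨p₂, hp₂, hm₂, hl₂⟩ := exists_sorted h.inj (hMf.toFinset.filter (fun x => x ∈ late))
  obtain ⟨q, hq, hmq, hlq⟩ := exists_sorted h.inj hEf.toFinset
  simp only [mem_filter, Set.Finite.mem_toFinset] at hm₁ hm₂ hmq
  have hlen : p₁.length + p₂.length = 3 * n - 1 := by
    rw [hl₁, hl₂, ← hM, Set.ncard_eq_toFinset_card _ hMf, add_comm,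
      card_filter_add_card_filter_not]
  have hlenq : q.length = n + 2 := by
    rw [hlq, ← Set.ncard_eq_toFinset_card _ hEf, h.card_entries, h1, h2, add_comm]
  -- the starts of the paths are listed so that the first merging has the label `1` for both
  -- routings
  obtain ⟨x₀, hx₀⟩ : ∃ x₀, (p₁ ++ p₂)[0]? = some x₀ := by
    have h0 : 0 < (p₁ ++ p₂).length := by rw [List.length_append]; omega
    exact ⟨_, List.getElem?_eq_getElem h0⟩
  have hmem : ∀ x, x ∈ p₁ ++ p₂ ↔ x ∈ merges (σ 1) (σ 2) := by
    intro x
    rw [List.mem_append, hm₁, hm₂, ← and_or_left]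
    exact and_iff_left (em _).symm
  have hx₀M : x₀ ∈ merges (σ 1) (σ 2) := (hmem _).1 (List.mem_of_getElem? hx₀)
  obtain ⟨lA, hndA, hmA, hlA, hA0⟩ :=
    exists_list_cons ((h.routing 1).root_spec (h.arc_lt 1) hx₀M.1).1
  obtain ⟨lB, hndB, hmB, hlB, hB0⟩ :=
    exists_list_cons ((h.routing 2).root_spec (h.arc_lt 2) hx₀M.2.1).1
  have hentry : ∀ c : Fin 3, ∃ f : X → X, c ≠ 0 → ∀ r ∈ I c,
      f r ∈ entries σ ∧ σ c (f r) ≠ f r ∧ root (I c) (σ c) (f r) = r := by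
    intro c
    by_cases hc : c = 0
    · exact ⟨id, fun h => absurd hc h⟩
    · choose! f hf using fun r => h.exists_entry (r := r) hc
      exact ⟨f, fun _ => hf⟩
  obtain ⟨fA, hfA⟩ := hentry 1
  obtain ⟨fB, hfB⟩ := hentry 2
  replace hfA := hfA (by decide)
  replace hfB := hfB (by decide)
  -- the entries, listed like the paths that they enter
  set eA := lA.map fA with heA
  set eB := lB.map fB with heB
  have hmeA : ∀ x, x ∈ eA ↔ x ∈ entries σ ∧ σ 1 x ≠ x := by
    intro x
    rw [heA, List.mem_map]
    constructor
    · rintro ⟨r, hr, rfl⟩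
      have := hfA r ((hmA r).1 hr)
      exact ⟨this.1, this.2.1⟩
    · rintro ⟨hx, hx1⟩
      have hr := ((h.routing 1).root_spec (h.arc_lt 1) hx1).1
      have h3 := hfA _ hr
      exact ⟨_, (hmA _).2 hr, h.entries_eq_of_root_eq h.inj (by decide) h3.1 hx h3.2.1 hx1 h3.2.2⟩
  have hmeB : ∀ x, x ∈ eB ↔ x ∈ entries σ ∧ σ 2 x ≠ x := by
    intro x
    rw [heB, List.mem_map]
    constructor
    · rintro ⟨r, hr, rfl⟩
      have := hfB r ((hmB r).1 hr)
      exact ⟨this.1, this.2.1⟩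
    · rintro ⟨hx, hx1⟩
      have hr := ((h.routing 2).root_spec (h.arc_lt 2) hx1).1
      have h3 := hfB _ hr
      exact ⟨_, (hmB _).2 hr, h.entries_eq_of_root_eq h.inj (by decide) h3.1 hx h3.2.1 hx1 h3.2.2⟩
  have hmE : ∀ x, x ∈ eA ++ eB ↔ x ∈ entries σ := by
    intro x
    rw [List.mem_append, hmeA, hmeB, ← and_or_left]
    exact and_iff_left_of_imp fun hx => hx.2.2
  have hndE : (eA ++ eB).Nodup := by
    rw [List.nodup_append]
    refine ⟨hndA.map_on fun x hx y hy hxy => ?_, hndB.map_on fun x hx y hy hxy => ?_, ?_⟩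
    · rw [← (hfA x ((hmA x).1 hx)).2.2, ← (hfA y ((hmA y).1 hy)).2.2, hxy]
    · rw [← (hfB x ((hmB x).1 hx)).2.2, ← (hfB y ((hmB y).1 hy)).2.2, hxy]
    · rintro x hx y hy rfl
      exact ((hmeB x).1 hy).2 (h.entry_excl ((hmeA x).1 hx).1 ((hmeA x).1 hx).2)
  -- no entry precedes another one along the last two routings, so that this order of the points
  -- is compatible with the order on the paths
  set p := p₁ ++ (eA ++ eB) ++ p₂ with hp
  have hmp : ∀ x, x ∈ p ↔ x ∈ merges (σ 1) (σ 2) ∪ entries σ := by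
    intro x
    rw [hp, List.mem_append, List.mem_append, hmE, Set.mem_union, ← hmem x, List.mem_append]
    tauto
  have hlisted : ∀ c : Fin 3, c ≠ 0 → ∀ x y, (¬ Before (σ c) y x) → x ≠ y →
      Listed (I c) (σ c) x y := by
    intro c hc x y hyx hne hx hy hr
    rcases lt_or_gt_of_ne (h.inj.ne hne) with hlt | hlt
    · exact (h.routing c).before_of_root_eq (h.arc_lt c) hx hy hr hlt
    · exact absurd ((h.routing c).before_of_root_eq (h.arc_lt c) hy hx hr.symm hlt) hyx
  have hsorted : ∀ (c : Fin 3) {x y}, τ x < τ y → ¬ Before (σ c) y x :=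
    fun c x y hlt hb => absurd (Before.lt (h.arc_lt c) hb) (by omega)
  have hlist₁₂ : ∀ c : Fin 3, c ≠ 0 → ∀ x ∈ p₁, ∀ y ∈ p₂, Listed (I c) (σ c) x y := by
    intro c hc x hx y hy
    have hx' := ((hm₁ x).1 hx).2
    obtain ⟨e, he, hey⟩ := ((hm₂ y).1 hy).2
    refine hlisted c hc x y (fun hb => hx' ⟨e, he, hey.trans (hor_of_before hc hb)⟩) ?_
    rintro rfl
    exact hx' ⟨e, he, hey⟩
  have hpw : ∀ c : Fin 3, c ≠ 0 → p.Pairwise (Listed (I c) (σ c)) := by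
    intro c hc
    rw [hp, List.pairwise_append, List.pairwise_append]
    refine ⟨⟨hp₁.imp fun {x y} hlt => hlisted c hc x y (hsorted c hlt) (by rintro rfl; omega),
      hndE.imp_of_mem fun {x y} hx hy hne => ?_, fun x hx y hy => ?_⟩,
      hp₂.imp fun {x y} hlt => hlisted c hc x y (hsorted c hlt) (by rintro rfl; omega),
      fun x hx y hy => ?_⟩
    · exact hlisted c hc x y (fun hb => h.entries_antichain ((hmE _).1 hy) ((hmE _).1 hx)
        (hor_of_before hc hb)) hne
    · have hx' := (hm₁ x).1 hx
      have hy' := (hmE y).1 hy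
      exact hlisted c hc x y (fun hb => hx'.2 ⟨y, hy', hor_of_before hc hb⟩)
        (fun e => Set.disjoint_left.1 h.disjoint hx'.1 (e ▸ hy'))
    · rcases List.mem_append.1 hx with hx | hx
      · exact hlist₁₂ c hc x hx y hy
      · have hx' := (hmE x).1 hx
        obtain ⟨hyM, e, he, hey⟩ := (hm₂ y).1 hy
        exact hlisted c hc x y
          (fun hb => h.entries_antichain he hx' (hey.trans (hor_of_before hc hb)))
          (fun e => Set.disjoint_left.1 h.disjoint hyM (e ▸ hx'))
  have hpw' : ∀ c : Fin 3, c ≠ 0 → (p₁ ++ p₂).Pairwise (Listed (I c) (σ c)) := by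
    intro c hc
    rw [List.pairwise_append]
    exact ⟨hp₁.imp fun {x y} hlt => hlisted c hc x y (hsorted c hlt) (by rintro rfl; omega),
      hp₂.imp fun {x y} hlt => hlisted c hc x y (hsorted c hlt) (by rintro rfl; omega),
      hlist₁₂ c hc⟩
  obtain ⟨α, hα⟩ := h.exists_rank_tot 1
  obtain ⟨β, hβ⟩ := h.exists_rank_tot 2
  have hT : ∀ c : Fin 3, ∀ a b, Arc (σ c) a b → Tot σ a b := fun c a b hab => ⟨c, hab⟩
  have hI : ∀ c : Fin 3, ∀ a b, Tot σ a b → b ∉ I c := fun c a b hab => h.start a b hab c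
  have hcA : ∀ r ∈ I 1, r ∈ lA := fun r => (hmA r).2
  have hcB : ∀ r ∈ I 2, r ∈ lB := fun r => (hmB r).2
  have hpp : ∀ x ∈ p, σ 1 x ≠ x → σ 2 x ≠ x → σ 1 x ≠ σ 2 x := by
    intro x hx h3 h4
    rcases (hmp x).1 hx with h5 | h5
    · exact h5.2.2
    · exact absurd (h.entry_excl h5 h3) h4
  set labA := label (I 1) (σ 1) lA with hlabA
  set labB := label (I 2) (σ 2) lB with hlabB
  have hfst : p.map labA = fullFst n ((p₁ ++ p₂).map labA) p₁.length := by
    have e1 : eA.map labA = [1, 2] := by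
      have : eA.map labA = (lA.map (fun r => lA.idxOf r)).map (· + 1) := by
        rw [heA, List.map_map, List.map_map]
        refine List.map_congr_left fun r hr => ?_
        have h3 := hfA r ((hmA r).1 hr)
        simp [hlabA, label, h3.2.1, h3.2.2]
      rw [this, map_idxOf_self hndA, hlA, h1]
      rfl
    have e2 : eB.map labA = List.replicate n 0 := by
      rw [List.eq_replicate_iff]
      refine ⟨by rw [heB, List.length_map, List.length_map, hlB, h2], fun a ha => ?_⟩
      obtain ⟨x, hx, rfl⟩ := List.mem_map.1 ha
      have h3 := (hmeB x).1 hx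
      rw [hlabA, label_eq_zero]
      by_contra h4
      exact h3.2 (h.entry_excl h3.1 h4)
    simp only [fullFst, hp, List.map_append, e1, e2]
    rw [← List.length_map (f := labA), List.take_left, List.drop_left]
  have hsnd : p.map labB = fullSnd n ((p₁ ++ p₂).map labB) p₁.length := by
    have e1 : eB.map labB = (List.range n).map (· + 1) := by
      have : eB.map labB = (lB.map (fun r => lB.idxOf r)).map (· + 1) := by
        rw [heB, List.map_map, List.map_map]
        refine List.map_congr_left fun r hr => ?_
        have h3 := hfB r ((hmB r).1 hr)
        simp [hlabB, label, h3.2.1, h3.2.2]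
      rw [this, map_idxOf_self hndB, hlB, h2]
    have e2 : eA.map labB = [0, 0] := by
      have : [0, 0] = List.replicate 2 0 := rfl
      rw [this, List.eq_replicate_iff]
      refine ⟨by rw [heA, List.length_map, List.length_map, hlA, h1], fun a ha => ?_⟩
      obtain ⟨x, hx, rfl⟩ := List.mem_map.1 ha
      have h3 := (hmeA x).1 hx
      rw [hlabB, label_eq_zero]
      exact h.entry_excl h3.1 h3.2
    simp only [fullSnd, hp, List.map_append, e1, e2]
    rw [← List.length_map (f := labB), List.take_left, List.drop_left]
  have hα' := hα.obeys (h.routing 1) (h.routing 2) h.lt (hI 1) (hT 1) (hT 2) hcA hcB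
    (hpw 1 (by decide)) (hpw 2 (by decide)) (fun x hx => (hmp x).2 (Or.inl hx)) hpp
  have hβ' := hβ.obeys (h.routing 2) (h.routing 1) h.lt (hI 2) (hT 2) (hT 1) hcB hcA
    (hpw 2 (by decide)) (hpw 1 (by decide))
    (fun x hx => (hmp x).2 (Or.inl ⟨hx.2.1, hx.1, hx.2.2.symm⟩))
    (fun x hx h3 h4 e => hpp x hx h4 h3 e.symm)
  have hαM := hα.obeys (h.routing 1) (h.routing 2) h.lt (hI 1) (hT 1) (hT 2) hcA hcB
    (hpw' 1 (by decide)) (hpw' 2 (by decide)) (fun x hx => (hmem x).2 hx)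
    (fun x hx _ _ => ((hmem x).1 hx).2.2)
  have hβM := hβ.obeys (h.routing 2) (h.routing 1) h.lt (hI 2) (hT 2) (hT 1) hcB hcA
    (hpw' 2 (by decide)) (hpw' 1 (by decide))
    (fun x hx => (hmem x).2 ⟨hx.2.1, hx.1, hx.2.2.symm⟩)
    (fun x hx _ _ e => ((hmem x).1 hx).2.2 e.symm)
  -- the first routing visits the entries in the order of their topological numbers
  have hchain : List.IsChain (fun a b =>
      Link (p.map labA) (rankAt α p) a b ∧ Link (p.map labB) (rankAt β p) a b)
      (q.map (fun x => p.idxOf x)) := by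
    rw [List.isChain_map]
    refine (isChain_consecutive hq).imp fun a b hab => ?_
    obtain ⟨ha, hb, hlt, hno⟩ := hab
    have ha' := (hmq a).1 ha
    have hb' := (hmq b).1 hb
    have hap := (hmp a).2 (Or.inr ha')
    have hbp := (hmp b).2 (Or.inr hb')
    have hno' : ∀ e ∈ entries σ, τ a < τ e → ¬ τ e < τ b := fun e he => hno e ((hmq e).2 he)
    exact ⟨h.link (by decide) hα hcA (hpw 1 (by decide)) (fun x hx => (hmp x).1 hx) ha' hb' hap
      hbp hlt hno', h.link (by decide) hβ hcB (hpw 2 (by decide)) (fun x hx => (hmp x).1 hx) ha'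
      hb' hap hbp hlt hno'⟩
  rw [← hlabA, ← hlabB, hfst, hsnd] at hα' hβ'
  rw [hfst, hsnd] at hchain
  refine not_exists_word hn hαM hβM ?_ ?_ ?_ ?_ ?_ ?_ (k := p₁.length) (by omega) hα' hβ' hchain
    ?_ ?_ ?_
  · rw [List.getElem?_map, hx₀, Option.map_some, label_of_root_eq_head hx₀M.1 hA0]
  · rw [List.getElem?_map, hx₀, Option.map_some, label_of_root_eq_head hx₀M.2.1 hB0]
  · intro a ha
    obtain ⟨x, hx, rfl⟩ := List.mem_map.1 ha
    have := (h.routing 1).label_pos (h.arc_lt 1) hcA ((hmem x).1 hx).1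
    rwa [hlA, h1] at this
  · intro a ha
    obtain ⟨x, hx, rfl⟩ := List.mem_map.1 ha
    have := (h.routing 2).label_pos (h.arc_lt 2) hcB ((hmem x).1 hx).2.1
    rwa [hlB, h2] at this
  · rw [List.length_map, List.length_append, hlen]
  · rw [List.length_map, List.length_append, hlen]
  · refine List.Nodup.map_on (fun x hx y _ hxy => ?_)
      (hq.imp fun {x y} hlt => (by rintro rfl; omega))
    exact (List.idxOf_inj ((hmp x).2 (Or.inr ((hmq x).1 hx)))).1 hxy
  · intro i hi
    obtain ⟨x, hx, rfl⟩ := List.mem_map.1 hi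
    have hxE := (hmq x).1 hx
    have hx₁ : x ∉ p₁ := fun h3 => Set.disjoint_left.1 h.disjoint ((hm₁ x).1 h3).1 hxE
    have hxe := (hmE x).2 hxE
    have h3 : p.idxOf x = p₁.length + (eA ++ eB).idxOf x := by
      rw [hp, List.append_assoc, List.idxOf_append_of_notMem hx₁,
        List.idxOf_append_of_mem hxe]
    have h4 := List.idxOf_lt_length_of_mem hxe
    have h5 : (eA ++ eB).length = n + 2 := by
      rw [List.length_append, heA, heB, List.length_map, List.length_map, hlA, hlB, h1, h2,
        add_comm]
    omega
  · rw [List.length_map, hlenq]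

/-- For two or three paths of the third routing the number of joins is one below the general
bound. -/
theorem Tight.ncard_joins_le_of_small [Finite X] (h : Tight I Z σ τ)
    (hinj : Function.Injective τ) {n : ℕ} (hn : n = 2 ∨ n = 3) (h1 : (I 1).card ≤ 2)
    (h2 : (I 2).card ≤ n) : (joins σ).ncard ≤ 4 * n := by
  by_contra hcon
  have e1 := Set.ncard_le_ncard (joins_subset (σ := σ)) (Set.toFinite _)
  have e2 := Set.ncard_union_add_ncard_inter (merges (σ 1) (σ 2)) (entries σ)
  have e3 := h.ncard_merges_le hinj h1
  have e4 := h.ncard_entries_le hinj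
  have e5 : (merges (σ 1) (σ 2) ∩ entries σ).ncard = 0 := by omega
  rw [Set.ncard_eq_zero] at e5
  exact (Extremal.mk h hinj (by omega) (Set.disjoint_iff_inter_eq_empty.2 e5)).false hn
    (by omega) (by omega) (by omega)

end Bound

end Merging

namespace Merging

open Relation Finset

/-! ### Edge-disjoint paths and routings -/

section Lists

variable {X : Type*}

/-- The list `l` passes from `a` directly to `b`. -/
def Consec (l : List X) (a b : X) : Prop := ∃ i, l[i]? = some a ∧ l[i + 1]? = some b

theorem consec_iff {l : List X} {a b : X} : Consec l a b ↔ [a, b] <:+: l := by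
  constructor
  · rintro ⟨i, h1, h2⟩
    obtain ⟨hi, rfl⟩ := List.getElem?_eq_some_iff.1 h1
    obtain ⟨hi', rfl⟩ := List.getElem?_eq_some_iff.1 h2
    refine ⟨l.take i, l.drop (i + 2), ?_⟩
    have e1 := List.drop_eq_getElem_cons hi
    have e2 := List.drop_eq_getElem_cons hi'
    rw [List.append_assoc]
    conv_rhs => rw [← List.take_append_drop i l, e1, e2]
    simp
  · rintro ⟨s, t, rfl⟩
    refine ⟨s.length, ?_, ?_⟩
    · rw [List.append_assoc, List.getElem?_append_right le_rfl]; simp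
    · rw [List.append_assoc, List.getElem?_append_right (by omega)]; simp

/-- A relation in which nodes have at most one predecessor and at most one successor is a
routing, if it starts in `I` and may end in `Z`. -/
theorem exists_routing_of_rel {I Z : Finset X} (S : X → X → Prop)
    (hleft : ∀ a b c, S a c → S b c → a = b) (hright : ∀ a b c, S a b → S a c → b = c)
    (hI : ∀ a, ∀ x ∈ I, ¬ S a x) (hZ : ∀ a, ∀ x ∈ Z, ¬ S x a)
    (hsrc : ∀ a x, S a x → a ∉ I → ∃ b, S b a) (hend : ∀ z ∈ Z, z ∉ I → ∃ a, S a z) :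
    ∃ σ : X → X, IsRouting I Z σ ∧ ∀ a b, Arc σ a b → S a b := by
  classical
  set σ : X → X := fun x => if h : ∃ a, S a x then h.choose else x with hσ
  have hσ1 : ∀ {a x}, S a x → σ x = a := by
    intro a x hax
    have h : ∃ a, S a x := ⟨a, hax⟩
    rw [hσ]
    simp only [dif_pos h]
    exact hleft _ _ _ h.choose_spec hax
  have hσ2 : ∀ {x}, (¬ ∃ a, S a x) → σ x = x := fun h => dif_neg h
  refine ⟨σ, ⟨fun x hx => hσ2 fun ⟨a, ha⟩ => hI a x hx ha, fun x hx => ?_,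
    fun x hx y hy hxy => ?_⟩, ?_⟩
  · by_cases h : ∃ a, S a x
    · obtain ⟨a, ha⟩ := h
      rw [hσ1 ha]
      exact fun h => hZ _ _ h ha
    · rw [hσ2 h]
      exact fun hxZ => h (hend x hxZ hx)
  · by_cases h : ∃ a, S a x <;> by_cases h' : ∃ a, S a y
    · obtain ⟨a, ha⟩ := h
      obtain ⟨b, hb⟩ := h'
      rw [hσ1 ha, hσ1 hb] at hxy
      subst hxy
      exact hright _ _ _ ha hb
    · obtain ⟨a, ha⟩ := h
      rw [hσ1 ha, hσ2 h'] at hxy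
      subst hxy
      exact absurd (hsrc _ _ ha hy) h'
    · obtain ⟨b, hb⟩ := h'
      rw [hσ1 hb, hσ2 h] at hxy
      subst hxy
      exact absurd (hsrc _ _ hb hx) h
    · rwa [hσ2 h, hσ2 h'] at hxy
  · rintro a b ⟨rfl, hb⟩
    by_cases h : ∃ a, S a b
    · obtain ⟨a, ha⟩ := h
      rw [hσ1 ha]
      exact ha
    · exact absurd (hσ2 h) hb

/-- A family of disjoint lists without repetitions is a routing. -/
theorem exists_routing_of_lists [DecidableEq X] {ι : Type*} (F : Finset ι) (l : ι → List X)
    (first last : ι → X) (hfirst : ∀ p ∈ F, (l p)[0]? = some (first p))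
    (hlast : ∀ p ∈ F, (l p)[(l p).length - 1]? = some (last p)) (hnd : ∀ p ∈ F, (l p).Nodup)
    (hdisj : ∀ p ∈ F, ∀ q ∈ F, ∀ x ∈ l p, x ∈ l q → p = q) :
    ∃ σ : X → X, IsRouting (F.image first) (F.image last) σ ∧
      (∀ a b, Arc σ a b → ∃ p ∈ F, Consec (l p) a b) ∧
      (F.image first).card = F.card ∧ (F.image last).card = F.card := by
  classical
  set S : X → X → Prop := fun a b => ∃ p ∈ F, Consec (l p) a b with hS
  have hpos : ∀ p ∈ F, ∀ q ∈ F, ∀ (i j : ℕ) (x : X), (l p)[i]? = some x → (l q)[j]? = some x →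
      p = q ∧ i = j := by
    intro p hp q hq i j x h1 h2
    obtain rfl := hdisj p hp q hq x (List.mem_of_getElem? h1) (List.mem_of_getElem? h2)
    obtain ⟨hi, h1⟩ := List.getElem?_eq_some_iff.1 h1
    obtain ⟨hj, h2⟩ := List.getElem?_eq_some_iff.1 h2
    exact ⟨rfl, ((hnd p hp).getElem_inj_iff).1 (h1.trans h2.symm)⟩
  have hleft : ∀ a b c, S a c → S b c → a = b := by
    rintro a b c ⟨p, hp, i, h1, h2⟩ ⟨q, hq, j, h3, h4⟩
    obtain ⟨rfl, hij⟩ := hpos p hp q hq _ _ c h2 h4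
    obtain rfl : i = j := by omega
    simpa [h1] using h3
  have hright : ∀ a b c, S a b → S a c → b = c := by
    rintro a b c ⟨p, hp, i, h1, h2⟩ ⟨q, hq, j, h3, h4⟩
    obtain ⟨rfl, rfl⟩ := hpos p hp q hq _ _ a h1 h3
    simpa [h2] using h4
  -- a node of a list which is not a first node has a predecessor
  have hprev : ∀ p ∈ F, ∀ x ∈ l p, x ∉ F.image first → ∃ a, S a x := by
    intro p hp x hx hxI
    obtain ⟨i, hi⟩ := List.mem_iff_getElem?.1 hx
    rcases i with _ | i
    · exfalso
      rw [hfirst p hp] at hi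
      exact hxI (mem_image.2 ⟨p, hp, by simpa using hi⟩)
    · have hi' : i < (l p).length := by
        have := (List.getElem?_eq_some_iff.1 hi).1; omega
      exact ⟨(l p)[i], p, hp, i, List.getElem?_eq_getElem hi', hi⟩
  have hI : ∀ a, ∀ x ∈ F.image first, ¬ S a x := by
    rintro a x hx ⟨p, hp, i, h1, h2⟩
    obtain ⟨q, hq, rfl⟩ := mem_image.1 hx
    have := (hpos p hp q hq _ _ _ h2 (hfirst q hq)).2
    omega
  have hZ : ∀ a, ∀ x ∈ F.image last, ¬ S x a := by
    rintro a x hx ⟨p, hp, i, h1, h2⟩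
    obtain ⟨q, hq, rfl⟩ := mem_image.1 hx
    obtain ⟨rfl, hi⟩ := hpos p hp q hq _ _ _ h1 (hlast q hq)
    have := (List.getElem?_eq_some_iff.1 h2).1
    omega
  obtain ⟨σ, h1, h2⟩ := exists_routing_of_rel S hleft hright hI hZ
    (fun a x ⟨p, hp, i, h1, _⟩ ha => hprev p hp a (List.mem_of_getElem? h1) ha)
    (fun z hz hzI => by
      obtain ⟨p, hp, rfl⟩ := mem_image.1 hz
      exact hprev p hp _ (List.mem_of_getElem? (hlast p hp)) hzI)
  refine ⟨σ, h1, h2, ?_, ?_⟩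
  · refine card_image_of_injOn fun p hp q hq hpq => ?_
    exact hdisj p hp q hq _ (List.mem_of_getElem? (hfirst p hp))
      (by rw [hpq]; exact List.mem_of_getElem? (hfirst q hq))
  · refine card_image_of_injOn fun p hp q hq hpq => ?_
    exact hdisj p hp q hq _ (List.mem_of_getElem? (hlast p hp))
      (by rw [hpq]; exact List.mem_of_getElem? (hlast q hq))

/-- A finite acyclic relation has an injective topological numbering. -/
theorem exists_numbering [Finite X] {A : X → X → Prop} (hA : ∀ x, ¬ TransGen A x x) :
    ∃ τ : X → ℕ, Function.Injective τ ∧ ∀ a b, A a b → τ a < τ b := by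
  classical
  obtain ⟨n, ⟨e⟩⟩ := Finite.exists_equiv_fin X
  set g : X → ℕ := fun x => {y | TransGen A y x}.ncard
  refine ⟨fun x => g x * n + e x, fun x y hxy => ?_, fun a b hab => ?_⟩
  · have h1 := (e x).2
    have h2 := (e y).2
    have h3 : (g x * n + e x) % n = (g y * n + e y) % n := congrArg (· % n) hxy
    rw [Nat.mul_add_mod', Nat.mul_add_mod', Nat.mod_eq_of_lt h1, Nat.mod_eq_of_lt h2] at h3
    exact e.injective (Fin.ext h3)
  · have h : g a < g b := by
      refine Set.ncard_lt_ncard ⟨fun y hy => TransGen.tail hy hab, fun hsub => ?_⟩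
        (Set.toFinite _)
      exact hA a (hsub (TransGen.single hab))
    have h1 := (e a).2
    have h2 : (g a + 1) * n ≤ g b * n := Nat.mul_le_mul_right _ h
    rw [add_one_mul] at h2
    simp only
    omega

end Lists

section Graph

open DiMultigraph

variable (G : DiMultigraph)

theorem isPath_append {G : DiMultigraph} {u v : G.V} {p q : List G.E} :
    G.IsPath u v (p ++ q) ↔ ∃ w, G.IsPath u w p ∧ G.IsPath w v q := by
  induction p generalizing u with
  | nil => simp [IsPath]
  | cons e p ih => simp [IsPath, ih, and_assoc]

theorem isPath_consec {G : DiMultigraph} {u v : G.V} {p : List G.E} (h : G.IsPath u v p)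
    {e f : G.E} (hef : Consec p e f) : G.tgt e = G.src f := by
  obtain ⟨s, t, rfl⟩ := consec_iff.1 hef
  obtain ⟨w, h1, h2⟩ := isPath_append.1 h
  obtain ⟨w', h3, h4⟩ := isPath_append.1 h1
  exact h4.2.1.symm

theorem isPath_head {G : DiMultigraph} {u v : G.V} {p : List G.E} (h : G.IsPath u v p)
    {e : G.E} (he : p[0]? = some e) : G.src e = u := by
  rcases p with _ | ⟨f, p⟩
  · simp at he
  · obtain rfl : f = e := by simpa using he
    exact h.1

theorem isPath_last {G : DiMultigraph} {u v : G.V} {p : List G.E} (h : G.IsPath u v p)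
    {e : G.E} (he : p[p.length - 1]? = some e) : G.tgt e = v := by
  rw [← List.getLast?_eq_getElem?] at he
  obtain ⟨q, rfl⟩ := List.getLast?_eq_some_iff.1 he
  obtain ⟨w, -, h2⟩ := isPath_append.1 h
  exact h2.2

theorem isPath_nodup {G : DiMultigraph} (hG : G.Acyclic) {u v : G.V} {p : List G.E}
    (h : G.IsPath u v p) : p.Nodup := by
  induction p generalizing u with
  | nil => simp
  | cons e p ih =>
    refine List.nodup_cons.2 ⟨fun he => ?_, ih h.2⟩
    obtain ⟨s, t, rfl⟩ := List.append_of_mem he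
    obtain ⟨w, h1, h2⟩ := isPath_append.1 h.2
    have : G.IsPath u u (e :: s) := ⟨h.1, by rw [← h.1, h2.1]; exact h1⟩
    exact absurd (hG _ _ this) (by simp)

/-- The number of disjoint paths is at most the size of a cut. -/
theorem card_le_card_of_isCut {G : DiMultigraph} {u v : G.V} {P : Finset (List G.E)}
    (hP : G.IsEdgeDisjointPaths u v P) {C : Finset G.E} (hC : G.IsCut u v C) :
    P.card ≤ C.card := by
  classical
  rcases P.eq_empty_or_nonempty with rfl | ⟨p₀, hp₀⟩
  · simp
  obtain ⟨e₀, -, -⟩ := hC p₀ (hP.1 p₀ hp₀)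
  have : Nonempty G.E := ⟨e₀⟩
  choose! f hf using fun p (hp : p ∈ P) => hC p (hP.1 p hp)
  refine card_le_card_of_injOn f (fun p hp => (hf p hp).2) fun p hp q hq hpq => ?_
  by_contra hne
  exact hP.2 p hp q hq hne _ (hf p hp).1 (by rw [hpq]; exact (hf q hq).1)

theorem exists_cut {G : DiMultigraph} {u v : G.V} {k : ℕ} (h : G.minCut u v = k) :
    ∃ C : Finset G.E, G.IsCut u v C ∧ C.card ≤ k := by
  have h1 : G.minCut u v < ((k + 1 : ℕ) : ℕ∞) := by
    rw [h]; exact_mod_cast Nat.lt_succ_self k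
  simp only [minCut, iInf_lt_iff] at h1
  obtain ⟨C, hC, hlt⟩ := h1
  exact ⟨C, hC, Nat.lt_succ_iff.1 (by exact_mod_cast hlt)⟩

theorem exists_isMengerSet {G : DiMultigraph} {u v : G.V} {k : ℕ} (h : G.minCut u v = k) :
    ∃ P, G.IsMengerSet u v P ∧ P.card ≤ k := by
  classical
  obtain ⟨C, hC, hk⟩ := exists_cut h
  set s : Set ℕ := {m | ∃ P, G.IsEdgeDisjointPaths u v P ∧ P.card = m}
  have hs : s.Nonempty := ⟨0, ∅, ⟨by simp, by simp⟩, rfl⟩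
  have hb : BddAbove s := ⟨k, by
    rintro m ⟨P, hP, rfl⟩; exact (card_le_card_of_isCut hP hC).trans hk⟩
  obtain ⟨P, hP, hm⟩ := Nat.sSup_mem hs hb
  refine ⟨P, ⟨hP, fun Q hQ => ?_⟩, (card_le_card_of_isCut hP hC).trans hk⟩
  rw [hm]
  exact le_csSup hb ⟨Q, hQ, rfl⟩

theorem ne_nil_of_minCut {G : DiMultigraph} {u v : G.V} {k : ℕ} (h : G.minCut u v = k)
    {p : List G.E} (hp : G.IsPath u v p) : p ≠ [] := by
  rintro rfl
  obtain ⟨C, hC, -⟩ := exists_cut h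
  obtain ⟨e, he, -⟩ := hC [] hp
  simp at he

/-- The nodes between which routings lead: the edges of the network and, for each edge and each
of the three families of paths, a private start before this edge. -/
abbrev Node (G : DiMultigraph) : Type := G.E ⊕ (Fin 3 × G.E)

/-- The arcs along which paths may lead. -/
inductive Adm {G : DiMultigraph} (S : Fin 3 → G.V) : Node G → Node G → Prop
  | edge (e f : G.E) (h : G.tgt e = G.src f) : Adm S (Sum.inl e) (Sum.inl f)
  | start (i : Fin 3) (e : G.E) (h : G.src e = S i) : Adm S (Sum.inr (i, e)) (Sum.inl e)

theorem Adm.exists_eq {G : DiMultigraph} {S : Fin 3 → G.V} {a b : Node G} (h : Adm S a b) :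
    ∃ e, b = Sum.inl e := by
  cases h <;> exact ⟨_, rfl⟩

theorem Adm.acyclic {G : DiMultigraph} (hG : G.Acyclic) {S : Fin 3 → G.V} (x : Node G) :
    ¬ TransGen (Adm S) x x := by
  intro hx
  have key : ∀ e y, TransGen (Adm S) (Sum.inl e) y → ∃ f p, y = Sum.inl f ∧ p ≠ [] ∧
      G.IsPath (G.src e) (G.src f) p := by
    intro e y hy
    induction hy with
    | single h =>
      cases h with
      | edge _ f h => exact ⟨f, [e], rfl, by simp, rfl, h⟩
    | tail _ h ih =>
      obtain ⟨f, p, rfl, hp, hpath⟩ := ih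
      cases h with
      | edge _ g h => exact ⟨g, p ++ [f], rfl, by simp, isPath_append.2 ⟨_, hpath, rfl, h⟩⟩
  obtain ⟨c, -, hc⟩ := TransGen.tail'_iff.1 hx
  obtain ⟨e, rfl⟩ := hc.exists_eq
  obtain ⟨f, p, hf, hp, hpath⟩ := key e _ hx
  obtain rfl : e = f := Sum.inl_injective hf
  exact hp (hG _ _ hpath)

/-- A set of disjoint paths gives a routing. -/
theorem exists_routing_of_paths {G : DiMultigraph} (hG : G.Acyclic) (S : Fin 3 → G.V)
    (i : Fin 3) {v : G.V} {P : Finset (List G.E)} (hP : G.IsEdgeDisjointPaths (S i) v P)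
    (hne : ∀ p ∈ P, p ≠ []) :
    ∃ (I Z : Finset (Node G)) (σ : Node G → Node G), IsRouting I Z σ ∧
      (∀ a b, Arc σ a b → Adm S a b) ∧ I.card = P.card ∧ Z.card = P.card ∧
      (∀ x ∈ I, ∃ e, x = Sum.inr (i, e)) ∧ ∀ x ∈ Z, ∃ e, x = Sum.inl e ∧ G.tgt e = v := by
  classical
  rcases P.eq_empty_or_nonempty with rfl | ⟨p₀, hp₀⟩
  · exact ⟨∅, ∅, id, ⟨by simp, by simp, fun _ _ _ _ h => h⟩, fun a b h => absurd rfl h.2, rfl,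
      rfl, by simp, by simp⟩
  obtain ⟨e₀, -⟩ := List.exists_mem_of_ne_nil _ (hne p₀ hp₀)
  have hhead : ∀ p : List G.E, ∃ e, p ∈ P → p[0]? = some e := fun p => by
    by_cases hp : p ∈ P
    · exact ⟨_, fun _ => List.getElem?_eq_getElem (List.length_pos_iff.2 (hne p hp))⟩
    · exact ⟨e₀, fun h => absurd h hp⟩
  have hlast : ∀ p : List G.E, ∃ e, p ∈ P → p[p.length - 1]? = some e := fun p => by
    by_cases hp : p ∈ P
    · have := List.length_pos_iff.2 (hne p hp)
      exact ⟨_, fun _ => List.getElem?_eq_getElem (show p.length - 1 < p.length by omega)⟩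
    · exact ⟨e₀, fun h => absurd h hp⟩
  choose fst hfst using hhead
  choose lst hlst using hlast
  have hdis : ∀ p ∈ P, ∀ q ∈ P, ∀ e ∈ p, e ∈ q → p = q := fun p hp q hq e he he' => by
    by_contra hne
    exact hP.2 p hp q hq hne e he he'
  obtain ⟨σ, h1, h2, h3, h4⟩ := exists_routing_of_lists P
    (fun p => (Sum.inr (i, fst p) : Node G) :: p.map Sum.inl) (fun p => Sum.inr (i, fst p))
    (fun p => Sum.inl (lst p)) (fun p hp => by simp)
    (fun p hp => by
      have := List.length_pos_iff.2 (hne p hp)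
      obtain ⟨m, hm⟩ : ∃ m, p.length = m + 1 := ⟨p.length - 1, by omega⟩
      have h := hlst p hp
      simp only [hm, Nat.add_sub_cancel] at h
      have e : ((Sum.inr (i, fst p) : Node G) :: p.map Sum.inl).length - 1 = m + 1 := by simp [hm]
      rw [e, List.getElem?_cons_succ, List.getElem?_map, h, Option.map_some])
    (fun p hp => by
      rw [List.nodup_cons]
      exact ⟨by simp, (isPath_nodup hG (hP.1 p hp)).map Sum.inl_injective⟩)
    (fun p hp q hq x hx hx' => by
      rw [List.mem_cons, List.mem_map] at hx hx'
      rcases hx with rfl | ⟨e, he, rfl⟩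
      · rcases hx' with h | ⟨e, -, h⟩
        · simp only [Sum.inr.injEq, Prod.mk.injEq, true_and] at h
          exact hdis p hp q hq _ (List.mem_of_getElem? (hfst p hp))
            (by rw [h]; exact List.mem_of_getElem? (hfst q hq))
        · simp at h
      · rcases hx' with h | ⟨e', he', h⟩
        · simp at h
        · exact hdis p hp q hq e he (Sum.inl_injective h ▸ he'))
  refine ⟨_, _, σ, h1, fun a b hab => ?_, h3, h4, ?_, ?_⟩
  · obtain ⟨p, hp, j, ha, hb⟩ := h2 a b hab
    rw [List.getElem?_cons_succ, List.getElem?_map, Option.map_eq_some_iff] at hb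
    obtain ⟨f, hf, rfl⟩ := hb
    rcases j with _ | j
    · obtain rfl : Sum.inr (i, fst p) = a := by simpa using ha
      obtain rfl : fst p = f := by simpa [hfst p hp] using hf
      exact Adm.start i _ (isPath_head (hP.1 p hp) (hfst p hp))
    · rw [List.getElem?_cons_succ, List.getElem?_map, Option.map_eq_some_iff] at ha
      obtain ⟨e, he, rfl⟩ := ha
      exact Adm.edge _ _ (isPath_consec (hP.1 p hp) ⟨j, he, hf⟩)
  · intro x hx
    obtain ⟨p, -, rfl⟩ := mem_image.1 hx
    exact ⟨_, rfl⟩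
  · intro x hx
    obtain ⟨p, hp, rfl⟩ := mem_image.1 hx
    exact ⟨_, rfl, isPath_last (hP.1 p hp) (hlst p hp)⟩

/-- A routing gives a set of disjoint paths. -/
theorem exists_paths_of_routing {G : DiMultigraph} {S : Fin 3 → G.V} {i : Fin 3} {v : G.V}
    {I Z : Finset (Node G)} {σ : Node G → Node G} {τ : Node G → ℕ} (hσ : IsRouting I Z σ)
    (hA : ∀ a b, Arc σ a b → Adm S a b) (hτ : ∀ a b, Adm S a b → τ a < τ b)
    (hI : ∀ x ∈ I, ∃ e, x = Sum.inr (i, e)) (hZ : ∀ x ∈ Z, ∃ e, x = Sum.inl e ∧ G.tgt e = v) :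
    ∃ P, G.IsEdgeDisjointPaths (S i) v P ∧ P.card = Z.card ∧
      ∀ p ∈ P, ∀ e f, Consec p e f → Arc σ (Sum.inl e) (Sum.inl f) := by
  classical
  have key : ∀ e, σ (Sum.inl e) ≠ Sum.inl e → ∃ p : List G.E, G.IsPath (S i) (G.tgt e) (p ++ [e]) ∧
      (∀ f g, Consec (p ++ [e]) f g → Arc σ (Sum.inl f) (Sum.inl g)) ∧
      ∀ f ∈ p ++ [e], ReflTransGen (Arc σ) (Sum.inl f) (Sum.inl e) := by
    intro e he
    induction hk : τ (Sum.inl e) using Nat.strong_induction_on generalizing e with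
    | _ k ih =>
    subst hk
    have hadm := hA _ _ ⟨rfl, he⟩
    rcases hx : σ (Sum.inl e) with f | ⟨j, f⟩
    · rw [hx] at hadm
      have hfI : σ (Sum.inl e) ∉ I := fun h => by
        obtain ⟨g, hg⟩ := hI _ h
        rw [hx] at hg
        exact Sum.inl_ne_inr hg
      have hf := hσ.prev_ne he hfI
      rw [hx] at hf
      obtain ⟨p, h1, h2, h3⟩ := ih _ (hτ _ _ hadm) f hf rfl
      have harc : Arc σ (Sum.inl f) (Sum.inl e) := ⟨hx, he⟩
      refine ⟨p ++ [f], isPath_append.2 ⟨_, h1, ?_, rfl⟩, fun g g' hg => ?_, fun g hg => ?_⟩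
      · cases hadm with
        | edge _ _ h => exact h.symm
      · obtain ⟨j, hj, hj'⟩ := hg
        by_cases hlt : j + 1 < (p ++ [f]).length
        · rw [List.getElem?_append_left hlt] at hj'
          rw [List.getElem?_append_left (by omega)] at hj
          exact h2 _ _ ⟨j, hj, hj'⟩
        · have hlt' := (List.getElem?_eq_some_iff.1 hj').1
          simp only [List.length_append, List.length_singleton] at hlt hlt'
          obtain rfl : j = p.length := by omega
          have e1 : f = g := by simpa using hj
          have e2 : e = g' := by simpa using hj'
          rw [← e1, ← e2]
          exact harc
      · rcases List.mem_append.1 hg with hg | hg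
        · exact (h3 g hg).tail harc
        · rw [List.mem_singleton] at hg
          rw [hg]
    · have hmem : σ (Sum.inl e) ∈ I := by
        by_contra h
        obtain ⟨g, hg⟩ := (hA _ _ ⟨rfl, hσ.prev_ne he h⟩).exists_eq
        rw [hx] at hg
        exact Sum.inr_ne_inl hg
      obtain ⟨g, hg⟩ := hI _ hmem
      rw [hx] at hg hadm
      simp only [Sum.inr.injEq, Prod.mk.injEq] at hg
      obtain ⟨rfl, rfl⟩ := hg
      refine ⟨[], ?_, fun f' g' hf' => ?_, fun f' hf' => ?_⟩
      · cases hadm with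
        | start _ _ h => exact ⟨h, rfl⟩
      · obtain ⟨j', -, hj'⟩ := hf'
        simp at hj'
      · simp only [List.nil_append, List.mem_singleton] at hf'
        rw [hf']
  have hZσ : ∀ e, Sum.inl e ∈ Z → σ (Sum.inl e) ≠ Sum.inl e := by
    intro e he h
    refine hσ.notEnd (Sum.inl e) (fun hi => ?_) (by rw [h]; exact he)
    obtain ⟨g, hg⟩ := hI _ hi
    exact Sum.inl_ne_inr hg
  have hz : ∀ z : Node G, ∃ p : List G.E, z ∈ Z → G.IsPath (S i) v p ∧
      (∀ f g, Consec p f g → Arc σ (Sum.inl f) (Sum.inl g)) ∧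
      (∀ f ∈ p, ReflTransGen (Arc σ) (Sum.inl f) z) ∧ p ≠ [] := by
    intro z
    by_cases h : z ∈ Z
    · obtain ⟨e, rfl, rfl⟩ := hZ z h
      obtain ⟨p, h1, h2, h3⟩ := key e (hZσ e h)
      exact ⟨_, fun _ => ⟨h1, h2, h3, by simp⟩⟩
    · exact ⟨[], fun h' => absurd h' h⟩
  choose P hP using hz
  have hdis : ∀ z ∈ Z, ∀ z' ∈ Z, ∀ e ∈ P z, e ∈ P z' → z = z' := by
    have hend : ∀ z ∈ Z, ∀ y, ReflTransGen (Arc σ) z y → z = y := by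
      intro z hz y hy
      rcases hy.cases_head with h | ⟨c, hc, -⟩
      · exact h
      · exact absurd (by rw [hc.1]; exact hz) (hσ.notEnd c (hσ.notMem_start hc.2))
    intro z hz z' hz' e he he'
    rcases ReflTransGen.total_of_right_unique (r := Arc σ)
      (fun _ _ _ h h' => hσ.arc_rightUnique h h') ((hP z hz).2.2.1 e he)
      ((hP z' hz').2.2.1 e he') with h | h
    · exact hend z hz z' h
    · exact (hend z' hz' z h).symm
  refine ⟨Z.image P, ⟨?_, ?_⟩, ?_, ?_⟩
  · intro p hp
    obtain ⟨z, hz, rfl⟩ := mem_image.1 hp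
    exact (hP z hz).1
  · intro p hp q hq hpq e he he'
    obtain ⟨z, hz, rfl⟩ := mem_image.1 hp
    obtain ⟨z', hz', rfl⟩ := mem_image.1 hq
    exact hpq (by rw [hdis z hz z' hz' e he he'])
  · refine card_image_of_injOn fun z hz z' hz' h => ?_
    obtain ⟨e, he⟩ := List.exists_mem_of_ne_nil _ (hP z hz).2.2.2
    exact hdis z hz z' hz' e he (by rw [← h]; exact he)
  · intro p hp
    obtain ⟨z, hz, rfl⟩ := mem_image.1 hp
    exact (hP z hz).2.1

end Graph

section Upper

open DiMultigraph UnicastNetwork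

/-- Every network has sets of Menger's paths whose mergings are joins of a tight triple of
routings. -/
theorem exists_tight_of_network (G : UnicastNetwork 3) (c : Fin 3 → ℕ) (hc0 : c 0 ≤ 1)
    (hc : ∀ i, G.minCut (G.S i) (G.R i) = (c i : ℕ∞)) :
    ∃ (I Z : Fin 3 → Finset (Node G.toDiMultigraph))
      (σ : Fin 3 → Node G.toDiMultigraph → Node G.toDiMultigraph)
      (τ : Node G.toDiMultigraph → ℕ), Tight I Z σ τ ∧ Function.Injective τ ∧
      (∀ i, (I i).card ≤ c i) ∧ Finite (Node G.toDiMultigraph) ∧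
      G.minMergings ≤ ((joins σ).ncard : ℕ∞) := by
  classical
  have := G.finE
  have hfin : Finite (Node G.toDiMultigraph) := inferInstance
  choose α hα hαc using fun i => exists_isMengerSet (hc i)
  choose I Z ω hω hωA hI hZ hI' hZ' using fun i => exists_routing_of_paths G.acyclic G.S i
    (hα i).1 (fun p hp => ne_nil_of_minCut (hc i) ((hα i).1.1 p hp))
  obtain ⟨τ, hinj, hτ⟩ := exists_numbering (Adm.acyclic (S := G.S) G.acyclic)
  obtain ⟨σ, hσ, hσA⟩ := exists_tight (I := I) (Z := Z) (σ := ω) hτ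
    (fun a b hab i hb => by
      obtain ⟨e, rfl⟩ := hab.exists_eq
      obtain ⟨f, hf⟩ := hI' i _ hb
      exact Sum.inl_ne_inr hf)
    (fun i j x hi hj => by
      obtain ⟨e, rfl⟩ := hI' i _ hi
      obtain ⟨f, hf⟩ := hI' j _ hj
      simp only [Sum.inr.injEq, Prod.mk.injEq] at hf
      exact hf.1)
    ((hI 0).le.trans ((hαc 0).trans hc0)) ((hI 0).trans (hZ 0).symm) hω hωA
  choose β hβ hβc hβσ using fun i => exists_paths_of_routing (hσ.routing i) (hσA i) hτ (hI' i)
    (hZ' i)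
  refine ⟨I, Z, σ, τ, hσ, hinj, fun i => (hI i).le.trans (hαc i), hfin, ?_⟩
  have hβM : ∀ i, G.IsMengerSet (G.S i) (G.R i) (β i) := fun i =>
    ⟨hβ i, fun Q hQ => ((hα i).2 Q hQ).trans ((hZ i).symm.trans (hβc i).symm).le⟩
  refine (iInf₂_le β hβM).trans ?_
  have hsub : Sum.inl '' G.mergingEdges β ⊆ joins σ := by
    rintro _ ⟨e, ⟨k, s, b, hs, hb, hall, i, j, hij, f, g, hfg, hf, hg⟩, rfl⟩
    exact ⟨Sum.inl f, Sum.inl g, fun h => hfg (Sum.inl_injective h),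
      ⟨s i, hβσ _ _ (hb i) _ _ (consec_iff.2 hf)⟩, ⟨s j, hβσ _ _ (hb j) _ _ (consec_iff.2 hg)⟩⟩
  rw [numMergings, ← Sum.inl_injective.encard_image]
  exact (Set.encard_le_encard hsub).trans_eq (Set.toFinite _).cast_ncard_eq.symm

theorem maxMinMergings_le {n : ℕ} (hn : 1 ≤ n) : maxMinMergings ![1, 2, n] ≤ (4 * n + 1 : ℕ) := by
  refine iSup₂_le fun G hG => ?_
  obtain ⟨I, Z, σ, τ, hσ, hinj, hI, hfin, hle⟩ := exists_tight_of_network G ![1, 2, n] le_rfl hG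
  refine hle.trans ?_
  exact_mod_cast hσ.ncard_joins_le hinj (hI 1) hn (hI 2)

theorem maxMinMergings_le_of_small {n : ℕ} (hn : n = 2 ∨ n = 3) :
    maxMinMergings ![1, 2, n] ≤ (4 * n : ℕ) := by
  refine iSup₂_le fun G hG => ?_
  obtain ⟨I, Z, σ, τ, hσ, hinj, hI, hfin, hle⟩ := exists_tight_of_network G ![1, 2, n] le_rfl hG
  refine hle.trans ?_
  exact_mod_cast hσ.ncard_joins_le_of_small hinj hn (hI 1) (hI 2)

end Upper

end Merging

namespace Merging

open Relation Finset

/-! ### Networks whose sets of Menger's paths are unique -/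

/-- A layout of three families of `k 0`, `k 1` and `k 2` disjoint chains of points: `pred c p` is
the predecessor of the point `p` on the chains of the family `c`; it is `none` if `p` is on none
of them and `some (Sum.inr j)` if `p` is the first point of the `j`-th chain. The points
`last c j` are the last points of the chains. The ranks `ρ` certify that the chains of each family
cannot be rerouted along those of the others (`back`, `side`, `off`). The points are numbered
topologically by `τ`, and each of them lies on chains of at least two families
(`two`). -/
structure Layout (k : Fin 3 → ℕ) (α : Type) where
  pred : Fin 3 → α → Option (α ⊕ ℕ)
  last : Fin 3 → ℕ → α
  τ : α → ℕ
  ρ : Fin 3 → α → ℕ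
  start_lt : ∀ c p j, pred c p = some (Sum.inr j) → j < k c
  pred_inj : ∀ c p q a, pred c p = some a → pred c q = some a → p = q
  pred_used : ∀ c p x, pred c p = some (Sum.inl x) → pred c x ≠ none
  last_inj : ∀ c i j, i < k c → j < k c → last c i = last c j → i = j
  last_used : ∀ c j, j < k c → pred c (last c j) ≠ none
  last_final : ∀ c j p, j < k c → pred c p ≠ some (Sum.inl (last c j))
  lt : ∀ c p x, pred c p = some (Sum.inl x) → τ x < τ p
  back : ∀ c p x, pred c p = some (Sum.inl x) → ρ c x < ρ c p
  side : ∀ c d u v x, c ≠ d → pred c u = some (Sum.inl x) → pred d v = some (Sum.inl x) →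
    ρ c v < ρ c u
  off : ∀ c d v x, pred c x = none → pred d v = some (Sum.inl x) → ρ c v < ρ c x
  two : ∀ p, ∃ c d, c ≠ d ∧ pred c p ≠ none ∧ pred d p ≠ none

namespace Layout

variable {k : Fin 3 → ℕ} {α : Type}

/-- The vertices of the network of a layout: each point gives two of them. The vertex `idle` is
not connected to the sources. -/
inductive Vtx (α : Type) : Type
  | pin (p : α)
  | pout (p : α)
  | source (i : Fin 3)
  | sink (i : Fin 3)
  | idle

/-- The edges of the network of a layout: an edge through each point, an edge to each point for
each family, and an edge from the end of each chain. -/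
inductive Edg (k : Fin 3 → ℕ) (α : Type) : Type
  | thru (p : α)
  | into (i : Fin 3) (p : α)
  | exit (i : Fin 3) (j : Fin (k i))

instance [Finite α] : Finite (Vtx α) :=
  Finite.of_surjective (fun x : α ⊕ α ⊕ Fin 3 ⊕ Fin 3 ⊕ Unit => match x with
    | .inl p => Vtx.pin p
    | .inr (.inl p) => Vtx.pout p
    | .inr (.inr (.inl i)) => Vtx.source i
    | .inr (.inr (.inr (.inl i))) => Vtx.sink i
    | .inr (.inr (.inr (.inr _))) => Vtx.idle) fun
    | .pin p => ⟨.inl p, rfl⟩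
    | .pout p => ⟨.inr (.inl p), rfl⟩
    | .source i => ⟨.inr (.inr (.inl i)), rfl⟩
    | .sink i => ⟨.inr (.inr (.inr (.inl i))), rfl⟩
    | .idle => ⟨.inr (.inr (.inr (.inr ()))), rfl⟩

instance [Finite α] : Finite (Edg k α) :=
  Finite.of_surjective (fun x : α ⊕ (Fin 3 × α) ⊕ (Σ i, Fin (k i)) => match x with
    | .inl p => Edg.thru p
    | .inr (.inl q) => Edg.into q.1 q.2
    | .inr (.inr q) => Edg.exit q.1 q.2) fun
    | .thru p => ⟨.inl p, rfl⟩
    | .into i p => ⟨.inr (.inl (i, p)), rfl⟩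
    | .exit i j => ⟨.inr (.inr ⟨i, j⟩), rfl⟩

variable (L : Layout k α)

/-- The source of the edge that leads to a point of a chain. -/
def origin (i : Fin 3) : Option (α ⊕ ℕ) → Vtx α
  | some (Sum.inl x) => Vtx.pout x
  | some (Sum.inr _) => Vtx.source i
  | none => Vtx.idle

/-- The multigraph of a layout. -/
def graph [Finite α] : DiMultigraph where
  V := Vtx α
  E := Edg k α
  finV := inferInstance
  finE := inferInstance
  src
    | .thru p => Vtx.pin p
    | .into i p => origin i (L.pred i p)
    | .exit i j => Vtx.pout (L.last i j)
  tgt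
    | .thru p => Vtx.pout p
    | .into _ p => Vtx.pin p
    | .exit i _ => Vtx.sink i

/-- A topological numbering of the vertices. -/
noncomputable def height [Fintype α] : Vtx α → ℕ
  | .pin p => 2 * L.τ p + 1
  | .pout p => 2 * L.τ p + 2
  | .source _ => 0
  | .sink _ => univ.sup (fun p => 2 * L.τ p + 3)
  | .idle => 0

theorem height_lt [Fintype α] (e : Edg k α) :
    L.height (L.graph.src e) < L.height (L.graph.tgt e) := by
  rcases e with p | ⟨i, p⟩ | ⟨i, j⟩
  · simp [graph, height]
  · simp only [graph, height]
    rcases h : L.pred i p with _ | x | j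
    · simp [origin]
    · have := L.lt i p x h
      simp only [origin]
      omega
    · simp [origin]
  · have := Finset.le_sup (f := fun p => 2 * L.τ p + 3) (mem_univ (L.last i j))
    simp only [graph, height]
    omega

theorem acyclic [Fintype α] : L.graph.Acyclic := by
  have key : ∀ (p : List (Edg k α)) (u v : Vtx α), L.graph.IsPath u v p →
      p = [] ∨ L.height u < L.height v := by
    intro p
    induction p with
    | nil => exact fun _ _ _ => Or.inl rfl
    | cons e p ih =>
      rintro u v ⟨rfl, h⟩
      right
      have h1 := L.height_lt e
      rcases ih _ _ h with rfl | h2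
      · have : L.graph.tgt e = v := h
        rwa [this] at h1
      · exact h1.trans h2
  intro u p hp
  exact (key p u u hp).resolve_right (lt_irrefl _)

/-- The network of a layout. -/
def network [Fintype α] : UnicastNetwork 3 where
  toDiMultigraph := L.graph
  acyclic := L.acyclic
  S := Vtx.source
  R := Vtx.sink
  S_injective := fun _ _ h => Vtx.source.inj h
  R_injective := fun _ _ h => Vtx.sink.inj h

theorem src_eq_source [Fintype α] {e : Edg k α} {i : Fin 3} (h : L.graph.src e = Vtx.source i) :
    ∃ p j, e = Edg.into i p ∧ L.pred i p = some (Sum.inr j) := by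
  rcases e with p | ⟨c, p⟩ | ⟨c, j⟩
  · simp [graph] at h
  · simp only [graph] at h
    rcases h' : L.pred c p with _ | x | j <;> rw [h'] at h <;> simp only [origin] at h
    · cases h
    · cases h
    · cases h
      exact ⟨p, j, rfl, h'⟩
  · simp [graph] at h

open Classical in
/-- The edges from a source to the first points of the chains. -/
noncomputable def firstEdges [Fintype α] (i : Fin 3) : Finset (Edg k α) :=
  (univ.filter (fun p => ∃ j, L.pred i p = some (Sum.inr j))).image (Edg.into i)

theorem card_firstEdges_le [Fintype α] (i : Fin 3) : (L.firstEdges i).card ≤ k i := by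
  classical
  refine card_image_le.trans ?_
  have hj : ∀ p, ∃ j, (∃ j, L.pred i p = some (Sum.inr j)) → L.pred i p = some (Sum.inr j) :=
    fun p => by
      by_cases h : ∃ j, L.pred i p = some (Sum.inr j)
      · exact ⟨h.choose, fun _ => h.choose_spec⟩
      · exact ⟨0, fun h' => absurd h' h⟩
  choose f hf using hj
  rw [← card_range (k i)]
  refine card_le_card_of_injOn f (fun p hp => ?_) fun p hp q hq hpq => ?_
  · simp only [coe_filter, mem_univ, true_and, Set.mem_ofPred_eq] at hp
    simpa using L.start_lt i p _ (hf p hp)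
  · simp only [coe_filter, mem_univ, true_and, Set.mem_ofPred_eq] at hp hq
    exact L.pred_inj i p q _ (hf p hp) (by rw [hpq]; exact hf q hq)

theorem isCut_firstEdges [Fintype α] (i : Fin 3) :
    L.graph.IsCut (Vtx.source i) (Vtx.sink i) (L.firstEdges i) := by
  classical
  intro p hp
  rcases p with _ | ⟨e, p⟩
  · exact absurd hp (by simp [DiMultigraph.IsPath])
  · obtain ⟨q, j, rfl, hq⟩ := L.src_eq_source hp.1
    refine ⟨_, List.mem_cons_self, ?_⟩
    rw [firstEdges]
    exact mem_image_of_mem _ (by simp [hq])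

/-- The arcs between the edges of the network that belong to the chains of one family. -/
inductive Step (L : Layout k α) (i : Fin 3) :
    Edg k α ⊕ (Fin 3 × Edg k α) → Edg k α ⊕ (Fin 3 × Edg k α) → Prop
  | thru (p : α) (h : L.pred i p ≠ none) : L.Step i (Sum.inl (.into i p)) (Sum.inl (.thru p))
  | into (p x : α) (h : L.pred i p = some (Sum.inl x)) :
    L.Step i (Sum.inl (.thru x)) (Sum.inl (.into i p))
  | first (p : α) (j : ℕ) (h : L.pred i p = some (Sum.inr j)) :
    L.Step i (Sum.inr (i, .into i p)) (Sum.inl (.into i p))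
  | exit (j : Fin (k i)) : L.Step i (Sum.inl (.thru (L.last i j))) (Sum.inl (.exit i j))

/-- The chains of a family give disjoint paths. -/
theorem exists_paths [Fintype α] (i : Fin 3) :
    ∃ P, L.graph.IsEdgeDisjointPaths (Vtx.source i) (Vtx.sink i) P ∧ P.card = k i := by
  classical
  have : Finite (Node L.graph) := inferInstanceAs (Finite (Edg k α ⊕ (Fin 3 × Edg k α)))
  obtain ⟨τ, -, hτ⟩ := exists_numbering (Adm.acyclic (S := L.network.S) L.acyclic)
  set I : Finset (Node L.graph) := (L.firstEdges i).image (fun e => Sum.inr (i, e)) with hI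
  set Z : Finset (Node L.graph) :=
    (univ : Finset (Fin (k i))).image (fun j => Sum.inl (Edg.exit i j)) with hZ
  have hfirst : ∀ {p j}, L.pred i p = some (Sum.inr j) →
      (Sum.inr (i, Edg.into i p) : Node L.graph) ∈ I := by
    intro p j hp
    rw [hI, firstEdges]
    exact mem_image_of_mem _ (mem_image_of_mem _ (by simp [hp]))
  have hinl : ∀ e, (Sum.inl e : Node L.graph) ∉ I := fun e he => by
    obtain ⟨_, -, h⟩ := mem_image.1 he
    exact Sum.inr_ne_inl h
  obtain ⟨σ, hσ, hσS⟩ : ∃ σ, IsRouting I Z σ ∧ ∀ a b, Arc σ a b → L.Step i a b := by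
    refine exists_routing_of_rel (L.Step i) ?_ ?_ ?_ ?_ ?_ ?_
    · intro a b x hax hbx
      cases hax with
      | thru p h => cases hbx; rfl
      | into p x h =>
        cases hbx with
        | into _ y h' => rw [h] at h'; simp at h'; rw [h']
        | first _ j h' => rw [h] at h'; simp at h'
      | first p j h =>
        cases hbx with
        | into _ y h' => rw [h] at h'; simp at h'
        | first _ j h' => rfl
      | exit j => cases hbx; rfl
    · intro a x y hax hay
      cases hax with
      | thru p h => cases hay; rfl
      | into p x h =>
        generalize hw : (Sum.inl (Edg.thru x) : Edg k α ⊕ (Fin 3 × Edg k α)) = w at hay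
        cases hay with
        | thru => simp at hw
        | into q y h' =>
          simp only [Sum.inl.injEq, Edg.thru.injEq] at hw
          subst hw
          rw [L.pred_inj i p q _ h h']
        | first => simp at hw
        | exit j =>
          simp only [Sum.inl.injEq, Edg.thru.injEq] at hw
          exact absurd (hw ▸ h) (L.last_final i j p j.2)
      | first p j h => cases hay; rfl
      | exit j =>
        generalize hw : (Sum.inl (Edg.thru (L.last i j)) : Edg k α ⊕ (Fin 3 × Edg k α)) = w at hay
        cases hay with
        | thru => simp at hw
        | into q y h' =>
          simp only [Sum.inl.injEq, Edg.thru.injEq] at hw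
          exact absurd (hw ▸ h') (L.last_final i j q j.2)
        | first => simp at hw
        | exit j' =>
          simp only [Sum.inl.injEq, Edg.thru.injEq] at hw
          rw [Fin.ext (L.last_inj i j j' j.2 j'.2 hw)]
    · intro a x hx hax
      cases hax <;> exact hinl _ hx
    · intro a x hx hxa
      obtain ⟨j, -, rfl⟩ := mem_image.1 hx
      cases hxa
    · intro a x hax haI
      have hthru : ∀ p, L.pred i p ≠ none → ∃ b, L.Step i b (Sum.inl (.thru p)) :=
        fun p hp => ⟨_, .thru p hp⟩
      cases hax with
      | thru p h =>
        rcases hp : L.pred i p with _ | y | j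
        · exact absurd hp h
        · exact ⟨_, .into p y hp⟩
        · exact ⟨_, .first p j hp⟩
      | into p x h => exact hthru x (L.pred_used i p x h)
      | first p j h => exact absurd (hfirst h) haI
      | exit j => exact hthru _ (L.last_used i j j.2)
    · intro z hz _
      obtain ⟨j, -, rfl⟩ := mem_image.1 hz
      exact ⟨_, .exit j⟩
  have hA : ∀ a b, Arc σ a b → Adm L.network.S a b := by
    intro a b hab
    cases hσS a b hab with
    | thru p h => exact Adm.edge _ _ rfl
    | into p x h =>
      exact Adm.edge _ _ (show Vtx.pout x = origin i (L.pred i p) by rw [h, origin])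
    | first p j h =>
      exact Adm.start _ _ (show origin i (L.pred i p) = Vtx.source i by rw [h, origin])
    | exit j => exact Adm.edge _ _ rfl
  obtain ⟨P, hP, hPc, -⟩ := exists_paths_of_routing (i := i) (v := Vtx.sink i) hσ hA hτ
    (fun x hx => by
      obtain ⟨e, -, rfl⟩ := mem_image.1 hx
      exact ⟨e, rfl⟩)
    (fun x hx => by
      obtain ⟨j, -, rfl⟩ := mem_image.1 hx
      exact ⟨_, rfl, rfl⟩)
  refine ⟨P, hP, hPc.trans ?_⟩
  rw [hZ, card_image_of_injective _ (fun a b h => by cases h; rfl), card_univ, Fintype.card_fin]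

theorem minCut_eq [Fintype α] (i : Fin 3) :
    L.graph.minCut (Vtx.source i) (Vtx.sink i) = (k i : ℕ∞) := by
  obtain ⟨P, hP, hPc⟩ := L.exists_paths i
  refine le_antisymm ?_ (le_iInf₂ fun C hC => ?_)
  · refine (iInf₂_le _ (L.isCut_firstEdges i)).trans ?_
    exact_mod_cast L.card_firstEdges_le i
  · rw [← hPc]
    exact_mod_cast card_le_card_of_isCut hP hC

/-! ### Potentials -/

/-- A bound on the potential of the family `i`. -/
noncomputable def top [Fintype α] (i : Fin 3) : ℕ := univ.sup (fun p => 2 * L.ρ i p + 4)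

theorem two_mul_rank_add_four_le_top [Fintype α] (i : Fin 3) (p : α) : 2 * L.ρ i p + 4 ≤ L.top i :=
  Finset.le_sup (f := fun p => 2 * L.ρ i p + 4) (mem_univ p)

open Classical in
/-- The potential of the exit of a point: just below the next point on the chain, if there is
one. -/
noncomputable def exitPotential [Fintype α] (i : Fin 3) (x : α) : ℕ :=
  if h : ∃ u, L.pred i u = some (Sum.inl x) then 2 * L.ρ i h.choose + 1
  else if L.pred i x = none then 2 * L.ρ i x + 1 else L.top i - 1

/-- A potential on the vertices that increases along the edges of the family `i` and along no
other edges. -/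
noncomputable def potential [Fintype α] (i : Fin 3) : Vtx α → ℕ
  | .pin p => 2 * L.ρ i p + 2
  | .pout p => L.exitPotential i p
  | .source c => if c = i then 0 else L.top i
  | .sink c => if c = i then L.top i else 0
  | .idle => L.top i

theorem exitPotential_of_pred [Fintype α] {i : Fin 3} {x u : α}
    (h : L.pred i u = some (Sum.inl x)) : L.exitPotential i x = 2 * L.ρ i u + 1 := by
  have h' : ∃ u, L.pred i u = some (Sum.inl x) := ⟨u, h⟩
  rw [exitPotential, dif_pos h', L.pred_inj i _ u _ h'.choose_spec h]

theorem exitPotential_of_none [Fintype α] {i : Fin 3} {x : α} (h : L.pred i x = none) :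
    L.exitPotential i x = 2 * L.ρ i x + 1 := by
  rw [exitPotential, dif_neg, if_pos h]
  rintro ⟨u, hu⟩
  exact L.pred_used i u x hu h

theorem exitPotential_of_final [Fintype α] {i : Fin 3} {x : α} (h : L.pred i x ≠ none)
    (h' : ∀ u, L.pred i u ≠ some (Sum.inl x)) : L.exitPotential i x = L.top i - 1 := by
  rw [exitPotential, dif_neg (fun ⟨u, hu⟩ => h' u hu), if_neg h]

/-- The increase of the potential along an edge. -/
noncomputable def gain [Fintype α] (i : Fin 3) (e : Edg k α) : ℤ :=
  L.potential i (L.graph.tgt e) - L.potential i (L.graph.src e)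

/-- The edges that belong to the family `i`. -/
inductive Own (L : Layout k α) (i : Fin 3) : Edg k α → Prop
  | thru (p : α) (h : L.pred i p ≠ none) : L.Own i (.thru p)
  | into (p : α) (h : L.pred i p ≠ none) : L.Own i (.into i p)
  | exit (j : Fin (k i)) : L.Own i (.exit i j)

theorem gain_pos [Fintype α] {i : Fin 3} {e : Edg k α} (h : L.Own i e) : 0 < L.gain i e := by
  rw [gain, sub_pos, Nat.cast_lt]
  cases h with
  | thru p h =>
    have h1 := L.two_mul_rank_add_four_le_top i p
    by_cases h2 : ∃ u, L.pred i u = some (Sum.inl p)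
    · obtain ⟨u, hu⟩ := h2
      have h3 := L.back i u p hu
      simp only [graph, potential, L.exitPotential_of_pred hu]
      omega
    · push Not at h2
      simp only [graph, potential, L.exitPotential_of_final h h2]
      omega
  | into p h =>
    rcases hp : L.pred i p with _ | x | j
    · exact absurd hp h
    · simp only [graph, hp, origin, potential, L.exitPotential_of_pred hp]
      omega
    · simp [graph, hp, origin, potential]
  | exit j =>
    have h1 := L.two_mul_rank_add_four_le_top i (L.last i j)
    simp only [graph, potential, L.exitPotential_of_final (L.last_used i j j.2)
      (fun u => L.last_final i j u j.2), if_true]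
    omega

theorem gain_nonpos [Fintype α] {i : Fin 3} {e : Edg k α} (h : ¬ L.Own i e) :
    L.gain i e ≤ 0 := by
  rw [gain, sub_nonpos, Nat.cast_le]
  rcases e with p | ⟨d, p⟩ | ⟨d, j⟩
  · have hp : L.pred i p = none := by
      by_contra hp
      exact h (.thru p hp)
    simp only [graph, potential, L.exitPotential_of_none hp]
    omega
  · have h1 := L.two_mul_rank_add_four_le_top i p
    rcases hp : L.pred d p with _ | x | j
    · simp only [graph, hp, origin, potential]
      omega
    · have hd : i ≠ d := by
        rintro rfl
        exact h (.into p (by simp [hp]))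
      simp only [graph, hp, origin, potential]
      by_cases h2 : ∃ u, L.pred i u = some (Sum.inl x)
      · obtain ⟨u, hu⟩ := h2
        have h3 := L.side i d u p x hd hu hp
        rw [L.exitPotential_of_pred hu]
        omega
      · push Not at h2
        by_cases hx : L.pred i x = none
        · have h3 := L.off i d p x hx hp
          rw [L.exitPotential_of_none hx]
          omega
        · rw [L.exitPotential_of_final hx h2]
          omega
    · have hd : d ≠ i := by
        rintro rfl
        exact h (.into p (by simp [hp]))
      simp only [graph, hp, origin, potential, if_neg hd]
      omega
  · have hd : d ≠ i := by
      rintro rfl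
      exact h (.exit j)
    simp [graph, potential, hd]

end Layout

end Merging

namespace Merging

open Relation Finset

namespace Layout

variable {k : Fin 3 → ℕ} {α : Type} (L : Layout k α)

theorem sum_gain_path [Fintype α] (i : Fin 3) {u v : Vtx α} {p : List (Edg k α)}
    (h : L.graph.IsPath u v p) :
    (p.map (L.gain i)).sum = (L.potential i v : ℤ) - L.potential i u := by
  induction p generalizing u with
  | nil =>
    obtain rfl : u = v := h
    simp
  | cons e p ih =>
    obtain ⟨rfl, h⟩ := h
    rw [List.map_cons, List.sum_cons, ih h, gain]
    ring

theorem sum_gain_paths [Fintype α] [DecidableEq (Edg k α)] {i : Fin 3}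
    {P : Finset (List (Edg k α))}
    (hP : L.graph.IsEdgeDisjointPaths (Vtx.source i) (Vtx.sink i) P) :
    ∑ e ∈ P.biUnion List.toFinset, L.gain i e = P.card * L.top i := by
  rw [sum_biUnion, ← nsmul_eq_mul, ← sum_const]
  · refine sum_congr rfl fun p hp => ?_
    have hnd : p.Nodup := isPath_nodup L.acyclic (hP.1 p hp)
    rw [List.sum_toFinset _ hnd, L.sum_gain_path i (hP.1 p hp)]
    simp [potential]
  · intro p hp q hq hpq
    rw [Function.onFun, disjoint_left]
    intro e he he'
    have he₁ : e ∈ p := List.mem_toFinset.1 he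
    have he₂ : e ∈ q := List.mem_toFinset.1 he'
    exact hP.2 p hp q hq hpq e he₁ he₂

open Classical in
/-- The points on the chains of a family. -/
noncomputable def used [Fintype α] (i : Fin 3) : Finset α :=
  univ.filter (fun p => L.pred i p ≠ none)

open Classical in
/-- The set of the edges that belong to the family `i`. -/
noncomputable def ownEdges [Fintype α] (i : Fin 3) : Finset (Edg k α) :=
  ((L.used i).image .thru ∪ (L.used i).image (.into i)) ∪ univ.image (.exit i)

theorem mem_ownEdges [Fintype α] {i : Fin 3} {e : Edg k α} : e ∈ L.ownEdges i ↔ L.Own i e := by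
  classical
  simp only [ownEdges, mem_union, mem_image, used, mem_filter, mem_univ, true_and]
  constructor
  · rintro ((⟨p, h, rfl⟩ | ⟨p, h, rfl⟩) | ⟨j, rfl⟩)
    exacts [.thru p h, .into p h, .exit j]
  · rintro (⟨p, h⟩ | ⟨p, h⟩ | j)
    exacts [Or.inl (Or.inl ⟨p, h, rfl⟩), Or.inl (Or.inr ⟨p, h, rfl⟩), Or.inr ⟨j, rfl⟩]

/-- The predecessors of the points of a family and the ends of its chains are its points and the
starts of its chains. -/
theorem sum_pred [Fintype α] (i : Fin 3) (g : α → ℤ) :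
    ∑ p ∈ L.used i, (L.pred i p).elim 0 (Sum.elim g 0) + ∑ j ∈ range (k i), g (L.last i j) =
      ∑ p ∈ L.used i, g p := by
  classical
  -- `m` permutes the points of the family together with the indices of its chains
  set W := (L.used i).disjSum (range (k i)) with hW
  set m : α ⊕ ℕ → α ⊕ ℕ :=
    Sum.elim (fun p => (L.pred i p).getD (Sum.inl p)) (fun j => Sum.inl (L.last i j)) with hm
  have hU : ∀ p, p ∈ L.used i ↔ L.pred i p ≠ none := by simp [used]
  have hmaps : ∀ a ∈ W, m a ∈ W := by
    rintro (p | j) ha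
    · rw [hW, inl_mem_disjSum, hU] at ha
      rcases hp : L.pred i p with _ | x | j
      · exact absurd hp ha
      · simpa [hm, hp, hW, hU] using L.pred_used i p x hp
      · simpa [hm, hp, hW] using L.start_lt i p j hp
    · rw [hW, inr_mem_disjSum, mem_range] at ha
      simpa [hm, hW, hU] using L.last_used i j ha
  have hinj : Set.InjOn m W := by
    have hpj : ∀ p j, Sum.inl p ∈ W → Sum.inr j ∈ W → m (Sum.inl p) ≠ m (Sum.inr j) := by
      intro p j hp hj
      rw [hW, inl_mem_disjSum, hU] at hp
      rw [hW, inr_mem_disjSum, mem_range] at hj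
      rcases hp' : L.pred i p with _ | a
      · exact absurd hp' hp
      · simp only [hm, Sum.elim_inl, hp', Option.getD_some, Sum.elim_inr]
        rintro rfl
        exact L.last_final i j p hj hp'
    rintro (p | j) ha (q | j') hb hab
    · rw [mem_coe, hW, inl_mem_disjSum, hU] at ha hb
      rcases hp : L.pred i p with _ | a
      · exact absurd hp ha
      rcases hq : L.pred i q with _ | b
      · exact absurd hq hb
      simp only [hm, Sum.elim_inl, hp, hq, Option.getD_some] at hab
      rw [L.pred_inj i p q a hp (by rw [hq, hab])]
    · exact absurd hab (hpj p j' ha hb)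
    · exact absurd hab.symm (hpj q j hb ha)
    · rw [mem_coe, hW, inr_mem_disjSum, mem_range] at ha hb
      simp only [hm, Sum.elim_inr, Sum.inl.injEq] at hab
      rw [L.last_inj i j j' ha hb hab]
  have hsum : ∑ a ∈ W, Sum.elim g 0 (m a) = ∑ a ∈ W, Sum.elim g 0 a :=
    sum_nbij m hmaps hinj (surjOn_of_injOn_of_card_le m hmaps hinj le_rfl) (fun _ _ => rfl)
  rw [hW, sum_disjSum, sum_disjSum] at hsum
  simp only [Sum.elim_inl, Sum.elim_inr, Pi.zero_apply, sum_const_zero, add_zero, hm] at hsum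
  rw [← hsum]
  congr 1
  refine sum_congr rfl fun p hp => ?_
  rcases hp' : L.pred i p with _ | a
  · exact absurd hp' ((hU p).1 hp)
  · rfl

/-- The total increase of the potential along the chains is that of `k i` paths from the source
to the sink. -/
theorem sum_gain_own [Fintype α] (i : Fin 3) :
    ∑ e ∈ L.ownEdges i, L.gain i e = k i * L.top i := by
  classical
  have hsum := L.sum_pred i (fun p => (L.exitPotential i p : ℤ))
  have hd : Disjoint ((L.used i).image .thru ∪ (L.used i).image (.into i))
      (univ.image (Edg.exit (k := k) (α := α) i)) := by
    rw [disjoint_left]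
    simp only [mem_union, mem_image]
    rintro e (⟨p, -, rfl⟩ | ⟨p, -, rfl⟩) ⟨j, -, h⟩ <;> cases h
  have hd' : Disjoint ((L.used i).image (Edg.thru (k := k))) ((L.used i).image (.into i)) := by
    rw [disjoint_left]
    simp only [mem_image]
    rintro e ⟨p, -, rfl⟩ ⟨q, -, h⟩
    cases h
  rw [ownEdges, sum_union hd, sum_union hd', sum_image (fun a _ b _ h => by cases h; rfl),
    sum_image (fun a _ b _ h => by cases h; rfl), sum_image (fun a _ b _ h => by cases h; rfl),
    ← sum_add_distrib]
  have h1 : ∀ p ∈ L.used i, L.gain i (.thru p) + L.gain i (.into i p) = L.exitPotential i p -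
      (L.pred i p).elim 0 (Sum.elim (fun p => (L.exitPotential i p : ℤ)) 0) := by
    intro p hp
    have hp' : L.pred i p ≠ none := by simpa [used] using hp
    rcases h : L.pred i p with _ | x | j
    · exact absurd h hp'
    · simp only [gain, graph, h, origin, potential, Option.elim_some, Sum.elim_inl]
      ring
    · simp only [gain, graph, h, origin, potential, Option.elim_some, Sum.elim_inr]
      simp
  have h2 : ∀ j : Fin (k i), L.gain i (.exit i j) = L.top i - L.exitPotential i (L.last i j) := by
    intro j
    simp [gain, graph, potential]
  rw [sum_congr rfl h1, sum_congr rfl (fun j _ => h2 j), sum_sub_distrib, sum_sub_distrib,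
    ← hsum, Fin.sum_univ_eq_sum_range (fun j => (L.exitPotential i (L.last i j) : ℤ)) (k i)]
  simp

/-- Every set of Menger's paths uses all edges of the chains: the potential increases on no other
edges, and its total increase along the paths is as large as along the chains. -/
theorem exists_mem_of_own [Fintype α] {i : Fin 3} {P : Finset (List (Edg k α))}
    (hP : L.graph.IsMengerSet (Vtx.source i) (Vtx.sink i) P) {e : Edg k α} (he : L.Own i e) :
    ∃ p ∈ P, e ∈ p := by
  classical
  by_contra hcon
  push Not at hcon
  obtain ⟨Q, hQ, hQc⟩ := L.exists_paths i
  have hcard : k i ≤ P.card := hQc ▸ hP.2 Q hQ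
  set F := P.biUnion List.toFinset with hF
  have heF : e ∉ F := by
    rw [hF, mem_biUnion]
    rintro ⟨p, hp, hep⟩
    exact hcon p hp (List.mem_toFinset.1 hep)
  have h1 : ∑ e ∈ F, L.gain i e = P.card * L.top i := L.sum_gain_paths hP.1
  have h2 : ∑ e ∈ F, L.gain i e ≤ ∑ e ∈ F ∩ L.ownEdges i, L.gain i e := by
    rw [← sum_inter_add_sum_sdiff F (L.ownEdges i)]
    have : ∑ e ∈ F \ L.ownEdges i, L.gain i e ≤ 0 := sum_nonpos fun x hx =>
      L.gain_nonpos (fun h => (mem_sdiff.1 hx).2 (L.mem_ownEdges.2 h))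
    linarith
  have h3 : ∑ e ∈ F ∩ L.ownEdges i, L.gain i e < ∑ e ∈ L.ownEdges i, L.gain i e :=
    sum_lt_sum_of_subset inter_subset_right (L.mem_ownEdges.2 he)
      (fun h => heF (mem_inter.1 h).1) (L.gain_pos he)
      (fun x hx _ => (L.gain_pos (L.mem_ownEdges.1 hx)).le)
  rw [L.sum_gain_own] at h3
  have h4 : (k i : ℤ) * L.top i ≤ P.card * L.top i := by
    exact_mod_cast Nat.mul_le_mul_right _ hcard
  linarith

theorem consec_of_own [Fintype α] {i : Fin 3} {P : Finset (List (Edg k α))}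
    (hP : L.graph.IsMengerSet (Vtx.source i) (Vtx.sink i) P) {p : α} (hp : L.pred i p ≠ none) :
    ∃ l ∈ P, Consec l (Edg.into i p) (Edg.thru p) := by
  obtain ⟨l, hl, hel⟩ := L.exists_mem_of_own hP (.into p hp)
  refine ⟨l, hl, ?_⟩
  have hpath := hP.1.1 l hl
  obtain ⟨s, t, rfl⟩ := List.append_of_mem hel
  obtain ⟨w, -, -, h2⟩ := isPath_append.1 hpath
  rcases t with _ | ⟨e, t⟩
  · exact absurd h2 (by simp [DiMultigraph.IsPath, graph])
  · have h3 : L.graph.src e = Vtx.pin p := h2.1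
    have h4 : e = Edg.thru p := by
      rcases e with q | ⟨c, q⟩ | ⟨c, j⟩
      · simp only [graph] at h3
        cases h3
        rfl
      · have h5 : ∀ o : Option (α ⊕ ℕ), origin c o ≠ Vtx.pin p := by
          rintro (_ | x | j) h <;> cases h
        exact absurd h3 (h5 _)
      · simp [graph] at h3
    rw [consec_iff, h4]
    exact ⟨s, t, by simp⟩

/-- In the network of a layout all sets of Menger's paths merge at all points. -/
theorem card_le_maxMinMergings [Fintype α] (L : Layout k α) :
    (Fintype.card α : ℕ∞) ≤ maxMinMergings k := by
  refine le_trans ?_ (le_iSup₂ (f := fun (G : UnicastNetwork 3) _ => G.minMergings) L.network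
    (fun i => L.minCut_eq i))
  refine le_iInf₂ fun P hP => ?_
  have hinj : Function.Injective (Edg.thru (k := k) (α := α)) := fun a b h => by cases h; rfl
  have hsub : Edg.thru '' (Set.univ : Set α) ⊆ L.graph.mergingEdges P := by
    rintro _ ⟨p, -, rfl⟩
    obtain ⟨c, d, hcd, hc, hd⟩ := L.two p
    obtain ⟨l, hl, hl'⟩ := L.consec_of_own (hP c) hc
    obtain ⟨l', hm, hm'⟩ := L.consec_of_own (hP d) hd
    refine ⟨2, ![c, d], ![l, l'], ?_, ?_, ?_, 0, 1, by decide, .into c p, .into d p, ?_,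
      consec_iff.1 hl', consec_iff.1 hm'⟩
    · intro a b
      fin_cases a <;> fin_cases b <;> simp [hcd, hcd.symm]
    · intro t
      fin_cases t
      exacts [hl, hm]
    · intro t
      obtain ⟨a, -, ha⟩ := hl'
      obtain ⟨b, -, hb⟩ := hm'
      fin_cases t
      exacts [List.mem_of_getElem? ha, List.mem_of_getElem? hb]
    · intro h
      cases h
      exact hcd rfl
  calc (Fintype.card α : ℕ∞) = (Set.univ : Set α).encard := by
        rw [Set.encard_univ, ENat.card_eq_coe_fintype_card]
    _ = (Edg.thru (k := k) '' (Set.univ : Set α)).encard := (hinj.encard_image _).symm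
    _ ≤ _ := Set.encard_le_encard hsub

end Layout

end Merging

namespace Merging

open Finset

/-! ### Layouts for few paths -/

namespace Layout

/-- A layout given by finite tables: the points are numbered in a topological order. -/
def ofTable {k : Fin 3 → ℕ} {N : ℕ} (pred : Fin 3 → Fin N → Option (Fin N ⊕ Fin 3))
    (last : Fin 3 → Fin 3 → Fin N) (ρ : Fin 3 → Fin N → ℕ)
    (hk : ∀ c, k c ≤ 3) (start_lt : ∀ c p, ∀ j : Fin 3, pred c p = some (Sum.inr j) → j.val < k c)
    (pred_inj : ∀ c p q, pred c p ≠ none → pred c p = pred c q → p = q)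
    (pred_used : ∀ c p x, pred c p = some (Sum.inl x) → pred c x ≠ none)
    (last_inj : ∀ c, ∀ i j : Fin 3, i.val < k c → j.val < k c → last c i = last c j → i = j)
    (last_used : ∀ c, ∀ j : Fin 3, j.val < k c → pred c (last c j) ≠ none)
    (last_final : ∀ c, ∀ j : Fin 3, ∀ p, j.val < k c → pred c p ≠ some (Sum.inl (last c j)))
    (lt : ∀ c p x, pred c p = some (Sum.inl x) → x < p)
    (back : ∀ c p x, pred c p = some (Sum.inl x) → ρ c x < ρ c p)
    (side : ∀ c d u v, c ≠ d → ∀ x, pred c u = some (Sum.inl x) → pred d v = some (Sum.inl x) →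
      ρ c v < ρ c u)
    (off : ∀ c d v x, pred c x = none → pred d v = some (Sum.inl x) → ρ c v < ρ c x)
    (two : ∀ p, ∃ c d, c ≠ d ∧ pred c p ≠ none ∧ pred d p ≠ none) : Layout k (Fin N) :=
  have key : ∀ c p x, (pred c p).map (Sum.map id Fin.val) = some (Sum.inl x) ↔
      pred c p = some (Sum.inl x) := by
    intro c p x
    rcases pred c p with _ | y | j <;> simp
  have hj : ∀ {c j}, j < k c → ∃ i : Fin 3, i.val = j :=
    fun {c j} h => ⟨⟨j, h.trans_le (hk c)⟩, rfl⟩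
  { pred := fun c p => (pred c p).map (Sum.map id Fin.val)
    last := fun c j => last c (Fin.ofNat 3 j)
    τ := Fin.val
    ρ := ρ
    start_lt := by
      intro c p j h
      rcases hp : pred c p with _ | y | i
      · simp [hp] at h
      · simp [hp] at h
      · rw [hp] at h
        obtain rfl : i.val = j := by simpa using h
        exact start_lt c p i hp
    pred_inj := by
      intro c p q a hp hq
      rw [← hq] at hp
      have hm : Function.Injective (Sum.map (id : Fin N → Fin N) (Fin.val : Fin 3 → ℕ)) :=
        Sum.map_injective.2 ⟨Function.injective_id, Fin.val_injective⟩
      refine pred_inj c p q (fun h => ?_) (Option.map_injective hm hp)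
      rw [← hp, h] at hq
      simp at hq
    pred_used := fun c p x h => by simpa using pred_used c p x ((key c p x).1 h)
    last_inj := by
      intro c i j hi hj' h
      obtain ⟨i, rfl⟩ := hj hi
      obtain ⟨j, rfl⟩ := hj hj'
      rw [Fin.ofNat_val_eq_self, Fin.ofNat_val_eq_self] at h
      rw [last_inj c i j hi hj' h]
    last_used := by
      intro c j h
      obtain ⟨j, rfl⟩ := hj h
      rw [Fin.ofNat_val_eq_self]
      simpa using last_used c j h
    last_final := by
      intro c j p h
      obtain ⟨j, rfl⟩ := hj h
      rw [Fin.ofNat_val_eq_self, Ne, key]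
      exact last_final c j p h
    lt := fun c p x h => lt c p x ((key c p x).1 h)
    back := fun c p x h => back c p x ((key c p x).1 h)
    side := fun c d u v x hcd hu hv =>
      side c d u v hcd x ((key c u x).1 hu) ((key d v x).1 hv)
    off := fun c d v x hx hv => off c d v x (by simpa using hx) ((key d v x).1 hv)
    two := fun p => by simpa using two p }

/-- The entry of a table with the given code: `0` stands for a point which is not used, `j + 1`
for the first point of the `j`-th chain, and `x + 4` for the successor of the point `x`. -/
def decode {N : ℕ} [NeZero N] (m : ℕ) : Option (Fin N ⊕ Fin 3) :=
  if m = 0 then none else if m ≤ 3 then some (Sum.inr (Fin.ofNat 3 (m - 1)))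
  else some (Sum.inl (Fin.ofNat N (m - 4)))

/-- The points `0` and `1` are mergings of the last two families; the first family visits the last
points of the chains of these families. -/
def five : Layout ![1, 2, 1] (Fin 5) :=
  ofTable (fun c p => decode (![![0, 0, 1, 6, 7], ![1, 2, 0, 4, 5], ![1, 4, 5, 0, 0]] c p))
    ![![4, 0, 0], ![3, 4, 0], ![2, 0, 0]]
    ![![4, 3, 0, 1, 2], ![0, 0, 2, 1, 3], ![0, 2, 3, 1, 0]]
    (by decide) (by decide) (by decide) (by decide) (by decide) (by decide) (by decide)
    (by decide) (by decide) (by decide +kernel) (by decide +kernel) (by decide)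

/-- The points `0, …, 4` are mergings of the last two families; the first family visits the last
points of all chains of these families but one. -/
def eight : Layout ![1, 2, 2] (Fin 8) :=
  ofTable (fun c p => decode (![![0, 0, 0, 0, 0, 1, 9, 10], ![1, 4, 2, 6, 5, 8, 0, 0],
      ![1, 2, 5, 4, 7, 0, 6, 8]] c p))
    ![![7, 0, 0], ![5, 3, 0], ![7, 6, 0]]
    ![![7, 6, 5, 4, 3, 0, 1, 2], ![0, 3, 0, 2, 4, 5, 1, 0], ![0, 0, 3, 1, 2, 5, 4, 6]]
    (by decide) (by decide) (by decide +kernel) (by decide +kernel) (by decide) (by decide)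
    (by decide) (by decide +kernel) (by decide +kernel) (by decide +kernel) (by decide +kernel)
    (by decide)

/-- The points `0, …, 7` are mergings of the last two families; the first family visits the last
points of all chains of these families but one. -/
def twelve : Layout ![1, 2, 3] (Fin 12) :=
  ofTable (fun c p => decode (![![0, 0, 0, 0, 0, 0, 0, 0, 1, 12, 13, 14],
      ![1, 2, 5, 6, 4, 8, 9, 7, 11, 0, 0, 0], ![1, 4, 2, 3, 6, 7, 5, 10, 0, 8, 9, 11]] c p))
    ![![11, 0, 0], ![8, 6, 0], ![11, 9, 10]]
    ![![10, 9, 8, 7, 7, 6, 5, 4, 0, 1, 2, 3], ![0, 0, 5, 6, 1, 3, 4, 7, 8, 2, 1, 0],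
      ![0, 2, 0, 0, 1, 5, 3, 4, 7, 6, 6, 8]]
    (by decide) (by decide) (by decide +kernel) (by decide +kernel) (by decide) (by decide)
    (by decide +kernel) (by decide +kernel) (by decide +kernel) (by decide +kernel)
    (by decide +kernel) (by decide +kernel)

end Layout

end Merging

namespace Merging

open Finset

/-! ### Layouts for many paths -/

namespace Layout

/-- The layout which is induced on a set of points that contains all points of the chains. -/
noncomputable def restrict {k : Fin 3 → ℕ} {β : Type} (V : β → Prop)
    (pred : Fin 3 → β → Option (β ⊕ ℕ)) (last : Fin 3 → ℕ → β) (τ : β → ℕ) (ρ : Fin 3 → β → ℕ)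
    (pred_mem : ∀ c p x, V p → pred c p = some (Sum.inl x) → V x)
    (last_mem : ∀ c j, j < k c → V (last c j))
    (start_lt : ∀ c p j, V p → pred c p = some (Sum.inr j) → j < k c)
    (pred_inj : ∀ c p q a, V p → V q → pred c p = some a → pred c q = some a → p = q)
    (pred_used : ∀ c p x, V p → pred c p = some (Sum.inl x) → pred c x ≠ none)
    (last_inj : ∀ c i j, i < k c → j < k c → last c i = last c j → i = j)
    (last_used : ∀ c j, j < k c → pred c (last c j) ≠ none)
    (last_final : ∀ c j p, V p → j < k c → pred c p ≠ some (Sum.inl (last c j)))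
    (lt : ∀ c p x, V p → pred c p = some (Sum.inl x) → τ x < τ p)
    (back : ∀ c p x, V p → pred c p = some (Sum.inl x) → ρ c x < ρ c p)
    (side : ∀ c d u v x, V u → V v → c ≠ d → pred c u = some (Sum.inl x) →
      pred d v = some (Sum.inl x) → ρ c v < ρ c u)
    (off : ∀ c d v x, V v → pred c x = none → pred d v = some (Sum.inl x) → ρ c v < ρ c x)
    (two : ∀ p, V p → ∃ c d, c ≠ d ∧ pred c p ≠ none ∧ pred d p ≠ none) (default : {p // V p}) :
    Layout k {p // V p} := by
  classical
  set lift : β ⊕ ℕ → {p // V p} ⊕ ℕ :=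
    Sum.elim (fun x => if h : V x then Sum.inl ⟨x, h⟩ else Sum.inl default) Sum.inr with hlift
  set fall : {p // V p} ⊕ ℕ → β ⊕ ℕ := Sum.map Subtype.val id with hfall
  have hback : ∀ c (p : {p // V p}) a, pred c p = some a → fall (lift a) = a := by
    rintro c p (x | j) h
    · simp [hlift, hfall, pred_mem c p x p.2 h]
    · rfl
  have key : ∀ c (p : {p // V p}) a, (pred c p).map lift = some a ↔ pred c p = some (fall a) := by
    intro c p a
    constructor
    · intro h
      obtain ⟨b, hb, rfl⟩ := Option.map_eq_some_iff.1 h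
      rw [hb, hback c p b hb]
    · intro h
      rw [h, Option.map_some]
      rcases a with x | j
      · simp [hlift, hfall, x.2]
      · rfl
  have keyn : ∀ c (p : {p // V p}), (pred c p).map lift = none ↔ pred c p = none :=
    fun c p => Option.map_eq_none_iff
  have hlast : ∀ {c j}, j < k c → (if h : V (last c j) then ⟨last c j, h⟩ else default :
      {p // V p}).1 = last c j := fun {c j} h => by rw [dif_pos (last_mem c j h)]
  exact
  { pred := fun c p => (pred c p).map lift
    last := fun c j => if h : V (last c j) then ⟨last c j, h⟩ else default
    τ := fun p => τ p
    ρ := fun c p => ρ c p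
    start_lt := fun c p j h => start_lt c p j p.2 ((key c p _).1 h)
    pred_inj := fun c p q a hp hq =>
      Subtype.ext (pred_inj c p q _ p.2 q.2 ((key c p a).1 hp) ((key c q a).1 hq))
    pred_used := fun c p x h =>
      mt (keyn c x).1 (pred_used c p x p.2 ((key c p _).1 h))
    last_inj := fun c i j hi hj h => by
      have := congrArg Subtype.val h
      rw [hlast hi, hlast hj] at this
      exact last_inj c i j hi hj this
    last_used := fun c j h => by
      rw [Ne, keyn, hlast h]
      exact last_used c j h
    last_final := fun c j p h => by
      rw [Ne, key]
      simp only [hfall, Sum.map_inl]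
      rw [hlast h]
      exact last_final c j p p.2 h
    lt := fun c p x h => lt c p x p.2 ((key c p _).1 h)
    back := fun c p x h => back c p x p.2 ((key c p _).1 h)
    side := fun c d u v x hcd hu hv =>
      side c d u v x u.2 v.2 hcd ((key c u _).1 hu) ((key d v _).1 hv)
    off := fun c d v x hx hv =>
      off c d v x v.2 ((keyn c x).1 hx) ((key d v _).1 hv)
    two := fun p => by
      obtain ⟨c, d, hcd, h1, h2⟩ := two p p.2
      exact ⟨c, d, hcd, mt (keyn c p).1 h1, mt (keyn d p).1 h2⟩ }

/-- The names of the points of the large layouts. -/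
inductive Pt : Type
  | z (i : ℕ)
  | x (i : ℕ)
  | y (i : ℕ)
  | e (i : ℕ)
  | a
  | b

namespace Pt

/-- The points of the layout with `t + 2` paths in the third family. -/
def Valid (t : ℕ) : Pt → Prop
  | z i => i ≤ t + 2
  | x i => 1 ≤ i ∧ i ≤ t + 1
  | y i => 1 ≤ i ∧ i ≤ t + 1
  | e i => i ≤ t + 1
  | a => True
  | b => True

/-- The predecessors of the points. The third family consists of the chains
`z 0, …, z (t + 2), e 0` and `x i, y i, e i`. The two chains of the second family are composed of
the blocks `y (s - 1), z s, x s` with `s` of one parity, and end in `a` and `b`; the last three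
blocks are modified. The first family is a single chain through `a`, `b` and all `e i`. -/
def pred (t : ℕ) : Fin 3 → Pt → Option (Pt ⊕ ℕ)
  | 0, a => some (.inr 0)
  | 0, b => some (.inl a)
  | 0, e i => some (.inl (if i = 0 then e (t + 1) else if i = 1 then b else e (i - 1)))
  | 1, z i => if i ≤ 1 then some (.inr i) else some (.inl (if i = t + 1 then y (t + 1) else
      if i = t + 2 then x (t + 1) else y (i - 1)))
  | 1, x i => some (.inl (if i = t + 1 then x t else z i))
  | 1, y i => some (.inl (if i = 1 then z 0 else if i = t + 1 then y t else x (i - 1)))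
  | 1, a => some (.inl (z (t + 2)))
  | 1, b => some (.inl (z (t + 1)))
  | 2, z i => if i = 0 then some (.inr 0) else some (.inl (z (i - 1)))
  | 2, x i => some (.inr i)
  | 2, y i => some (.inl (x i))
  | 2, e i => some (.inl (if i = 0 then z (t + 2) else y i))
  | _, _ => none

/-- The last points of the chains. -/
def last : Fin 3 → ℕ → Pt
  | 0, _ => e 0
  | 1, j => if j = 0 then a else b
  | 2, j => e j

/-- A topological numbering of the points. -/
def tau (t : ℕ) : Pt → ℕ
  | z i => 6 * i + 2
  | x i => if i ≤ t then 6 * i + 3 else 6 * t + 4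
  | y i => if i ≤ t then 6 * (i + 1) else 6 * (t + 1) + 1
  | a => 6 * t + 100
  | b => 6 * t + 101
  | e i => if i = 0 then 7 * t + 103 else 6 * t + 101 + i

/-- The residual ranks. The first family visits `a`, `b` and the `e i` only; at all other points
its rank is a reversed topological numbering. -/
def rho (t : ℕ) : Fin 3 → Pt → ℕ
  | 0, a => 0
  | 0, b => 1
  | 0, e i => if i = 0 then t + 3 else i + 1
  | 0, p => 7 * t + 120 - tau t p
  | 1, x i => if i ≤ t then 6 * (i + 1) + 3 + (t + 2) else 6 * (t + 1) + 4 + (t + 2)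
  | 1, e i => if i = 0 then 0 else t + 2 - i
  | 1, p => tau t p + (t + 2)
  | 2, z i => if i = 0 then 0 else if i ≤ t + 1 then t + 1 + i else 2 * t + 5
  | 2, x _ => 0
  | 2, y i => if i ≤ t then t + 1 - i else 2 * t + 6
  | 2, e i => if i = 1 then 2 * t + 3 else 2 * t + 7
  | 2, a => 2 * t + 5
  | 2, b => 2 * t + 4

theorem pred_zero {t : ℕ} {p q : Pt} (hp : Valid t p) (h : pred t 0 p = some (.inl q)) :
    (p = b ∧ q = a) ∨ (p = e 0 ∧ q = e (t + 1)) ∨ (p = e 1 ∧ q = b) ∨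
      ∃ i, 1 ≤ i ∧ i ≤ t ∧ p = e (i + 1) ∧ q = e i := by
  rcases p with i | i | i | i | _ | _ <;> simp only [pred, reduceCtorEq, Option.some.injEq,
    Sum.inl.injEq] at h
  · simp only [Valid] at hp
    split_ifs at h with h1 h2
    · exact Or.inr (Or.inl ⟨by rw [h1], h.symm⟩)
    · exact Or.inr (Or.inr (Or.inl ⟨by rw [h2], h.symm⟩))
    · exact Or.inr (Or.inr (Or.inr ⟨i - 1, by omega, by omega,
        by rw [Nat.sub_add_cancel (by omega)], h.symm⟩))
  · exact Or.inl ⟨rfl, h.symm⟩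

theorem pred_one {t : ℕ} {p q : Pt} (hp : Valid t p)
    (h : pred t 1 p = some (.inl q)) :
    (p = a ∧ q = z (t + 2)) ∨ (p = b ∧ q = z (t + 1)) ∨ (p = z (t + 1) ∧ q = y (t + 1)) ∨
      (p = z (t + 2) ∧ q = x (t + 1)) ∨ (∃ i, 1 ≤ i ∧ i + 1 ≤ t ∧ p = z (i + 1) ∧ q = y i) ∨
      (p = x (t + 1) ∧ q = x t) ∨ (∃ i, 1 ≤ i ∧ i ≤ t ∧ p = x i ∧ q = z i) ∨
      (p = y 1 ∧ q = z 0) ∨ (p = y (t + 1) ∧ q = y t) ∨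
      ∃ i, 1 ≤ i ∧ i + 1 ≤ t ∧ p = y (i + 1) ∧ q = x i := by
  rcases p with i | i | i | i | _ | _ <;> simp only [Valid] at hp <;>
    simp only [pred, reduceCtorEq, Option.some.injEq, Sum.inl.injEq] at h
  · by_cases h0 : i ≤ 1
    · simp [h0] at h
    rw [if_neg h0, Option.some.injEq, Sum.inl.injEq] at h
    split_ifs at h with h1 h2
    · simp [h1, h]
    · simp [h2, h]
    · exact Or.inr (Or.inr (Or.inr (Or.inr (Or.inl ⟨i - 1, by omega, by omega,
        by rw [Nat.sub_add_cancel (by omega)], h.symm⟩))))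
  · split_ifs at h with h1
    · simp [h1, h]
    · exact Or.inr (Or.inr (Or.inr (Or.inr (Or.inr (Or.inr (Or.inl ⟨i, by omega, by omega, rfl,
        h.symm⟩))))))
  · split_ifs at h with h1 h2
    · simp [h1, h]
    · simp [h2, h]
    · exact Or.inr (Or.inr (Or.inr (Or.inr (Or.inr (Or.inr (Or.inr (Or.inr (Or.inr ⟨i - 1,
        by omega, by omega, by rw [Nat.sub_add_cancel (by omega)], h.symm⟩))))))))
  · exact Or.inl ⟨rfl, h.symm⟩
  · exact Or.inr (Or.inl ⟨rfl, h.symm⟩)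

theorem pred_two {t : ℕ} {p q : Pt} (hp : Valid t p) (h : pred t 2 p = some (.inl q)) :
    (∃ i, i ≤ t + 1 ∧ p = z (i + 1) ∧ q = z i) ∨ (∃ i, 1 ≤ i ∧ i ≤ t + 1 ∧ p = y i ∧ q = x i) ∨
      (p = e 0 ∧ q = z (t + 2)) ∨ ∃ i, 1 ≤ i ∧ i ≤ t + 1 ∧ p = e i ∧ q = y i := by
  rcases p with i | i | i | i | _ | _ <;> simp only [Valid] at hp <;>
    simp only [pred, reduceCtorEq, Option.some.injEq, Sum.inl.injEq] at h
  · by_cases h0 : i = 0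
    · simp [h0] at h
    rw [if_neg h0, Option.some.injEq, Sum.inl.injEq] at h
    exact Or.inl ⟨i - 1, by omega, by rw [Nat.sub_add_cancel (by omega)], h.symm⟩
  · exact Or.inr (Or.inl ⟨i, hp.1, hp.2, rfl, h.symm⟩)
  · split_ifs at h with h1
    · exact Or.inr (Or.inr (Or.inl ⟨by rw [h1], h.symm⟩))
    · exact Or.inr (Or.inr (Or.inr ⟨i, by omega, by omega, rfl, h.symm⟩))

end Pt

end Layout

end Merging

namespace Merging

open Finset

namespace Layout

theorem fin_three (c : Fin 3) : c = 0 ∨ c = 1 ∨ c = 2 := by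
  fin_cases c <;> simp

namespace Pt

theorem pred_start {t : ℕ} {c : Fin 3} {p : Pt} {j : ℕ} (hp : Valid t p)
    (h : pred t c p = some (.inr j)) : j < ![1, 2, t + 2] c := by
  rcases fin_three c with rfl | rfl | rfl <;> rcases p with i | i | i | i | _ | _ <;>
    simp only [Valid] at hp <;>
    simp [pred] at h ⊢ <;> (try split_ifs at h) <;> (try simp at h) <;> omega

theorem valid_pred {t : ℕ} (ht : 2 ≤ t) {c : Fin 3} {p q : Pt} (hp : Valid t p)
    (h : pred t c p = some (.inl q)) : Valid t q := by
  rcases fin_three c with rfl | rfl | rfl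
  · rcases pred_zero hp h with ⟨rfl, rfl⟩ | ⟨rfl, rfl⟩ | ⟨rfl, rfl⟩ | ⟨i, h1, h2, rfl, rfl⟩ <;>
      simp only [Valid] <;> omega
  · rcases pred_one hp h with ⟨rfl, rfl⟩ | ⟨rfl, rfl⟩ | ⟨rfl, rfl⟩ | ⟨rfl, rfl⟩ |
      ⟨i, h1, h2, rfl, rfl⟩ | ⟨rfl, rfl⟩ | ⟨i, h1, h2, rfl, rfl⟩ | ⟨rfl, rfl⟩ | ⟨rfl, rfl⟩ |
      ⟨i, h1, h2, rfl, rfl⟩ <;> simp only [Valid] <;> omega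
  · rcases pred_two hp h with ⟨i, h1, rfl, rfl⟩ | ⟨i, h1, h2, rfl, rfl⟩ | ⟨rfl, rfl⟩ |
      ⟨i, h1, h2, rfl, rfl⟩ <;> simp only [Valid] <;> omega

theorem tau_lt {t : ℕ} (ht : 2 ≤ t) {c : Fin 3} {p q : Pt} (hp : Valid t p)
    (h : pred t c p = some (.inl q)) : tau t q < tau t p := by
  rcases fin_three c with rfl | rfl | rfl
  · rcases pred_zero hp h with ⟨rfl, rfl⟩ | ⟨rfl, rfl⟩ | ⟨rfl, rfl⟩ | ⟨i, h1, h2, rfl, rfl⟩ <;>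
      simp only [tau, ↓reduceIte] <;> (try split_ifs) <;>
        first | omega | contradiction
  · rcases pred_one hp h with ⟨rfl, rfl⟩ | ⟨rfl, rfl⟩ | ⟨rfl, rfl⟩ | ⟨rfl, rfl⟩ |
      ⟨i, h1, h2, rfl, rfl⟩ | ⟨rfl, rfl⟩ | ⟨i, h1, h2, rfl, rfl⟩ | ⟨rfl, rfl⟩ | ⟨rfl, rfl⟩ |
      ⟨i, h1, h2, rfl, rfl⟩ <;> simp only [tau] <;> (try split_ifs) <;> omega
  · rcases pred_two hp h with ⟨i, h1, rfl, rfl⟩ | ⟨i, h1, h2, rfl, rfl⟩ | ⟨rfl, rfl⟩ |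
      ⟨i, h1, h2, rfl, rfl⟩ <;> simp only [tau, ↓reduceIte] <;> (try split_ifs) <;> omega

theorem rho_lt {t : ℕ} (ht : 2 ≤ t) {c : Fin 3} {p q : Pt} (hp : Valid t p)
    (h : pred t c p = some (.inl q)) : rho t c q < rho t c p := by
  rcases fin_three c with rfl | rfl | rfl
  · rcases pred_zero hp h with ⟨rfl, rfl⟩ | ⟨rfl, rfl⟩ | ⟨rfl, rfl⟩ | ⟨i, h1, h2, rfl, rfl⟩ <;>
      simp only [rho, ↓reduceIte] <;> (try split_ifs) <;>
        first | omega | contradiction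
  · rcases pred_one hp h with ⟨rfl, rfl⟩ | ⟨rfl, rfl⟩ | ⟨rfl, rfl⟩ | ⟨rfl, rfl⟩ |
      ⟨i, h1, h2, rfl, rfl⟩ | ⟨rfl, rfl⟩ | ⟨i, h1, h2, rfl, rfl⟩ | ⟨rfl, rfl⟩ | ⟨rfl, rfl⟩ |
      ⟨i, h1, h2, rfl, rfl⟩ <;> simp only [rho, tau] <;> (try split_ifs) <;> omega
  · rcases pred_two hp h with ⟨i, h1, rfl, rfl⟩ | ⟨i, h1, h2, rfl, rfl⟩ | ⟨rfl, rfl⟩ |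
      ⟨i, h1, h2, rfl, rfl⟩ <;> simp only [rho] <;> (try split_ifs) <;>
        first | omega | contradiction

theorem rho_side {t : ℕ} (ht : 2 ≤ t) {c d : Fin 3} {u v q : Pt} (hu : Valid t u) (hv : Valid t v)
    (hcd : c ≠ d) (h : pred t c u = some (.inl q)) (h' : pred t d v = some (.inl q)) :
    rho t c v < rho t c u := by
  have key : ∀ u v, Valid t u → Valid t v →
      (pred t 0 u = some (.inl q) → pred t 1 v = some (.inl q) →
        rho t 0 v < rho t 0 u ∧ rho t 1 u < rho t 1 v) ∧
      (pred t 0 u = some (.inl q) → pred t 2 v = some (.inl q) →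
        rho t 0 v < rho t 0 u ∧ rho t 2 u < rho t 2 v) ∧
      (pred t 1 u = some (.inl q) → pred t 2 v = some (.inl q) →
        rho t 1 v < rho t 1 u ∧ rho t 2 u < rho t 2 v) := by
    intro u v hu hv
    refine ⟨fun h h' => ?_, fun h h' => ?_, fun h h' => ?_⟩
    · rcases pred_zero hu h with ⟨rfl, rfl⟩ | ⟨rfl, rfl⟩ | ⟨rfl, rfl⟩ | ⟨i, h1, h2, rfl, rfl⟩ <;>
      rcases pred_one hv h' with ⟨rfl, hq⟩ | ⟨rfl, hq⟩ | ⟨rfl, hq⟩ | ⟨rfl, hq⟩ |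
        ⟨i, h1, h2, rfl, hq⟩ | ⟨rfl, hq⟩ | ⟨i, h1, h2, rfl, hq⟩ | ⟨rfl, hq⟩ | ⟨rfl, hq⟩ |
        ⟨i, h1, h2, rfl, hq⟩ <;> cases hq
    · rcases pred_zero hu h with ⟨rfl, rfl⟩ | ⟨rfl, rfl⟩ | ⟨rfl, rfl⟩ | ⟨i, h1, h2, rfl, rfl⟩ <;>
      rcases pred_two hv h' with ⟨i, h1, rfl, hq⟩ | ⟨i, h1, h2, rfl, hq⟩ | ⟨rfl, hq⟩ |
        ⟨i, h1, h2, rfl, hq⟩ <;> cases hq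
    · rcases pred_one hu h with ⟨rfl, rfl⟩ | ⟨rfl, rfl⟩ | ⟨rfl, rfl⟩ | ⟨rfl, rfl⟩ |
        ⟨i, h1, h2, rfl, rfl⟩ | ⟨rfl, rfl⟩ | ⟨i, h1, h2, rfl, rfl⟩ | ⟨rfl, rfl⟩ | ⟨rfl, rfl⟩ |
        ⟨i, h1, h2, rfl, rfl⟩ <;>
      rcases pred_two hv h' with ⟨j, h3, rfl, hq⟩ | ⟨j, h3, h4, rfl, hq⟩ | ⟨rfl, hq⟩ |
        ⟨j, h3, h4, rfl, hq⟩ <;> simp only [z.injEq, x.injEq, y.injEq, reduceCtorEq] at hq <;>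
      constructor <;> simp only [rho, tau, ↓reduceIte] <;> (try split_ifs) <;>
        first | omega | contradiction
  rcases fin_three c with rfl | rfl | rfl <;> rcases fin_three d with rfl | rfl | rfl
  · exact absurd rfl hcd
  · exact ((key u v hu hv).1 h h').1
  · exact ((key u v hu hv).2.1 h h').1
  · exact ((key v u hv hu).1 h' h).2
  · exact absurd rfl hcd
  · exact ((key u v hu hv).2.2 h h').1
  · exact ((key v u hv hu).2.1 h' h).2
  · exact ((key v u hv hu).2.2 h' h).2
  · exact absurd rfl hcd

theorem rho_off {t : ℕ} (ht : 2 ≤ t) {c d : Fin 3} {v q : Pt} (hv : Valid t v)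
    (h : pred t c q = none) (h' : pred t d v = some (.inl q)) : rho t c v < rho t c q := by
  rcases fin_three d with rfl | rfl | rfl
  · rcases pred_zero hv h' with ⟨rfl, rfl⟩ | ⟨rfl, rfl⟩ | ⟨rfl, rfl⟩ | ⟨i, h1, h2, rfl, rfl⟩ <;>
      rcases fin_three c with rfl | rfl | rfl <;> simp [pred] at h <;>
      simp only [rho, ↓reduceIte] <;> (try split_ifs) <;>
        first | omega | contradiction
  · rcases pred_one hv h' with ⟨rfl, rfl⟩ | ⟨rfl, rfl⟩ | ⟨rfl, rfl⟩ | ⟨rfl, rfl⟩ |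
      ⟨i, h1, h2, rfl, rfl⟩ | ⟨rfl, rfl⟩ | ⟨i, h1, h2, rfl, rfl⟩ | ⟨rfl, rfl⟩ | ⟨rfl, rfl⟩ |
      ⟨i, h1, h2, rfl, rfl⟩ <;> rcases fin_three c with rfl | rfl | rfl <;>
      simp [pred] at h <;> (try split_ifs at h) <;>
      simp only [rho, tau] <;> (try split_ifs) <;> omega
  · rcases pred_two hv h' with ⟨i, h1, rfl, rfl⟩ | ⟨i, h1, h2, rfl, rfl⟩ | ⟨rfl, rfl⟩ |
      ⟨i, h1, h2, rfl, rfl⟩ <;> rcases fin_three c with rfl | rfl | rfl <;>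
      simp [pred] at h <;> (try split_ifs at h) <;>
      simp only [rho, tau, ↓reduceIte] <;> (try split_ifs) <;> omega

theorem pred_inj {t : ℕ} {c : Fin 3} {p q : Pt} {s : Pt ⊕ ℕ} (hp : Valid t p)
    (hq : Valid t q) (h : pred t c p = some s) (h' : pred t c q = some s) : p = q := by
  rcases s with s | j
  · rcases fin_three c with rfl | rfl | rfl
    · rcases pred_zero hp h with ⟨rfl, rfl⟩ | ⟨rfl, rfl⟩ | ⟨rfl, rfl⟩ | ⟨i, h1, h2, rfl, rfl⟩ <;>
      rcases pred_zero hq h' with ⟨rfl, hs⟩ | ⟨rfl, hs⟩ | ⟨rfl, hs⟩ | ⟨j, h3, h4, rfl, hs⟩ <;>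
      simp only [e.injEq, reduceCtorEq] at hs ⊢ <;> omega
    · rcases pred_one hp h with ⟨rfl, rfl⟩ | ⟨rfl, rfl⟩ | ⟨rfl, rfl⟩ | ⟨rfl, rfl⟩ |
        ⟨i, h1, h2, rfl, rfl⟩ | ⟨rfl, rfl⟩ | ⟨i, h1, h2, rfl, rfl⟩ | ⟨rfl, rfl⟩ | ⟨rfl, rfl⟩ |
        ⟨i, h1, h2, rfl, rfl⟩ <;>
      rcases pred_one hq h' with ⟨rfl, hs⟩ | ⟨rfl, hs⟩ | ⟨rfl, hs⟩ | ⟨rfl, hs⟩ |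
        ⟨j, h3, h4, rfl, hs⟩ | ⟨rfl, hs⟩ | ⟨j, h3, h4, rfl, hs⟩ | ⟨rfl, hs⟩ | ⟨rfl, hs⟩ |
        ⟨j, h3, h4, rfl, hs⟩ <;>
      simp only [z.injEq, x.injEq, y.injEq, reduceCtorEq] at hs ⊢ <;> omega
    · rcases pred_two hp h with ⟨i, h1, rfl, rfl⟩ | ⟨i, h1, h2, rfl, rfl⟩ | ⟨rfl, rfl⟩ |
        ⟨i, h1, h2, rfl, rfl⟩ <;>
      rcases pred_two hq h' with ⟨j, h3, rfl, hs⟩ | ⟨j, h3, h4, rfl, hs⟩ | ⟨rfl, hs⟩ |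
        ⟨j, h3, h4, rfl, hs⟩ <;>
      simp only [z.injEq, x.injEq, y.injEq, e.injEq, reduceCtorEq] at hs ⊢ <;> omega
  · rcases fin_three c with rfl | rfl | rfl <;> rcases p with i | i | i | i | _ | _ <;>
    simp only [Valid] at hp <;>
      simp [pred] at h <;> (try split_ifs at h) <;> (try simp at h) <;>
      rcases q with k | k | k | k | _ | _ <;> simp only [Valid] at hq <;>
      simp [pred] at h' <;> (try split_ifs at h') <;> (try simp at h') <;>
      simp <;> omega

theorem pred_used {t : ℕ} {c : Fin 3} {p q : Pt} (hp : Valid t p)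
    (h : pred t c p = some (.inl q)) : pred t c q ≠ none := by
  rcases fin_three c with rfl | rfl | rfl
  · rcases pred_zero hp h with ⟨rfl, rfl⟩ | ⟨rfl, rfl⟩ | ⟨rfl, rfl⟩ | ⟨i, h1, h2, rfl, rfl⟩ <;>
      simp [pred]
  · rcases pred_one hp h with ⟨rfl, rfl⟩ | ⟨rfl, rfl⟩ | ⟨rfl, rfl⟩ | ⟨rfl, rfl⟩ |
      ⟨i, h1, h2, rfl, rfl⟩ | ⟨rfl, rfl⟩ | ⟨i, h1, h2, rfl, rfl⟩ | ⟨rfl, rfl⟩ | ⟨rfl, rfl⟩ |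
      ⟨i, h1, h2, rfl, rfl⟩ <;> simp [pred] <;> (try split_ifs) <;> simp
  · rcases pred_two hp h with ⟨i, h1, rfl, rfl⟩ | ⟨i, h1, h2, rfl, rfl⟩ | ⟨rfl, rfl⟩ |
      ⟨i, h1, h2, rfl, rfl⟩ <;> simp only [pred] <;> (try split_ifs) <;> simp

end Pt

/-- The valid points, numbered family by family of names. -/
def ofIndex {t : ℕ} : Fin (t + 3) ⊕ Fin (t + 1) ⊕ Fin (t + 1) ⊕ Fin (t + 2) ⊕ Bool →
    {p // Pt.Valid t p}
  | .inl i => ⟨.z i, Nat.lt_succ_iff.1 i.2⟩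
  | .inr (.inl i) => ⟨.x (i + 1), Nat.le_add_left 1 i, i.2⟩
  | .inr (.inr (.inl i)) => ⟨.y (i + 1), Nat.le_add_left 1 i, i.2⟩
  | .inr (.inr (.inr (.inl i))) => ⟨.e i, Nat.lt_succ_iff.1 i.2⟩
  | .inr (.inr (.inr (.inr true))) => ⟨.a, trivial⟩
  | .inr (.inr (.inr (.inr false))) => ⟨.b, trivial⟩

theorem ofIndex_bijective {t : ℕ} : Function.Bijective (ofIndex (t := t)) := by
  constructor
  · rintro (i | i | i | i | _ | _) (j | j | j | j | _ | _) h <;>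
      replace h := congrArg Subtype.val h <;> simp [ofIndex, Fin.ext_iff] at h ⊢ <;> exact h
  · rintro ⟨i | i | i | i | _ | _, h⟩
    · exact ⟨.inl ⟨i, Nat.lt_succ_iff.2 h⟩, rfl⟩
    · obtain ⟨i, rfl⟩ := Nat.exists_eq_add_of_le' h.1
      exact ⟨.inr (.inl ⟨i, h.2⟩), rfl⟩
    · obtain ⟨i, rfl⟩ := Nat.exists_eq_add_of_le' h.1
      exact ⟨.inr (.inr (.inl ⟨i, h.2⟩)), rfl⟩
    · exact ⟨.inr (.inr (.inr (.inl ⟨i, Nat.lt_succ_iff.2 h⟩))), rfl⟩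
    · exact ⟨.inr (.inr (.inr (.inr true))), rfl⟩
    · exact ⟨.inr (.inr (.inr (.inr false))), rfl⟩

/-- A layout with one, two and `t + 2` paths and with `4 (t + 2) + 1` points. -/
noncomputable def large (t : ℕ) (ht : 2 ≤ t) : Layout ![1, 2, t + 2] {p // Pt.Valid t p} :=
  restrict (Pt.Valid t) (Pt.pred t) Pt.last (Pt.tau t) (Pt.rho t)
    (fun _ _ _ => Pt.valid_pred ht)
    (fun c j hj => by
      rcases fin_three c with rfl | rfl | rfl
      · exact Nat.zero_le _
      · simp only [Pt.last]
        split_ifs <;> trivial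
      · exact Nat.lt_succ_iff.1 hj)
    (fun _ _ _ => Pt.pred_start)
    (fun _ _ _ _ => Pt.pred_inj)
    (fun _ _ _ => Pt.pred_used)
    (fun c i j hi hj h => by
      rcases fin_three c with rfl | rfl | rfl <;> simp at hi hj <;>
        simp [Pt.last] at h <;> (try split_ifs at h) <;>
        (try simp at h ⊢) <;> omega)
    (fun c j hj => by
      rcases fin_three c with rfl | rfl | rfl <;> simp only [Pt.last] <;> (try split_ifs) <;>
        simp [Pt.pred])
    (fun c j p hp hj h => by
      rcases fin_three c with rfl | rfl | rfl
      · rcases Pt.pred_zero hp h with ⟨rfl, hq⟩ | ⟨rfl, hq⟩ | ⟨rfl, hq⟩ | ⟨i, h1, h2, rfl, hq⟩ <;>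
          cases hq
        omega
      · rcases Pt.pred_one hp h with ⟨rfl, hq⟩ | ⟨rfl, hq⟩ | ⟨rfl, hq⟩ | ⟨rfl, hq⟩ |
          ⟨i, h1, h2, rfl, hq⟩ | ⟨rfl, hq⟩ | ⟨i, h1, h2, rfl, hq⟩ | ⟨rfl, hq⟩ | ⟨rfl, hq⟩ |
          ⟨i, h1, h2, rfl, hq⟩ <;> simp only [Pt.last] at hq <;> split_ifs at hq
      · rcases Pt.pred_two hp h with ⟨i, h1, rfl, hq⟩ | ⟨i, h1, h2, rfl, hq⟩ | ⟨rfl, hq⟩ |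
          ⟨i, h1, h2, rfl, hq⟩ <;> cases hq)
    (fun _ _ _ => Pt.tau_lt ht)
    (fun _ _ _ => Pt.rho_lt ht)
    (fun _ _ _ _ _ => Pt.rho_side ht)
    (fun _ _ _ _ => Pt.rho_off ht)
    (fun p hp => by
      rcases p with i | i | i | i | _ | _
      · exact ⟨1, 2, by decide, by simp only [Pt.pred]; split_ifs <;> simp,
          by simp only [Pt.pred]; split_ifs <;> simp⟩
      · exact ⟨1, 2, by decide, by simp [Pt.pred], by simp [Pt.pred]⟩
      · exact ⟨1, 2, by decide, by simp [Pt.pred], by simp [Pt.pred]⟩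
      · exact ⟨0, 2, by decide, by simp [Pt.pred], by simp [Pt.pred]⟩
      · exact ⟨0, 1, by decide, by simp [Pt.pred], by simp [Pt.pred]⟩
      · exact ⟨0, 1, by decide, by simp [Pt.pred], by simp [Pt.pred]⟩)
    ⟨.a, trivial⟩

theorem le_maxMinMergings_large (t : ℕ) (ht : 2 ≤ t) :
    ((4 * (t + 2) + 1 : ℕ) : ℕ∞) ≤ maxMinMergings ![1, 2, t + 2] := by
  let _ : Fintype {p // Pt.Valid t p} :=
    Fintype.ofBijective ofIndex ofIndex_bijective
  have hcard : Fintype.card {p // Pt.Valid t p} = 4 * (t + 2) + 1 := by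
    rw [← Fintype.card_of_bijective (ofIndex_bijective (t := t))]
    simp only [Fintype.card_sum, Fintype.card_fin, Fintype.card_bool]
    ring
  exact hcard ▸ (large t ht).card_le_maxMinMergings

end Layout

end Merging

theorem mainTheorem10 (n : ℕ) :
    ((n = 2 ∨ n = 3) → maxMinMergings ![1, 2, n] = ((4 * n : ℕ) : ℕ∞)) ∧
    ((n = 1 ∨ 4 ≤ n) → maxMinMergings ![1, 2, n] = ((4 * n + 1 : ℕ) : ℕ∞)) := by
  refine ⟨fun hn => le_antisymm (Merging.maxMinMergings_le_of_small hn) ?_,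
    fun hn => le_antisymm (Merging.maxMinMergings_le (by omega)) ?_⟩
  · rcases hn with rfl | rfl
    · simpa using Merging.Layout.eight.card_le_maxMinMergings
    · simpa using Merging.Layout.twelve.card_le_maxMinMergings
  · rcases hn with rfl | hn
    · simpa using Merging.Layout.five.card_le_maxMinMergings
    · obtain ⟨t, rfl⟩ := Nat.exists_eq_add_of_le' (show 2 ≤ n by omega)
      exact Merging.Layout.le_maxMinMergings_large t (by omega)
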